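/- Let $\sigma:\mathbb R\to[0,1]$ be non-decreasing and such that: (i) $\sigma$ is $C^\infty$ except possibly at finitely many points $r_1,\dots,r_k$; (ii) $\sigma$ and all its derivatives have finite left and right limits at each $r_j$; (iii) $r\mapsto r^2\sigma(r)$ belongs to $L^2((-\infty,0),\mathrm dr)$. Write $\mathrm d\sigma$ for the Stieltjes measure of $\sigma$, i.e. $\sigma'(r)\,\mathrm dr+\sum_j m_j\delta_{r_j}$ with $m_j=\sigma(r_j+0)-\sigma(r_j-0)$. Let $\mathrm{Ai}$ be the (entire) Airy function, and let $$K^{\mathrm{Ai}}(u,v)=\frac{\mathrm{Ai}(u)\mathrm{Ai}'(v)-\mathrm{Ai}'(u)\mathrm{Ai}(v)}{u-v}\quad(u\neq v),\qquad K^{\mathrm{Ai}}(u,u)=\mathrm{Ai}'(u)^2-u\,\mathrm{Ai}(u)^2$$ be the Airy kernel. For $x\in\mathbb R$, $t>0$ put $s(u)=\sigma(t^{-2/3}u+x/t)$, let $\mathbb K=\mathbb K_{\sigma,x,t}$ be the integral operator on $L^2(\mathbb R)$ with kernel $\sqrt{s(u)}\,K^{\mathrm{Ai}}(u,v)\sqrt{s(v)}$,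 and let $$Q_\sigma(x,t)=\det(1-\mathbb K_{\sigma,x,t})=\sum_{k\ge0}\frac{(-1)^k}{k!}\int_{\mathbb R^k}\det\big(s(u_i)K^{\mathrm{Ai}}(u_i,u_j)\big)_{i,j=1}^k\,\mathrm du_1\cdots\mathrm du_k .$$ Let $\mathbf f(u)=\sqrt{s(u)}\,(-\mathrm i\,\mathrm{Ai}'(u),\mathrm{Ai}(u))^\top$, $\mathbf h(v)=\sqrt{s(v)}\,(-\mathrm i\,\mathrm{Ai}(v),\mathrm{Ai}'(v))^\top$, $\mathbf F=(1-\mathbb K)^{-1}\mathbf f$ (componentwise), and for $\zeta\in\mathbb C\setminus\mathbb R$ $$Y(\zeta)=I-\int_{\mathbb R}\frac{\mathbf F(\xi)\mathbf h^\top(\xi)}{\xi-\zeta}\,\mathrm d\xi .$$ With $\omega=\mathrm e^{2\pi\mathrm i/3}$ let $$\Phi_{\mathrm{Ai}}(\zeta)=-\sqrt{2\pi}\begin{pmatrix}\mathrm{Ai}'(\zeta)&-\omega\mathrm{Ai}'(\omega^2\zeta)\\ \mathrm i\mathrm{Ai}(\zeta)&-\mathrm i\omega^2\mathrm{Ai}(\omega^2\zeta)\end{pmatrix}\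 (\operatorname{Im}\zeta>0),\qquad \Phi_{\mathrm{Ai}}(\zeta)=-\sqrt{2\pi}\begin{pmatrix}\mathrm{Ai}'(\zeta)&\omega^2\mathrm{Ai}'(\omega\zeta)\\ \mathrm i\mathrm{Ai}(\zeta)&\mathrm i\omega\mathrm{Ai}(\omega\zeta)\end{pmatrix}\ (\operatorname{Im}\zeta<0),$$ and, with $\zeta(z)=t^{2/3}z-t^{-1/3}x$, let $$\Psi(z)=\begin{pmatrix}1&\frac{\mathrm ix^2}{4t}\\0&1\end{pmatrix}\begin{pmatrix}t^{-1/6}&0\\0&t^{1/6}\end{pmatrix}Y(\zeta(z))\,\Phi_{\mathrm{Ai}}(\zeta(z)),\qquad \phi_\sigma(z;x,t)=\frac{\mathrm i}{\sqrt{2\pi}}\Psi_{21}(z)\qquad(z\in\mathbb C\setminus\mathbb R),$$ and for real $z$ let $\phi_\sigma(z;x,t)$ be the boundary value, i.e. the limit of $\phi_\sigma(w;x,t)$ as $w\to z$, $w\in\mathbb C\setminus\mathbb R$. Then, for all $x\in\mathbb R$ and $t>0$, these objects are well defined: the integrands in the series for $Q_\sigma$ are integrable, the series converges, and $Q_\sigma(x,t)>0$;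 $\mathbf F$ exists in $L^2(\mathbb R)$ and is unique; the boundary values $\phi_\sigma(z;x,t)$, $z\in\mathbb R$, exist and are real; and $\phi_\sigma^2(\cdot\,;x,t)$ is $\mathrm d\sigma$-integrable. Moreover $\log Q_\sigma(\cdot,t)$ is twice differentiable with $$\partial_x^2\log Q_\sigma(x,t)=-\frac1t\int_{\mathbb R}\phi_\sigma^2(r;x,t)\,\mathrm d\sigma(r),$$ and for every $z\in\mathbb R$ the function $x\mapsto\phi_\sigma(z;x,t)$ is twice differentiable and satisfies the integro-differential Painlevé II equation $$\partial_x^2\phi_\sigma(z;x,t)=\Big(z-\frac xt+\frac2t\int_{\mathbb R}\phi_\sigma^2(r;x,t)\,\mathrm d\sigma(r)\Big)\phi_\sigma(z;x,t).$$ -/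

import Mathlib

open MeasureTheory Filter Topology

noncomputable section

namespace AiryKdV

/-- The standing assumptions on `σ : ℝ → [0,1]`: non-decreasing, `C^∞` off a finite set, at whose
points all derivatives (including the zeroth) have finite one-sided limits, and
`r ↦ r² σ(r)` is square integrable on the negative half-line. -/
structure Assumptions (σ : ℝ → ℝ) : Prop where
  mem_Icc : ∀ r, σ r ∈ Set.Icc (0 : ℝ) 1
  mono : Monotone σ
  piecewise_smooth : ∃ S : Finset ℝ,
    ContDiffOn ℝ ((⊤ : ℕ∞) : WithTop ℕ∞) σ ((S : Set ℝ)ᶜ) ∧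
    ∀ r ∈ S, ∀ n : ℕ,
      (∃ l : ℝ, Tendsto (iteratedDeriv n σ) (𝓝[<] r) (𝓝 l)) ∧
      (∃ l : ℝ, Tendsto (iteratedDeriv n σ) (𝓝[>] r) (𝓝 l))
  decay : MemLp (fun r : ℝ => r ^ 2 * σ r) 2 (volume.restrict (Set.Iio 0))

/-- The measure `dσ` (Lebesgue–Stieltjes): it is `σ'(r) dr` plus the jump
`σ(r_j+0) - σ(r_j-0)` as a point mass at each discontinuity `r_j`. -/
def dMeasure {σ : ℝ → ℝ} (hσ : Assumptions σ) : Measure ℝ :=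
  hσ.mono.stieltjesFunction.measure

/-- The entire Airy function, `Ai(z) = (2πi)⁻¹ ∫ exp(s³/3 - z s) ds` over the upward
vertical line `s = 1 + i y`. -/
def airyC (z : ℂ) : ℂ :=
  (1 / (2 * Real.pi) : ℂ) *
    ∫ y : ℝ, Complex.exp ((1 + Complex.I * y) ^ 3 / 3 - z * (1 + Complex.I * y))

/-- The derivative of the entire Airy function. -/
def airyC' (z : ℂ) : ℂ := deriv airyC z

/-- `Ai` on the real line, where it is real-valued. -/
def airy (u : ℝ) : ℝ := (airyC u).re

/-- `Ai'` on the real line. -/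
def airy' (u : ℝ) : ℝ := (airyC' u).re

/-- The Airy kernel; its diagonal values are given by continuity, using `Ai''(u) = u Ai(u)`. -/
def airyKernel (u v : ℝ) : ℝ :=
  if u = v then airy' u ^ 2 - u * airy u ^ 2
  else (airy u * airy' v - airy' u * airy v) / (u - v)

/-- The rescaled symbol `σ(t^{-2/3} u + x / t)`. -/
def symbol (σ : ℝ → ℝ) (x t u : ℝ) : ℝ := σ (t ^ (-(2 / 3) : ℝ) * u + x / t)

/-- The kernel `√σ(t^{-2/3} u + x/t) K^Ai(u,v) √σ(t^{-2/3} v + x/t)`. -/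
def kernel (σ : ℝ → ℝ) (x t u v : ℝ) : ℝ :=
  √(symbol σ x t u) * airyKernel u v * √(symbol σ x t v)

/-- The `k`-point integrand of the Fredholm series, `det (σ(t^{-2/3} u_i + x/t) K^Ai(u_i,u_j))`. -/
def fredholmIntegrand (σ : ℝ → ℝ) (x t : ℝ) (k : ℕ) (u : Fin k → ℝ) : ℝ :=
  (Matrix.of fun i j : Fin k => symbol σ x t (u i) * airyKernel (u i) (u j)).det

/-- The `k`-th term of the Fredholm series. -/
def fredholmTerm (σ : ℝ → ℝ) (x t : ℝ) (k : ℕ) : ℝ :=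
  (-1) ^ k / (k.factorial : ℝ) * ∫ u : Fin k → ℝ, fredholmIntegrand σ x t k u

/-- The Fredholm determinant `Q_σ(x,t) = det(1 - K_{σ,x,t})`. -/
def Q (σ : ℝ → ℝ) (x t : ℝ) : ℝ := ∑' k : ℕ, fredholmTerm σ x t k

/-- The vector `f(u) = √σ(t^{-2/3} u + x/t) (-i Ai'(u), Ai(u))`. -/
def fVec (σ : ℝ → ℝ) (x t : ℝ) (i : Fin 2) (u : ℝ) : ℂ :=
  (√(symbol σ x t u) : ℂ) * ![-Complex.I * airy' u, (airy u : ℂ)] i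

/-- The vector `h(v) = √σ(t^{-2/3} v + x/t) (-i Ai(v), Ai'(v))`. -/
def hVec (σ : ℝ → ℝ) (x t : ℝ) (i : Fin 2) (v : ℝ) : ℂ :=
  (√(symbol σ x t v) : ℂ) * ![-Complex.I * airy v, (airy' v : ℂ)] i

/-- `F ∈ L²(ℝ)` and `(1 - K) F = f` in `L²(ℝ)`, where `K` is the integral operator with
kernel `kernel σ x t`. -/
def SolvesResolvent (σ : ℝ → ℝ) (x t : ℝ) (f F : ℝ → ℂ) : Prop :=
  MemLp F 2 volume ∧ ∀ᵐ u : ℝ, F u - ∫ v : ℝ, (kernel σ x t u v : ℂ) * F v = f u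

/-- The components of `F = (1 - K_{σ,x,t})⁻¹ f`. -/
def FVec (σ : ℝ → ℝ) (x t : ℝ) (i : Fin 2) : ℝ → ℂ :=
  Classical.epsilon fun F => SolvesResolvent σ x t (fVec σ x t i) F

/-- `Y(ζ) = I - ∫ F(ξ) h(ξ)ᵀ / (ξ - ζ) dξ`, for `ζ ∈ ℂ \ ℝ`. -/
def Y (σ : ℝ → ℝ) (x t : ℝ) (ζ : ℂ) : Matrix (Fin 2) (Fin 2) ℂ :=
  1 - Matrix.of fun i j => ∫ ξ : ℝ, FVec σ x t i ξ * hVec σ x t j ξ / ((ξ : ℂ) - ζ)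

/-- The primitive cube root of unity `exp(2πi/3)`. -/
def ω : ℂ := Complex.exp (2 * Real.pi * Complex.I / 3)

/-- The Airy model matrix, for `ζ ∈ ℂ \ ℝ`. -/
def PhiAi (ζ : ℂ) : Matrix (Fin 2) (Fin 2) ℂ :=
  (-(√(2 * Real.pi)) : ℂ) •
    if 0 < ζ.im then
      !![airyC' ζ, -ω * airyC' (ω ^ 2 * ζ);
         Complex.I * airyC ζ, -Complex.I * ω ^ 2 * airyC (ω ^ 2 * ζ)]
    else
      !![airyC' ζ, ω ^ 2 * airyC' (ω * ζ);
         Complex.I * airyC ζ, Complex.I * ω * airyC (ω * ζ)]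

/-- The affine change of variable `ζ(z) = t^{2/3} z - t^{-1/3} x`. -/
def zeta (x t : ℝ) (z : ℂ) : ℂ :=
  ((t ^ (2 / 3 : ℝ) : ℝ) : ℂ) * z - ((t ^ (-(1 / 3) : ℝ) * x : ℝ) : ℂ)

/-- The solution `Ψ` of the Riemann–Hilbert problem associated with `σ`, for `z ∈ ℂ \ ℝ`. -/
def Psi (σ : ℝ → ℝ) (x t : ℝ) (z : ℂ) : Matrix (Fin 2) (Fin 2) ℂ :=
  !![1, Complex.I * x ^ 2 / (4 * t); 0, 1] *
    !![((t ^ (-(1 / 6) : ℝ) : ℝ) : ℂ), 0; 0, ((t ^ (1 / 6 : ℝ) : ℝ) : ℂ)] *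
    Y σ x t (zeta x t z) * PhiAi (zeta x t z)

/-- The wave function off the real axis. With
`Θ = e^{πi/4 σ₃} [[1, -i p], [0, 1]] Ψ e^{-πi/4 σ₃}` one sets `φ = -Θ₂₁ / √(2π)`, and
`Θ₂₁ = e^{-πi/4} Ψ₂₁ e^{-πi/4} = -i Ψ₂₁` whatever `p` is. -/
def phiC (σ : ℝ → ℝ) (z : ℂ) (x t : ℝ) : ℂ :=
  Complex.I / (√(2 * Real.pi) : ℂ) * Psi σ x t z 1 0

/-- The wave function `φ_σ(z; x, t)` for real `z`: the boundary value on the real axis of the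
function `phiC`, whose values above and below the axis match there. -/
def phi (σ : ℝ → ℝ) (z x t : ℝ) : ℝ :=
  (limUnder (𝓝[{w : ℂ | w.im ≠ 0}] (z : ℂ)) fun w => phiC σ w x t).re

end AiryKdV

end

noncomputable section

namespace AiryKdV

/-! ### The Airy function -/

/-! Put v = u + τ with τ = t^(-1/3) x. The symbol becomes `scaled σ t`, which is free of x, and x
survives only in the translated kernel K(v - τ, w - τ). Since K(u, v) = ∫ Ai(u + y) Ai(v + y) dy
over y > 0, the operator is K_τ = ∫ g_s ⊗ g_s ds over s ≤ τ, where g_s = √σ Ai(· - s). Hence dK_τ/dτ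
= g_τ ⊗ g_τ has rank one (`hasDerivAt_airyOp`), and everything built from the resolvent can be
differentiated explicitly.

Invertibility of 1 - K_τ (`isUnit_one_sub_airyOp`): K_τ is compact, so it is enough to exclude K_τ f
= f. The Airy transform is an L² contraction (`eLpNorm_airy_transform_le`), so c(s) = ⟨g_s, f⟩
satisfies ‖f‖² = ∫_{s ≤ τ} c² ≤ ∫ c² ≤ ∫ σ f² ≤ ‖f‖². Equality forces c = 0 on (τ, ∞) and f = 0
where σ < 1, in particular far to the left. Then c extends to an entire function, so c = 0
everywhere and f = 0.

Put φ = (1 - K)⁻¹ g, q = ⟨g, φ⟩, p = ⟨g', φ⟩, Φ(z) = Ai(z - τ) + ⟨κ_z, φ⟩ and X(z) = Ai'(z - τ) +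
⟨(1 - K)⁻¹ κ_z, g'⟩, where g' = √σ Ai'(· - τ) and κ_z = K(z - τ, · - τ) √σ. The rank one rule gives
q' = q² - 2p and Φ' = qΦ - X. Differentiating X produces v g(v), which is handled by the rank two
commutator of K with multiplication by v (`integral_mul_airyVec`); the outcome is X' = -(z - τ)Φ +
2pΦ - qX, and therefore Φ'' = (z - τ + 2q')Φ (`hasDerivAt_deriv_wave`).

The identity q' = ∫ Φ² dσ (`waveQ_sq_sub_eq_integral`) needs no smoothness of σ. Translating by h
turns the problem at τ + h into the problem at τ with symbol σ(· + h), and pairing the two integral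
equations gives q(τ + h) - q(τ) = ∫ Φ(v, τ) Φ(v + h, τ + h) (σ(v + h) - σ(v)) dv. The increment of σ
is the dσ-mass of an interval; exchange the integrals, divide by h and let h tend to 0.

For the determinant, Fredholm's recursion sums to the series identity Σ = det(1 - K) φ
(`tsum_fredL2`), and differentiation term by term gives (log det)' = -q (`hasDerivAt_fredSum`).
Positivity follows from this linear equation, because the determinant is close to 1 as τ → -∞.

Finally, the Wronskian identity turns the second row of Y Φ_Ai into a continuous function on ℂ that
restricts to Φ on the real line (`phiC_eq`, `waveC_ofReal`). So φ_σ(z; x, t) = t^(1/6) Φ(t^(2/3) z,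
t^(-1/3) x), and the theorem follows by the chain rule. -/

lemma integrable_exp_neg_sq_add_abs {a : ℝ} (ha : 0 < a) (b d : ℝ) :
    Integrable (fun y : ℝ => Real.exp (d - a * y ^ 2 + b * |y|)) := by
  have h := (integrable_exp_neg_mul_sq (half_pos ha)).const_mul (Real.exp (d + b ^ 2 / (2 * a)))
  refine h.mono' (by fun_prop) (Eventually.of_forall fun y => ?_)
  rw [Real.norm_of_nonneg (Real.exp_pos _).le, ← Real.exp_add]
  refine Real.exp_le_exp.2 ?_
  -- Completing the square: the linear term b|y| costs half of the Gaussian and a constant.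
  have h1 : 0 ≤ (a * |y| - b) ^ 2 / (2 * a) := by positivity
  have h2 : (a * |y| - b) ^ 2 / (2 * a) = a / 2 * y ^ 2 - b * |y| + b ^ 2 / (2 * a) := by
    rw [← sq_abs y]; field_simp; ring
  linarith

/-- The integrand of the Airy integral along the vertical line with abscissa `c`. -/
def airyExp (c : ℝ) (z : ℂ) (y : ℝ) : ℂ :=
  Complex.exp ((c + Complex.I * y) ^ 3 / 3 - z * (c + Complex.I * y))

/-- The real part of s³/3 at s = c + iy is c³/3 - c y², so a positive abscissa makes the Airy
integral absolutely convergent with Gaussian decay. -/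
lemma norm_airyExp (c : ℝ) (z : ℂ) (y : ℝ) :
    ‖airyExp c z y‖ = Real.exp (c ^ 3 / 3 - c * y ^ 2 - z.re * c + z.im * y) := by
  rw [airyExp, Complex.norm_exp]
  congr 1
  have h : ((c : ℂ) + Complex.I * y) ^ 3 / 3 - z * (c + Complex.I * y) =
      ((c ^ 3 / 3 - c * y ^ 2 : ℝ) : ℂ) + ((c ^ 2 * y - y ^ 3 / 3 : ℝ) : ℂ) * Complex.I
        - z * (c + Complex.I * y) := by
    push_cast
    linear_combination (c * y ^ 2 + Complex.I * y ^ 3 / 3 : ℂ) * Complex.I_sq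
  rw [h]
  simp only [Complex.sub_re, Complex.add_re, Complex.mul_re, Complex.mul_im, Complex.ofReal_re,
    Complex.ofReal_im, Complex.I_re, Complex.I_im, Complex.add_im]
  ring

lemma norm_vertical_le (c y : ℝ) : ‖(c : ℂ) + Complex.I * y‖ ≤ Real.exp (|c| + |y|) := by
  calc ‖(c : ℂ) + Complex.I * y‖ ≤ ‖(c : ℂ)‖ + ‖Complex.I * y‖ := norm_add_le _ _
    _ = |c| + |y| := by simp
    _ ≤ _ := by linarith [Real.add_one_le_exp (|c| + |y|)]

lemma continuous_airyExp (c : ℝ) (z : ℂ) : Continuous (airyExp c z) := by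
  unfold airyExp; fun_prop

/-- The moments of the Airy integrand, which are the successive derivatives of `Ai`. -/
def airyMoment (n : ℕ) (z : ℂ) : ℂ :=
  (1 / (2 * Real.pi) : ℂ) * ∫ y : ℝ, (-(((1 : ℝ) : ℂ) + Complex.I * y)) ^ n * airyExp 1 z y

lemma norm_moment_integrand_le (n : ℕ) {z : ℂ} {B : ℝ} (hB : |z.im| ≤ B) (y : ℝ) :
    ‖(-(((1 : ℝ) : ℂ) + Complex.I * y)) ^ n * airyExp 1 z y‖ ≤
      Real.exp (-z.re) * Real.exp ((n + 1 / 3) - 1 * y ^ 2 + (n + B) * |y|) := by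
  rw [norm_mul, norm_pow, norm_neg, norm_airyExp, ← Real.exp_add]
  calc _ ≤ Real.exp (|1| + |y|) ^ n *
        Real.exp (1 ^ 3 / 3 - 1 * y ^ 2 - z.re * 1 + z.im * y) := by
        gcongr; exact norm_vertical_le 1 y
    _ = Real.exp (n * (|1| + |y|) + (1 ^ 3 / 3 - 1 * y ^ 2 - z.re * 1 + z.im * y)) := by
        rw [Real.exp_add (n * (|1| + |y|)), Real.exp_nat_mul]
    _ ≤ _ := by
        refine Real.exp_le_exp.2 ?_
        have h1 : z.im * y ≤ B * |y| :=
          (le_abs_self _).trans (by rw [abs_mul]; gcongr)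
        have h2 : |(1 : ℝ)| = 1 := abs_one
        rw [h2]
        nlinarith

lemma integrable_moment (n : ℕ) (z : ℂ) :
    Integrable (fun y : ℝ => (-(((1 : ℝ) : ℂ) + Complex.I * y)) ^ n * airyExp 1 z y) := by
  refine ((integrable_exp_neg_sq_add_abs one_pos (n + |z.im|) (n + 1 / 3)).const_mul
    (Real.exp (-z.re))).mono' ?_ (Eventually.of_forall fun y => norm_moment_integrand_le n le_rfl y)
  have := continuous_airyExp 1 z
  exact (by fun_prop : Continuous _).aestronglyMeasurable

lemma hasDerivAt_airyMoment (n : ℕ) (z : ℂ) :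
    HasDerivAt (airyMoment n) (airyMoment (n + 1) z) z := by
  unfold airyMoment
  refine HasDerivAt.const_mul _ ?_
  have hc := continuous_airyExp 1
  refine (hasDerivAt_integral_of_dominated_loc_of_deriv_le (s := Metric.ball z 1)
    (F' := fun z y => (-(((1 : ℝ) : ℂ) + Complex.I * y)) ^ (n + 1) * airyExp 1 z y)
    (bound := fun y => Real.exp (|z.re| + 1) * Real.exp (((n + 1 : ℕ) + 1 / 3) - 1 * y ^ 2
      + ((n + 1 : ℕ) + (|z.im| + 1)) * |y|))
    (Metric.ball_mem_nhds z one_pos)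
    (Eventually.of_forall fun w => (integrable_moment n w).aestronglyMeasurable)
    (integrable_moment n z) (integrable_moment (n + 1) z).aestronglyMeasurable
    (Eventually.of_forall fun y w hw => ?_)
    ((integrable_exp_neg_sq_add_abs one_pos _ _).const_mul _)
    (Eventually.of_forall fun y w _ => ?_)).2
  · have hw' : ‖w - z‖ < 1 := by simpa [dist_eq_norm] using hw
    have hre : |w.re - z.re| ≤ 1 := by
      simpa using (Complex.abs_re_le_norm (w - z)).trans hw'.le
    have him : |w.im - z.im| ≤ 1 := by
      simpa using (Complex.abs_im_le_norm (w - z)).trans hw'.le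
    have h1 : |w.im| ≤ |z.im| + 1 := by
      have := abs_add_le (w.im - z.im) z.im
      rw [sub_add_cancel] at this; linarith
    refine (norm_moment_integrand_le (n + 1) h1 y).trans ?_
    gcongr
    have := abs_le.1 hre
    have := neg_abs_le z.re
    linarith
  · have h1 : HasDerivAt (fun w : ℂ => airyExp 1 w y)
        (-(((1 : ℝ) : ℂ) + Complex.I * y) * airyExp 1 w y) w := by
      unfold airyExp
      have := (((hasDerivAt_id w).mul_const (((1 : ℝ) : ℂ) + Complex.I * y)).const_sub
        ((((1 : ℝ) : ℂ) + Complex.I * y) ^ 3 / 3)).cexp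
      exact this.congr_deriv (by simp only [id]; ring)
    exact (h1.const_mul ((-(((1 : ℝ) : ℂ) + Complex.I * y)) ^ n)).congr_deriv (by ring)

lemma airyMoment_zero : airyMoment 0 = airyC := by
  funext z; simp [airyMoment, airyC, airyExp]

lemma airyMoment_one : airyMoment 1 = airyC' := by
  funext z
  rw [airyC', ← airyMoment_zero]
  exact (hasDerivAt_airyMoment 0 z).deriv.symm

lemma hasDerivAt_airyExp (c : ℝ) (z : ℂ) (y : ℝ) :
    HasDerivAt (airyExp c z) (Complex.I * (((c + Complex.I * y) ^ 2 - z) * airyExp c z y)) y := by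
  unfold airyExp
  have h1 : HasDerivAt (fun y : ℝ => (c : ℂ) + Complex.I * y) Complex.I y := by
    simpa using ((Complex.ofRealCLM.hasDerivAt (x := y)).const_mul Complex.I).const_add (c : ℂ)
  have := (((h1.fun_pow 3).div_const 3).fun_sub (h1.const_mul z)).cexp
  exact this.congr_deriv (by push_cast; ring)

/-- The Airy equation: (s² - z) exp(s³/3 - zs) is an exact derivative along the contour, so it
integrates to zero. -/
lemma airyMoment_two (z : ℂ) : airyMoment 2 z = z * airyMoment 0 z := by
  have h := integral_eq_zero_of_hasDerivAt_of_integrable (hasDerivAt_airyExp 1 z)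
    (((integrable_moment 2 z).sub ((integrable_moment 0 z).const_mul z)).const_mul Complex.I
      |>.congr (Eventually.of_forall fun y => by simp; ring)) (by simpa using integrable_moment 0 z)
  rw [integral_const_mul] at h
  have h2 : ∫ y : ℝ, (((1 : ℝ) : ℂ) + Complex.I * y) ^ 2 * airyExp 1 z y
      - z * airyExp 1 z y = 0 := by
    have := (mul_eq_zero.1 h).resolve_left Complex.I_ne_zero
    rw [← this]; congr 1; funext y; ring
  rw [integral_sub (by simpa only [neg_sq] using integrable_moment 2 z)
    (by simpa using (integrable_moment 0 z).const_mul z), integral_const_mul, sub_eq_zero] at h2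
  simp only [airyMoment, neg_sq, pow_zero, one_mul]
  rw [h2]; ring

lemma hasDerivAt_airyC (z : ℂ) : HasDerivAt airyC (airyC' z) z := by
  rw [← airyMoment_zero, ← airyMoment_one]; exact hasDerivAt_airyMoment 0 z

lemma hasDerivAt_airyC' (z : ℂ) : HasDerivAt airyC' (z * airyC z) z := by
  rw [← airyMoment_zero, ← airyMoment_one, ← airyMoment_two]; exact hasDerivAt_airyMoment 1 z

lemma differentiable_airyC : Differentiable ℂ airyC := fun z => (hasDerivAt_airyC z).differentiableAt

lemma continuous_airyC : Continuous airyC := differentiable_airyC.continuous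

lemma continuous_airyC' : Continuous airyC' :=
  continuous_iff_continuousAt.2 fun z => (hasDerivAt_airyC' z).continuousAt

lemma exists_norm_airyMoment_le (n : ℕ) (B : ℝ) :
    ∃ C, 0 < C ∧ ∀ z : ℂ, |z.im| ≤ B → ‖airyMoment n z‖ ≤ C * Real.exp (-z.re) := by
  have hi := integrable_exp_neg_sq_add_abs one_pos (n + B) (n + 1 / 3)
  set D := ∫ y : ℝ, Real.exp ((n + 1 / 3) - 1 * y ^ 2 + (n + B) * |y|) with hD
  have hD0 : 0 ≤ D := integral_nonneg fun y => (Real.exp_pos _).le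
  refine ⟨‖(1 / (2 * Real.pi) : ℂ)‖ * D + 1, by positivity, fun z hz => ?_⟩
  rw [airyMoment, norm_mul]
  have h1 : ‖∫ y : ℝ, (-(((1 : ℝ) : ℂ) + Complex.I * y)) ^ n * airyExp 1 z y‖
      ≤ Real.exp (-z.re) * D := by
    rw [hD, ← integral_const_mul]
    exact norm_integral_le_of_norm_le (hi.const_mul _)
      (Eventually.of_forall fun y => norm_moment_integrand_le n hz y)
  have h2 := Real.exp_pos (-z.re)
  have h3 := mul_le_mul_of_nonneg_left h1 (norm_nonneg (1 / (2 * Real.pi) : ℂ))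
  nlinarith

/-- `Ai` and `Ai'` decay exponentially to the right in every horizontal strip. -/
lemma exists_norm_airyC_le (B : ℝ) :
    ∃ C, 0 < C ∧ ∀ z : ℂ, |z.im| ≤ B →
      ‖airyC z‖ ≤ C * Real.exp (-z.re) ∧ ‖airyC' z‖ ≤ C * Real.exp (-z.re) := by
  obtain ⟨C₀, h₀, h₀'⟩ := exists_norm_airyMoment_le 0 B
  obtain ⟨C₁, h₁, h₁'⟩ := exists_norm_airyMoment_le 1 B
  refine ⟨C₀ + C₁, by positivity, fun z hz => ⟨?_, ?_⟩⟩
  · rw [← airyMoment_zero]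
    exact (h₀' z hz).trans (by gcongr; linarith)
  · rw [← airyMoment_one]
    exact (h₁' z hz).trans (by gcongr; linarith)

/-- Conjugation amounts to the reflection y ↦ -y of the contour, so Ai and Ai' are real on the real
line. -/
lemma conj_airyMoment (n : ℕ) (x : ℝ) :
    (starRingEnd ℂ) (airyMoment n x) = airyMoment n x := by
  unfold airyMoment
  rw [map_mul, ← integral_conj]
  conv_rhs => rw [← integral_neg_eq_self]
  congr 1
  · simp [Complex.conj_ofNat]
  · congr 1
    funext y
    rw [map_mul, map_pow]
    congr 1
    · simp
    · rw [airyExp, airyExp, ← Complex.exp_conj]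
      simp [Complex.conj_ofNat]

lemma ofReal_airy (u : ℝ) : ((airy u : ℝ) : ℂ) = airyC u := by
  rw [airy, ← airyMoment_zero]
  exact Complex.conj_eq_iff_re.1 (conj_airyMoment 0 u)

lemma ofReal_airy' (u : ℝ) : ((airy' u : ℝ) : ℂ) = airyC' u := by
  rw [airy', ← airyMoment_one]
  exact Complex.conj_eq_iff_re.1 (conj_airyMoment 1 u)

lemma hasDerivAt_airy (u : ℝ) : HasDerivAt airy (airy' u) u :=
  (hasDerivAt_airyC u).real_of_complex

lemma hasDerivAt_airy' (u : ℝ) : HasDerivAt airy' (u * airy u) u := by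
  have := (hasDerivAt_airyC' u).real_of_complex
  rwa [← ofReal_airy, ← Complex.ofReal_mul, Complex.ofReal_re] at this

@[fun_prop]
lemma continuous_airy : Continuous airy :=
  continuous_iff_continuousAt.2 fun z => (hasDerivAt_airy z).continuousAt

@[fun_prop]
lemma continuous_airy' : Continuous airy' :=
  continuous_iff_continuousAt.2 fun z => (hasDerivAt_airy' z).continuousAt

lemma exists_abs_airy_le :
    ∃ C, 0 < C ∧ ∀ u : ℝ, |airy u| ≤ C * Real.exp (-u) ∧ |airy' u| ≤ C * Real.exp (-u) := by
  obtain ⟨C, hC, h⟩ := exists_norm_airyC_le 0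
  refine ⟨C, hC, fun u => ?_⟩
  have := h u (by simp)
  rwa [← ofReal_airy, ← ofReal_airy', Complex.norm_real, Complex.norm_real] at this

/-! ### The contour can be moved -/

/-- Cauchy's theorem in differential form: the integrand is holomorphic in c + iy, so its
c-derivative is -i times its y-derivative, which integrates to zero. A free abscissa is needed for
the limit c → 0 in the Airy transform. -/
lemma hasDerivAt_integral_airyExp {c₀ : ℝ} (hc : 0 < c₀) (z : ℂ) :
    HasDerivAt (fun c : ℝ => ∫ y : ℝ, airyExp c z y) 0 c₀ := by
  set bd : ℝ → ℝ := fun y =>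
    (1 + ‖z‖) * Real.exp (4 * c₀ + (2 * c₀) ^ 3 / 3 + |z.re| * (2 * c₀) - c₀ / 2 * y ^ 2
      + (2 + |z.im|) * |y|) with hbd
  have hint : ∀ c, c₀ / 2 < c → c < 2 * c₀ → ∀ y,
      ‖((c + Complex.I * y) ^ 2 - z) * airyExp c z y‖ ≤ bd y ∧ ‖airyExp c z y‖ ≤ bd y := by
    intro c h1 h2 y
    have hcpos : 0 < c := by linarith
    have e1 : ‖((c : ℂ) + Complex.I * y) ^ 2 - z‖ ≤ (1 + ‖z‖) * Real.exp (4 * c₀ + 2 * |y|) := by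
      have : ‖((c : ℂ) + Complex.I * y) ^ 2‖ ≤ Real.exp (4 * c₀ + 2 * |y|) := by
        rw [norm_pow]
        calc _ ≤ Real.exp (|c| + |y|) ^ 2 := by gcongr; exact norm_vertical_le c y
          _ = Real.exp (2 * (|c| + |y|)) := by rw [← Real.exp_nat_mul]; norm_num
          _ ≤ _ := by rw [abs_of_pos hcpos]; gcongr; linarith
      have h3 : (1 : ℝ) ≤ Real.exp (4 * c₀ + 2 * |y|) := Real.one_le_exp (by positivity)
      calc _ ≤ ‖((c : ℂ) + Complex.I * y) ^ 2‖ + ‖z‖ := norm_sub_le _ _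
        _ ≤ _ := by nlinarith [norm_nonneg z]
    have e2 : ‖airyExp c z y‖ ≤ Real.exp ((2 * c₀) ^ 3 / 3 + |z.re| * (2 * c₀) - c₀ / 2 * y ^ 2
        + |z.im| * |y|) := by
      rw [norm_airyExp]
      refine Real.exp_le_exp.2 ?_
      have a1 : c ^ 3 ≤ (2 * c₀) ^ 3 := by gcongr
      have a2 : -(z.re * c) ≤ |z.re| * (2 * c₀) := by
        calc -(z.re * c) ≤ |z.re * c| := neg_le_abs _
          _ = |z.re| * c := by rw [abs_mul, abs_of_pos hcpos]
          _ ≤ _ := by gcongr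
      have a3 : z.im * y ≤ |z.im| * |y| := by rw [← abs_mul]; exact le_abs_self _
      have a4 : c₀ / 2 * y ^ 2 ≤ c * y ^ 2 := by gcongr
      linarith
    constructor
    · rw [norm_mul]
      refine (mul_le_mul e1 e2 (norm_nonneg _) (by positivity)).trans (le_of_eq ?_)
      rw [hbd, mul_assoc, ← Real.exp_add]
      ring_nf
    · refine e2.trans ?_
      calc _ ≤ 1 * Real.exp (4 * c₀ + (2 * c₀) ^ 3 / 3 + |z.re| * (2 * c₀) - c₀ / 2 * y ^ 2
            + (2 + |z.im|) * |y|) := by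
            rw [one_mul]; refine Real.exp_le_exp.2 ?_
            nlinarith [abs_nonneg y]
        _ ≤ _ := by refine mul_le_mul_of_nonneg_right ?_ (Real.exp_pos _).le; linarith [norm_nonneg z]
  have hbi : Integrable bd := (integrable_exp_neg_sq_add_abs (half_pos hc) _ _).const_mul _
  have hcont := fun c => continuous_airyExp c z
  have hI0 : Integrable (airyExp c₀ z) := hbi.mono' (hcont c₀).aestronglyMeasurable
    (Eventually.of_forall fun y => (hint c₀ (by linarith) (by linarith) y).2)
  have key := hasDerivAt_integral_of_dominated_loc_of_deriv_le (𝕜 := ℝ) (μ := volume)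
    (F := fun c y => airyExp c z y) (x₀ := c₀) (s := Set.Ioo (c₀ / 2) (2 * c₀)) (bound := bd)
    (F' := fun c y => ((c + Complex.I * y) ^ 2 - z) * airyExp c z y)
    (Ioo_mem_nhds (by linarith) (by linarith))
    (Eventually.of_forall fun c => (hcont c).aestronglyMeasurable) hI0
    (by have := hcont c₀; exact (by fun_prop : Continuous _).aestronglyMeasurable)
    (Eventually.of_forall fun y c hc => (hint c hc.1 hc.2 y).1) hbi
    (Eventually.of_forall fun y c _ => by
      unfold airyExp
      have h1 : HasDerivAt (fun c : ℝ => (c : ℂ) + Complex.I * y) 1 c := by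
        simpa using (Complex.ofRealCLM.hasDerivAt (x := c)).add_const (Complex.I * y)
      have := (((h1.fun_pow 3).div_const 3).fun_sub (h1.const_mul z)).cexp
      exact this.congr_deriv (by push_cast; ring))
  have h0 := integral_eq_zero_of_hasDerivAt_of_integrable (hasDerivAt_airyExp c₀ z)
    (key.1.const_mul _) hI0
  rw [integral_const_mul] at h0
  rw [← (mul_eq_zero.1 h0).resolve_left Complex.I_ne_zero]
  exact key.2

lemma airyC_eq_of_pos {c : ℝ} (hc : 0 < c) (z : ℂ) :
    airyC z = (1 / (2 * Real.pi) : ℂ) * ∫ y : ℝ, airyExp c z y := by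
  have h : ∫ y : ℝ, airyExp c z y = ∫ y : ℝ, airyExp 1 z y := by
    refine isOpen_Ioi.is_const_of_deriv_eq_zero (𝕜 := ℝ) (s := Set.Ioi (0 : ℝ))
      (f := fun c => ∫ y : ℝ, airyExp c z y)
      isPreconnected_Ioi (fun c hc =>
        (hasDerivAt_integral_airyExp hc z).differentiableAt.differentiableWithinAt)
      (fun c hc => (hasDerivAt_integral_airyExp hc z).deriv) hc (Set.mem_Ioi.2 one_pos)
  rw [h, airyC]; simp [airyExp]


/-! ### The Airy kernel as an integral -/

lemma integrableOn_airyC_mul (ζ ξ : ℂ) :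
    IntegrableOn (fun y : ℝ => airyC (ζ + y) * airyC (ξ + y)) (Set.Ioi 0) := by
  obtain ⟨C, hC, h⟩ := exists_norm_airyC_le (max |ζ.im| |ξ.im|)
  have hi : IntegrableOn (fun y : ℝ => C * Real.exp (-ζ.re) * (C * Real.exp (-ξ.re)) *
      Real.exp (-2 * y)) (Set.Ioi 0) :=
    (exp_neg_integrableOn_Ioi 0 two_pos).const_mul _
  refine hi.mono' ?_ (Eventually.of_forall fun y => ?_)
  · have := continuous_airyC
    exact (by fun_prop : Continuous _).aestronglyMeasurable
  · rw [norm_mul]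
    have h1 := (h (ζ + y) (by simp)).1
    have h2 := (h (ξ + y) (by simp)).1
    calc _ ≤ (C * Real.exp (-(ζ + y).re)) * (C * Real.exp (-(ξ + y).re)) := by gcongr
      _ = _ := by
        rw [show -2 * y = -y + -y by ring, Real.exp_add]
        simp only [Complex.add_re, Complex.ofReal_re, neg_add, Real.exp_add]
        ring

lemma tendsto_airyC_atTop (ζ : ℂ) :
    Tendsto (fun y : ℝ => airyC (ζ + y)) atTop (𝓝 0) ∧
      Tendsto (fun y : ℝ => airyC' (ζ + y)) atTop (𝓝 0) := by
  obtain ⟨C, hC, h⟩ := exists_norm_airyC_le |ζ.im|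
  have ht : Tendsto (fun y : ℝ => C * Real.exp (-(ζ + y).re)) atTop (𝓝 0) := by
    have : Tendsto (fun y : ℝ => (ζ + y).re) atTop atTop := by
      simpa using tendsto_atTop_add_const_left atTop ζ.re tendsto_id
    simpa using ((Real.tendsto_exp_neg_atTop_nhds_zero).comp this).const_mul C
  exact ⟨squeeze_zero_norm (fun y => (h (ζ + y) (by simp)).1) ht,
    squeeze_zero_norm (fun y => (h (ζ + y) (by simp)).2) ht⟩

lemma hasDerivAt_airyC_add (ζ : ℂ) (y : ℝ) :
    HasDerivAt (fun y : ℝ => airyC (ζ + y)) (airyC' (ζ + y)) y ∧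
      HasDerivAt (fun y : ℝ => airyC' (ζ + y)) ((ζ + y) * airyC (ζ + y)) y :=
  ⟨((hasDerivAt_airyC (ζ + y)).comp_const_add ζ (y : ℂ)).comp_ofReal,
    ((hasDerivAt_airyC' (ζ + y)).comp_const_add ζ (y : ℂ)).comp_ofReal⟩

/-- By Ai'' = z Ai, the y-derivative of the Wronskian at (ζ + y, ξ + y) is (ξ - ζ) Ai Ai, and the
Wronskian vanishes as y → ∞. Complex arguments are allowed because the identity is also used off the
real axis, in `phiC_eq`. -/
lemma wronskian_eq_integral (ζ ξ : ℂ) :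
    airyC ζ * airyC' ξ - airyC' ζ * airyC ξ =
      (ζ - ξ) * ∫ y in Set.Ioi (0 : ℝ), airyC (ζ + y) * airyC (ξ + y) := by
  have hd : ∀ y : ℝ, HasDerivAt
      (fun y : ℝ => airyC (ζ + y) * airyC' (ξ + y) - airyC' (ζ + y) * airyC (ξ + y))
      ((ξ - ζ) * (airyC (ζ + y) * airyC (ξ + y))) y := fun y => by
    have h1 := hasDerivAt_airyC_add ζ y
    have h2 := hasDerivAt_airyC_add ξ y
    exact ((h1.1.fun_mul h2.2).fun_sub (h1.2.fun_mul h2.1)).congr_deriv (by ring)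
  have hlim : Tendsto
      (fun y : ℝ => airyC (ζ + y) * airyC' (ξ + y) - airyC' (ζ + y) * airyC (ξ + y)) atTop
      (𝓝 0) := by
    have h1 := tendsto_airyC_atTop ζ
    have h2 := tendsto_airyC_atTop ξ
    simpa using (h1.1.mul h2.2).sub (h1.2.mul h2.1)
  have := integral_Ioi_of_hasDerivAt_of_tendsto (hd 0).continuousAt.continuousWithinAt
    (fun y _ => hd y) ((integrableOn_airyC_mul ζ ξ).const_mul _) hlim
  rw [integral_const_mul] at this
  simp only [Complex.ofReal_zero, add_zero, zero_sub] at this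
  linear_combination this

lemma diagonal_eq_integral (ξ : ℂ) :
    airyC' ξ ^ 2 - ξ * airyC ξ ^ 2 = ∫ y in Set.Ioi (0 : ℝ), airyC (ξ + y) * airyC (ξ + y) := by
  have hd : ∀ y : ℝ, HasDerivAt
      (fun y : ℝ => airyC' (ξ + y) ^ 2 - (ξ + y) * airyC (ξ + y) ^ 2)
      (-(airyC (ξ + y) * airyC (ξ + y))) y := fun y => by
    have h1 := hasDerivAt_airyC_add ξ y
    have h0 : HasDerivAt (fun y : ℝ => ξ + (y : ℂ)) 1 y := by
      simpa using (Complex.ofRealCLM.hasDerivAt (x := y)).const_add ξ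
    exact ((h1.2.fun_pow 2).fun_sub (h0.fun_mul (h1.1.fun_pow 2))).congr_deriv (by push_cast; ring)
  have hlim : Tendsto
      (fun y : ℝ => airyC' (ξ + y) ^ 2 - (ξ + y) * airyC (ξ + y) ^ 2) atTop (𝓝 0) := by
    have h1 := (tendsto_airyC_atTop ξ).2.pow 2
    obtain ⟨C, hC, h⟩ := exists_norm_airyC_le |ξ.im|
    have h2 : Tendsto (fun y : ℝ => (ξ + y) * airyC (ξ + y) * airyC (ξ + y)) atTop (𝓝 0) := by
      -- One of the two exponentially decaying factors pays for the linear factor ξ + y; the other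
      -- still tends to 0.
      have h3 : ∀ᶠ y : ℝ in atTop, ‖(ξ + y) * airyC (ξ + y)‖ ≤
          (‖ξ‖ + 1) * (C * Real.exp (-ξ.re)) := by
        filter_upwards [eventually_ge_atTop 0] with y hy
        have h4 := (h (ξ + y) (by simp)).1
        rw [norm_mul]
        have h5 : ‖ξ + y‖ ≤ (‖ξ‖ + 1) * Real.exp y := by
          have a1 : ‖ξ + y‖ ≤ ‖ξ‖ + y := by
            simpa [abs_of_nonneg hy] using norm_add_le ξ (y : ℂ)
          have a2 := Real.add_one_le_exp y
          nlinarith [norm_nonneg ξ]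
        calc _ ≤ ((‖ξ‖ + 1) * Real.exp y) * (C * Real.exp (-(ξ + y).re)) := by gcongr
          _ = (‖ξ‖ + 1) * (C * Real.exp (-ξ.re)) * (Real.exp y * Real.exp (-y)) := by
            simp only [Complex.add_re, Complex.ofReal_re, neg_add, Real.exp_add]; ring
          _ = _ := by rw [← Real.exp_add]; simp
      have h5 := (tendsto_airyC_atTop ξ).1
      have h6 := (tendsto_zero_iff_norm_tendsto_zero.1 h5).const_mul
        ((‖ξ‖ + 1) * (C * Real.exp (-ξ.re)))
      rw [mul_zero] at h6
      refine squeeze_zero_norm' ?_ h6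
      filter_upwards [h3] with y hy
      rw [norm_mul]
      exact mul_le_mul_of_nonneg_right hy (norm_nonneg _)
    convert h1.sub h2 using 2
    · ring
    · simp
  have := integral_Ioi_of_hasDerivAt_of_tendsto (hd 0).continuousAt.continuousWithinAt
    (fun y _ => hd y) (integrableOn_airyC_mul ξ ξ).neg hlim
  rw [integral_neg] at this
  simp only [Complex.ofReal_zero, add_zero, zero_sub] at this
  linear_combination this

/-- The Airy kernel with one complex argument. -/
def airyKernelC (ζ : ℂ) (v : ℝ) : ℂ := ∫ y in Set.Ioi (0 : ℝ), airyC (ζ + y) * airyC (v + y)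

lemma ofReal_airyKernel (u v : ℝ) : ((airyKernel u v : ℝ) : ℂ) = airyKernelC u v := by
  unfold airyKernel airyKernelC
  split_ifs with h
  · subst h
    rw [← diagonal_eq_integral]
    push_cast [ofReal_airy, ofReal_airy']
    ring
  · have huv : (u : ℂ) - v ≠ 0 := by rw [sub_ne_zero]; exact_mod_cast h
    push_cast [ofReal_airy, ofReal_airy']
    rw [wronskian_eq_integral, mul_div_cancel_left₀ _ huv]

lemma integrableOn_airy_mul (u v : ℝ) :
    IntegrableOn (fun y : ℝ => airy (u + y) * airy (v + y)) (Set.Ioi 0) := by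
  refine (Integrable.re (integrableOn_airyC_mul u v)).congr (Eventually.of_forall fun y => ?_)
  simp only [← Complex.ofReal_add, ← ofReal_airy, ← Complex.ofReal_mul, RCLike.re_eq_complex_re,
    Complex.ofReal_re]

lemma airyKernel_eq_integral (u v : ℝ) :
    airyKernel u v = ∫ y in Set.Ioi (0 : ℝ), airy (u + y) * airy (v + y) := by
  have := ofReal_airyKernel u v
  rw [airyKernelC] at this
  simp only [← Complex.ofReal_add, ← ofReal_airy, ← Complex.ofReal_mul] at this
  rw [integral_complex_ofReal] at this
  exact_mod_cast this

lemma airyKernel_comm (u v : ℝ) : airyKernel u v = airyKernel v u := by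
  simp only [airyKernel_eq_integral, mul_comm]

lemma airyKernel_self (u : ℝ) : airyKernel u u = airy' u ^ 2 - u * airy u ^ 2 := by
  simp [airyKernel]

lemma sub_mul_airyKernel (u v : ℝ) :
    (u - v) * airyKernel u v = airy u * airy' v - airy' u * airy v := by
  unfold airyKernel
  split_ifs with h
  · subst h; ring
  · rw [mul_div_cancel₀ _ (sub_ne_zero.2 h)]

lemma airyKernel_self_nonneg (u : ℝ) : 0 ≤ airyKernel u u := by
  rw [airyKernel_eq_integral]
  exact integral_nonneg fun y => mul_self_nonneg _

/-- The kernel is the Gram kernel of the functions Ai(u + ·) on (0, ∞); Cauchy–Schwarz is read off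
the discriminant of a nonnegative quadratic in l. -/
lemma airyKernel_sq_le (u v : ℝ) : airyKernel u v ^ 2 ≤ airyKernel u u * airyKernel v v := by
  have h : ∀ l : ℝ, 0 ≤ airyKernel v v * (l * l) + 2 * airyKernel u v * l + airyKernel u u := by
    intro l
    have hi : 0 ≤ ∫ y in Set.Ioi (0 : ℝ), (airy (u + y) + l * airy (v + y)) ^ 2 :=
      integral_nonneg fun y => sq_nonneg _
    have he : ∀ y : ℝ, (airy (u + y) + l * airy (v + y)) ^ 2 =
        (l * l) * (airy (v + y) * airy (v + y)) + (2 * l) * (airy (u + y) * airy (v + y))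
          + airy (u + y) * airy (u + y) := fun y => by ring
    simp only [he] at hi
    have i1 := (integrableOn_airy_mul v v).const_mul (l * l)
    have i2 := (integrableOn_airy_mul u v).const_mul (2 * l)
    have i3 : IntegrableOn (fun y => (l * l) * (airy (v + y) * airy (v + y)) +
      (2 * l) * (airy (u + y) * airy (v + y))) (Set.Ioi 0) := i1.add i2
    rw [integral_add i3 (integrableOn_airy_mul u u),
      integral_add ((integrableOn_airy_mul v v).const_mul _)
      ((integrableOn_airy_mul u v).const_mul _), integral_const_mul, integral_const_mul,
      ← airyKernel_eq_integral, ← airyKernel_eq_integral, ← airyKernel_eq_integral] at hi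
    linarith
  have := discrim_le_zero h
  unfold discrim at this
  nlinarith

lemma abs_airyKernel_le (u v : ℝ) : |airyKernel u v| ≤ √(airyKernel u u) * √(airyKernel v v) := by
  rw [← Real.sqrt_mul (airyKernel_self_nonneg u)]
  exact Real.abs_le_sqrt (airyKernel_sq_le u v)

/-- The source of all the rank one formulas. Off the diagonal the denominator u - v is invariant
under the shift, so only the Wronskian is differentiated. -/
lemma hasDerivAt_airyKernel_shift (u v τ : ℝ) :
    HasDerivAt (fun τ => airyKernel (u - τ) (v - τ)) (airy (u - τ) * airy (v - τ)) τ := by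
  have hs : ∀ u τ : ℝ, HasDerivAt (fun τ => u - τ) (-1) τ := fun u τ => by
    simpa using (hasDerivAt_id τ).const_sub u
  have ha : ∀ u τ : ℝ, HasDerivAt (fun τ => airy (u - τ)) (-airy' (u - τ)) τ := fun u τ =>
    ((hasDerivAt_airy (u - τ)).comp τ (hs u τ)).congr_deriv (by ring)
  have hb : ∀ u τ : ℝ, HasDerivAt (fun τ => airy' (u - τ)) (-((u - τ) * airy (u - τ))) τ :=
    fun u τ => ((hasDerivAt_airy' (u - τ)).comp τ (hs u τ)).congr_deriv (by ring)
  by_cases h : u = v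
  · subst h
    simp only [airyKernel_self]
    exact (((hb u τ).fun_pow 2).fun_sub ((hs u τ).fun_mul ((ha u τ).fun_pow 2))).congr_deriv
      (by push_cast; ring)
  · have h' : ∀ τ : ℝ, airyKernel (u - τ) (v - τ) =
        (airy (u - τ) * airy' (v - τ) - airy' (u - τ) * airy (v - τ)) / (u - v) := fun τ => by
      rw [airyKernel, if_neg (by simpa using h)]; congr 1; ring
    simp only [h']
    have hne : u - v ≠ 0 := sub_ne_zero.2 h
    refine ((((ha u τ).fun_mul (hb v τ)).fun_sub ((hb u τ).fun_mul (ha v τ))).div_const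
      (u - v)).congr_deriv ?_
    field_simp; ring

lemma hasDerivAt_airy_shift (v τ : ℝ) :
    HasDerivAt (fun τ => airy (v - τ)) (-airy' (v - τ)) τ :=
  ((hasDerivAt_airy (v - τ)).comp τ ((hasDerivAt_id τ).const_sub v)).congr_deriv (by ring)

lemma hasDerivAt_airy'_shift (v τ : ℝ) :
    HasDerivAt (fun τ => airy' (v - τ)) (-((v - τ) * airy (v - τ))) τ :=
  ((hasDerivAt_airy' (v - τ)).comp τ ((hasDerivAt_id τ).const_sub v)).congr_deriv (by ring)

/-! ### Pointwise bounds -/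

/-- The envelope controlling `K(v,v)`, `Ai'(v)²` and `(1 + |v|) Ai(v)²`. -/
def envelope (v : ℝ) : ℝ := √(1 + |v|) * Real.exp (-max v 0)

lemma envelope_pos (v : ℝ) : 0 < envelope v := by unfold envelope; positivity

@[fun_prop]
lemma continuous_envelope : Continuous envelope := by unfold envelope; fun_prop

lemma envelope_shift {T τ : ℝ} (hτ : |τ| ≤ T) (v : ℝ) :
    envelope (v - τ) ≤ (1 + T) * Real.exp T * envelope v := by
  have hT : 0 ≤ T := (abs_nonneg τ).trans hτ
  unfold envelope
  have h1 : √(1 + |v - τ|) ≤ (1 + T) * √(1 + |v|) := by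
    rw [Real.sqrt_le_left (by positivity), mul_pow, Real.sq_sqrt (by positivity)]
    have := abs_sub v τ
    nlinarith [abs_nonneg v, mul_nonneg hT (abs_nonneg v), mul_nonneg hT hT,
      mul_nonneg (mul_nonneg hT hT) (abs_nonneg v)]
  have h2 : Real.exp (-max (v - τ) 0) ≤ Real.exp T * Real.exp (-max v 0) := by
    rw [← Real.exp_add]
    refine Real.exp_le_exp.2 ?_
    have : max v 0 ≤ max (v - τ) 0 + T := by
      refine max_le ?_ (by positivity)
      have := le_max_left (v - τ) 0
      have := (abs_le.1 hτ).2
      linarith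
    linarith
  calc _ ≤ ((1 + T) * √(1 + |v|)) * (Real.exp T * Real.exp (-max v 0)) := by gcongr
    _ = _ := by ring

/-- The corrected energy of the oscillating solution. -/
def airyEnergy (w : ℝ) : ℝ :=
  airy' (-w) ^ 2 / √w + √w * airy (-w) ^ 2 - airy (-w) * airy' (-w) / (2 * w * √w)

/-- The plain energy Ai'²/√w + √w Ai² has derivative -(Ai'² - w Ai²)/(2 w √w), which is not
integrable after division by the energy. The third term of `airyEnergy` cancels it and leaves a
remainder with a factor w^(-5/2). -/
lemma hasDerivAt_airyEnergy {w : ℝ} (hw : 0 < w) :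
    HasDerivAt airyEnergy (3 / 4 * (airy (-w) * airy' (-w)) / (w ^ 2 * √w)) w := by
  have hs : 0 < √w := Real.sqrt_pos.2 hw
  have ha : HasDerivAt (fun w => airy (-w)) (-airy' (-w)) w :=
    ((hasDerivAt_airy (-w)).comp w (hasDerivAt_neg w)).congr_deriv (by ring)
  have hb : HasDerivAt (fun w => airy' (-w)) (w * airy (-w)) w :=
    ((hasDerivAt_airy' (-w)).comp w (hasDerivAt_neg w)).congr_deriv (by ring)
  have hq := Real.hasDerivAt_sqrt hw.ne'
  have hd : HasDerivAt (fun w : ℝ => 2 * w * √w) (2 * 1 * √w + 2 * w * (1 / (2 * √w))) w :=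
    (((hasDerivAt_id w).const_mul 2).fun_mul hq)
  have := (((hb.fun_pow 2).fun_div hq hs.ne').fun_add (hq.fun_mul (ha.fun_pow 2))).fun_sub
    ((ha.fun_mul hb).fun_div hd (by positivity))
  refine this.congr_deriv ?_
  have hw2 : w = √w ^ 2 := (Real.sq_sqrt hw.le).symm
  generalize airy (-w) = a
  generalize airy' (-w) = b
  generalize √w = s at *
  subst hw2
  field_simp
  ring

/-- By 2|ab| ≤ b²/s + s a² the correction costs at most a quarter of the energy, and the derivative
of the corrected energy is at most the energy divided by w². -/
lemma airyEnergy_bounds {w : ℝ} (hw : 1 ≤ w) :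
    3 / 4 * (airy' (-w) ^ 2 / √w + √w * airy (-w) ^ 2) ≤ airyEnergy w ∧
      3 / 4 * (airy (-w) * airy' (-w)) / (w ^ 2 * √w) ≤ airyEnergy w / w ^ 2 := by
  have hs : 1 ≤ √w := Real.one_le_sqrt.2 hw
  have hw2 : w = √w ^ 2 := (Real.sq_sqrt (by linarith)).symm
  unfold airyEnergy
  generalize airy (-w) = a
  generalize airy' (-w) = b
  generalize √w = s at *
  subst hw2
  have hs0 : 0 < s := by linarith
  have h1 : b ^ 2 / s + s * a ^ 2 - 2 * (a * b) = (b - s * a) ^ 2 / s := by field_simp; ring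
  have h2 : b ^ 2 / s + s * a ^ 2 + 2 * (a * b) = (b + s * a) ^ 2 / s := by field_simp; ring
  have h1' : 0 ≤ (b - s * a) ^ 2 / s := by positivity
  have h2' : 0 ≤ (b + s * a) ^ 2 / s := by positivity
  set E := b ^ 2 / s + s * a ^ 2 with hE
  have hE0 : 0 ≤ E := by positivity
  have h3 : a * b / (2 * s ^ 2 * s) ≤ E / 4 := by
    rw [div_le_iff₀ (by positivity)]
    have : (1 : ℝ) ≤ s ^ 2 * s := by nlinarith [mul_pos hs0 hs0]
    nlinarith
  refine ⟨by linarith, ?_⟩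
  have h4 : 3 / 4 * (a * b) / ((s ^ 2) ^ 2 * s) ≤ (E / 2) / (s ^ 2) ^ 2 := by
    rw [div_le_div_iff₀ (by positivity) (by positivity)]
    have h5 : 3 / 4 * (a * b) ≤ E / 2 * s := by nlinarith
    calc _ ≤ (E / 2 * s) * (s ^ 2) ^ 2 := by gcongr
      _ = _ := by ring
  refine h4.trans ?_
  gcongr
  linarith

/-- Grönwall for E' ≤ E/w²: the integrating factor exp(1/w) makes the product nonincreasing. -/
lemma airyEnergy_le {w : ℝ} (hw : 1 ≤ w) : airyEnergy w ≤ Real.exp 1 * airyEnergy 1 := by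
  have hanti : AntitoneOn (fun w => airyEnergy w * Real.exp (1 / w)) (Set.Ici 1) := by
    have hd : ∀ w : ℝ, 1 ≤ w → HasDerivAt (fun w => airyEnergy w * Real.exp (1 / w))
        (3 / 4 * (airy (-w) * airy' (-w)) / (w ^ 2 * √w) * Real.exp (1 / w)
          + airyEnergy w * (Real.exp (1 / w) * (-(w ^ 2)⁻¹))) w := fun w hw => by
      have h0 : w ≠ 0 := by positivity
      simp only [one_div]
      exact (hasDerivAt_airyEnergy (by linarith)).fun_mul (hasDerivAt_inv h0).exp
    refine antitoneOn_of_deriv_nonpos (convex_Ici 1)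
      (fun w hw => (hd w hw).continuousAt.continuousWithinAt)
      (fun w hw => (hd w (interior_subset hw)).differentiableAt.differentiableWithinAt)
      (fun w hw => ?_)
    have hw' : 1 ≤ w := interior_subset hw
    rw [(hd w hw').deriv]
    have := (airyEnergy_bounds hw').2
    have he := Real.exp_pos (1 / w)
    have : airyEnergy w * (Real.exp (1 / w) * (-(w ^ 2)⁻¹)) =
      -(airyEnergy w / w ^ 2 * Real.exp (1 / w)) := by ring
    rw [this]
    nlinarith
  have h := hanti (Set.mem_Ici.2 le_rfl) (Set.mem_Ici.2 hw) hw
  simp only [div_one] at h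
  have h0 : 0 ≤ airyEnergy w := le_trans (by positivity) (airyEnergy_bounds hw).1
  have h1 : 1 ≤ Real.exp (1 / w) := Real.one_le_exp (by positivity)
  nlinarith

/-- For v ≤ -1 the bound comes from the energy; for v ≥ -1 from the exponential decay, whose square
e^(-2v) also absorbs the factor 1 + |v|. The diagonal value K(v, v) = Ai'² - v Ai² is a combination
of the other two quantities. -/
lemma exists_airy_le_envelope :
    ∃ C, 0 < C ∧ ∀ v : ℝ, airyKernel v v ≤ C * envelope v ∧ airy' v ^ 2 ≤ C * envelope v ∧
      (1 + |v|) * airy v ^ 2 ≤ C * envelope v := by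
  obtain ⟨C₁, hC₁, hexp⟩ := exists_abs_airy_le
  set D := 4 / 3 * (Real.exp 1 * airyEnergy 1) with hD
  have hD0 : 0 ≤ D := by
    have : 0 ≤ airyEnergy 1 := le_trans (by positivity) (airyEnergy_bounds le_rfl).1
    positivity
  refine ⟨2 * D + 4 * C₁ ^ 2 * Real.exp 2, by positivity, fun v => ?_⟩
  have hmain : (1 + |v|) * airy v ^ 2 + airy' v ^ 2 ≤ (2 * D + 4 * C₁ ^ 2 * Real.exp 2) * envelope v := by
    rcases le_total v (-1) with hv | hv
    · obtain ⟨w, rfl⟩ : ∃ w, v = -w := ⟨-v, by simp⟩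
      have hw : 1 ≤ w := by linarith
      have hE := (airyEnergy_bounds hw).1.trans (airyEnergy_le hw)
      have hs : 1 ≤ √w := Real.one_le_sqrt.2 hw
      have hE' : airy' (-w) ^ 2 + w * airy (-w) ^ 2 ≤ D * √w := by
        have h1 : airy' (-w) ^ 2 / √w + √w * airy (-w) ^ 2 ≤ D := by rw [hD]; linarith
        have h2 : (airy' (-w) ^ 2 / √w + √w * airy (-w) ^ 2) * √w ≤ D * √w := by gcongr
        have h3 : (airy' (-w) ^ 2 / √w + √w * airy (-w) ^ 2) * √w =
            airy' (-w) ^ 2 + (√w * √w) * airy (-w) ^ 2 := by field_simp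
        rwa [h3, Real.mul_self_sqrt (by linarith)] at h2
      have henv : √w ≤ envelope (-w) := by
        rw [envelope, abs_neg, abs_of_nonneg (by linarith), max_eq_right (by linarith)]
        simp only [neg_zero, Real.exp_zero, mul_one]
        exact Real.sqrt_le_sqrt (by linarith)
      rw [abs_neg, abs_of_nonneg (by linarith : (0 : ℝ) ≤ w)]
      have h4 : D * √w ≤ D * envelope (-w) := by gcongr
      have h5 : 0 ≤ 4 * C₁ ^ 2 * Real.exp 2 * envelope (-w) :=
        mul_nonneg (by positivity) (envelope_pos _).le
      have h6 : 0 ≤ (w - 1) * airy (-w) ^ 2 := mul_nonneg (by linarith) (sq_nonneg _)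
      have h7 := sq_nonneg (airy' (-w))
      have h8 := sq_nonneg (airy (-w))
      nlinarith
    · have hC : ∀ a : ℝ, |a| ≤ C₁ * Real.exp (-v) → a ^ 2 ≤ C₁ ^ 2 * Real.exp (-2 * v) := by
        intro a ha
        calc a ^ 2 = |a| ^ 2 := (sq_abs a).symm
          _ ≤ (C₁ * Real.exp (-v)) ^ 2 := by gcongr
          _ = _ := by rw [mul_pow, ← Real.exp_nat_mul]; push_cast; ring_nf
      have h1 := hC _ (hexp v).1
      have h2 := hC _ (hexp v).2
      have h3 : (1 + |v|) * Real.exp (-2 * v) ≤ 2 * Real.exp 2 * envelope v := by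
        have hs : 1 ≤ √(1 + |v|) := Real.one_le_sqrt.2 (by linarith [abs_nonneg v])
        rcases le_total v 0 with h0 | h0
        · have henv : 1 ≤ envelope v := by
            rw [envelope, max_eq_right h0]; simp
          have : Real.exp (-2 * v) ≤ Real.exp 2 := Real.exp_le_exp.2 (by linarith)
          have : 1 + |v| ≤ 2 := by rw [abs_of_nonpos h0]; linarith
          calc _ ≤ 2 * Real.exp 2 := by gcongr
            _ ≤ _ := le_mul_of_one_le_right (by positivity) henv
        · rw [envelope, abs_of_nonneg h0, max_eq_left h0]
          rw [abs_of_nonneg h0] at hs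
          have h4 : (1 + v) * Real.exp (-2 * v) ≤ Real.exp (-v) := by
            calc _ ≤ Real.exp v * Real.exp (-2 * v) := by
                  gcongr; linarith [Real.add_one_le_exp v]
              _ = _ := by rw [← Real.exp_add]; ring_nf
          have h5 : (1 : ℝ) ≤ 2 * Real.exp 2 := by linarith [Real.add_one_le_exp 2]
          calc _ ≤ Real.exp (-v) := h4
            _ = 1 * (1 * Real.exp (-v)) := by ring
            _ ≤ 2 * Real.exp 2 * (√(1 + v) * Real.exp (-v)) := by gcongr
      have h4 : 0 ≤ D * envelope v := mul_nonneg hD0 (envelope_pos _).le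
      have h5 : (1 + |v|) * airy v ^ 2 ≤ 2 * C₁ ^ 2 * Real.exp 2 * envelope v := by
        calc _ ≤ (1 + |v|) * (C₁ ^ 2 * Real.exp (-2 * v)) := by gcongr
          _ = C₁ ^ 2 * ((1 + |v|) * Real.exp (-2 * v)) := by ring
          _ ≤ C₁ ^ 2 * (2 * Real.exp 2 * envelope v) := by gcongr
          _ = _ := by ring
      have h6 : airy' v ^ 2 ≤ 2 * C₁ ^ 2 * Real.exp 2 * envelope v := by
        calc _ ≤ C₁ ^ 2 * Real.exp (-2 * v) := h2
          _ ≤ C₁ ^ 2 * ((1 + |v|) * Real.exp (-2 * v)) := by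
            gcongr; exact le_mul_of_one_le_left (Real.exp_pos _).le (by linarith [abs_nonneg v])
          _ ≤ C₁ ^ 2 * (2 * Real.exp 2 * envelope v) := by gcongr
          _ = _ := by ring
      nlinarith
  have h2 : 0 ≤ (1 + |v|) * airy v ^ 2 := by positivity
  refine ⟨?_, by linarith, by linarith [sq_nonneg (airy' v)]⟩
  rw [airyKernel_self]
  have h3 : -(v * airy v ^ 2) ≤ (1 + |v|) * airy v ^ 2 := by
    nlinarith [neg_abs_le v, sq_nonneg (airy v)]
  linarith


/-! ### The Airy transform is a contraction of `L²` -/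

open FourierTransform SchwartzMap in
/-- Plancherel's theorem for integrable, square integrable functions. -/
lemma eLpNorm_fourier_eq {f : ℝ → ℂ} (hf1 : Integrable f) (hf2 : MemLp f 2 volume) :
    Continuous (𝓕 f) ∧ eLpNorm (𝓕 f) 2 volume = eLpNorm f 2 volume := by
  have hcont : Continuous (𝓕 f) :=
    VectorFourier.fourierIntegral_continuous Real.continuous_fourierChar
      (innerSL ℝ (E := ℝ)).continuous₂ hf1
  refine ⟨hcont, ?_⟩
  set f2 : Lp ℂ 2 (volume : Measure ℝ) := hf2.toLp f with hf2def
  -- The integral transform and the L² transform agree because they have the same pairing with every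
  -- smooth compactly supported function: both pairings move the transform to the test function.
  have hae : ∀ᵐ x : ℝ, 𝓕 f x = (𝓕 f2 : Lp ℂ 2 (volume : Measure ℝ)) x := by
    refine ae_eq_of_integral_contDiff_smul_eq (hcont.locallyIntegrable)
      ((Lp.memLp (𝓕 f2)).locallyIntegrable (by norm_num)) fun g hg hg' => ?_
    set ψ : 𝓢(ℝ, ℂ) := (hg'.comp_left (g := ((↑) : ℝ → ℂ)) rfl).toSchwartzMap
      (Complex.ofRealCLM.contDiff.comp hg) with hψ
    have hψx : ∀ x, ψ x = (g x : ℂ) := fun x => rfl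
    have e1 : ∫ x, g x • 𝓕 f x = ∫ x, f x • (𝓕 ψ) x := by
      have := VectorFourier.integral_fourierIntegral_smul_eq_flip (L := innerₗ ℝ)
        (μ := (volume : Measure ℝ)) (ν := (volume : Measure ℝ)) (f := f) (g := ψ)
        Real.continuous_fourierChar (innerSL ℝ (E := ℝ)).continuous₂ hf1 ψ.integrable
      rw [flip_innerₗ] at this
      refine Eq.trans ?_ (this.trans ?_)
      · congr 1; funext x; rw [hψx, smul_eq_mul, mul_comm]; rfl
      · rfl
    have e2 : ∫ x, g x • (𝓕 f2 : Lp ℂ 2 (volume : Measure ℝ)) x = ∫ x, (𝓕 ψ) x • f2 x := by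
      have h1 := congrArg (fun T : 𝓢'(ℝ, ℂ) => T ψ) (Lp.fourier_toTemperedDistribution_eq f2)
      simp only [TemperedDistribution.fourier_apply, Lp.toTemperedDistribution_apply] at h1
      rw [h1]
      rfl
    rw [e1, e2]
    refine integral_congr_ae ?_
    filter_upwards [hf2.coeFn_toLp] with x hx
    rw [hf2def, hx, smul_eq_mul, smul_eq_mul, mul_comm]
  rw [eLpNorm_congr_ae hae]
  have hn := Lp.norm_fourier_eq f2
  rw [Lp.norm_def, Lp.norm_def, ENNReal.toReal_eq_toReal_iff' (Lp.eLpNorm_ne_top _)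
    (Lp.eLpNorm_ne_top _)] at hn
  rw [hn, eLpNorm_congr_ae hf2.coeFn_toLp]

lemma airyExp_eq (c u y : ℝ) :
    airyExp c u y = Complex.exp (-(c * u)) * (airyExp c 0 y * Complex.exp (-(u * y * Complex.I))) := by
  unfold airyExp
  rw [← Complex.exp_add, ← Complex.exp_add]
  congr 1
  ring

/-- On the line with abscissa c the factor e^(-cu) comes out and a Fourier integral remains; y = 2πξ
adapts it to the normalisation of the Fourier transform. -/
lemma exp_mul_airy_eq {c : ℝ} (hc : 0 < c) (u : ℝ) :
    Complex.exp (c * u) * airyC u =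
      ∫ ξ : ℝ, airyExp c 0 (2 * Real.pi * ξ) * Complex.exp (-(2 * Real.pi * (u * ξ) * Complex.I)) := by
  have h1 : ∫ y : ℝ, airyExp c u y = Complex.exp (-(c * u)) *
      ∫ y : ℝ, airyExp c 0 y * Complex.exp (-(u * y * Complex.I)) := by
    rw [← integral_const_mul]; simp only [← airyExp_eq]
  rw [airyC_eq_of_pos hc, h1]
  have h2 := Measure.integral_comp_mul_left
    (fun y : ℝ => airyExp c 0 y * Complex.exp (-(u * y * Complex.I))) (2 * Real.pi)
  have h3 : ∫ ξ : ℝ, airyExp c 0 (2 * Real.pi * ξ) *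
      Complex.exp (-(2 * Real.pi * (u * ξ) * Complex.I)) =
      ∫ ξ : ℝ, airyExp c 0 (2 * Real.pi * ξ) *
      Complex.exp (-(u * ((2 * Real.pi * ξ : ℝ) : ℂ) * Complex.I)) := by
    congr 1; funext ξ; congr 2; push_cast; ring
  have h4 : Complex.exp (c * u) * Complex.exp (-(c * u)) = 1 := by
    rw [← Complex.exp_add]; simp
  rw [h3, h2, abs_of_pos (by positivity), Complex.real_smul]
  push_cast
  linear_combination (1 / (2 * Real.pi) : ℂ) *
    (∫ y : ℝ, airyExp c 0 y * Complex.exp (-(u * y * Complex.I))) * h4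

lemma integrable_airyExp {c : ℝ} (hc : 0 < c) : Integrable (airyExp c 0) := by
  refine (integrable_exp_neg_sq_add_abs hc 0 (c ^ 3 / 3)).mono'
    (continuous_airyExp c 0).aestronglyMeasurable (Eventually.of_forall fun y => ?_)
  rw [norm_airyExp]; simp

open FourierTransform in
-- Write e^(cp) = e^(c(v + p)) e^(-cv). The first factor turns Ai into a Fourier transform, the
-- second damps h; the multiplication formula then moves the transform to the damped function.
lemma airy_transform_eq_fourier {c : ℝ} (hc : 0 < c) {h : ℝ → ℝ}
    (hi : Integrable (fun v : ℝ => ((Real.exp (-(c * v)) * h v : ℝ) : ℂ))) (p : ℝ) :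
    ((Real.exp (c * p) * ∫ v, airy (v + p) * h v : ℝ) : ℂ) =
      𝓕 (fun ξ : ℝ => airyExp c 0 (2 * Real.pi * ξ) *
        𝓕 (fun v : ℝ => ((Real.exp (-(c * v)) * h v : ℝ) : ℂ)) ξ) p := by
  set hc' : ℝ → ℂ := fun v : ℝ => ((Real.exp (-(c * v)) * h v : ℝ) : ℂ) with hc'def
  set f : ℝ → ℂ := fun ξ => airyExp c 0 (2 * Real.pi * ξ) *
    Complex.exp (-(2 * Real.pi * (p * ξ) * Complex.I)) with hf
  have hfi : Integrable f := by
    have h0 := (integrable_airyExp hc).comp_mul_left' (R := 2 * Real.pi) (by positivity)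
    refine h0.mono (by
      have := continuous_airyExp c 0
      exact (by rw [hf]; fun_prop : Continuous f).aestronglyMeasurable)
      (Eventually.of_forall fun ξ => ?_)
    rw [hf]
    simp [Complex.norm_exp]
  have key := VectorFourier.integral_fourierIntegral_smul_eq_flip (L := innerₗ ℝ)
    (μ := (volume : Measure ℝ)) (ν := (volume : Measure ℝ)) (f := f) (g := hc')
    Real.continuous_fourierChar (innerSL ℝ (E := ℝ)).continuous₂ hfi hi
  rw [flip_innerₗ] at key
  have hF : ∀ v, VectorFourier.fourierIntegral Real.fourierChar volume (innerₗ ℝ) f v =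
      Complex.exp (c * ((v + p : ℝ) : ℂ)) * airyC ((v + p : ℝ) : ℂ) := fun v => by
    rw [exp_mul_airy_eq hc, VectorFourier.fourierIntegral]
    congr 1; funext ξ
    rw [Circle.smul_def, Real.fourierChar_apply, smul_eq_mul, hf]
    simp only [innerₗ_apply_apply, RCLike.inner_apply, conj_trivial]
    rw [mul_left_comm, ← Complex.exp_add]
    congr 2; push_cast; ring
  simp only [hF] at key
  have lhs : ((Real.exp (c * p) * ∫ v, airy (v + p) * h v : ℝ) : ℂ) =
      ∫ v : ℝ, (Complex.exp (c * ((v + p : ℝ) : ℂ)) * airyC ((v + p : ℝ) : ℂ)) • hc' v := by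
    rw [← integral_const_mul, ← integral_complex_ofReal]
    congr 1; funext v
    rw [smul_eq_mul, ← ofReal_airy, hc'def, ← Complex.ofReal_mul, ← Complex.ofReal_exp]
    simp only [← Complex.ofReal_mul]
    congr 1
    rw [mul_add, Real.exp_add, Real.exp_neg]
    field_simp
  rw [lhs, key, Real.fourier_eq]
  congr 1; funext ξ
  rw [Circle.smul_def, Real.fourierChar_apply, smul_eq_mul, smul_eq_mul, hf]
  simp only [RCLike.inner_apply, conj_trivial]
  have : Complex.exp (-(2 * Real.pi * (p * ξ) * Complex.I)) =
      Complex.exp (((2 * Real.pi * -(p * ξ) : ℝ) : ℂ) * Complex.I) := by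
    congr 1; push_cast; ring
  rw [this]
  have h2 : VectorFourier.fourierIntegral Real.fourierChar volume (innerₗ ℝ) hc' ξ = 𝓕 hc' ξ := rfl
  rw [h2]; ring

/-- With weights, the Airy transform is Fourier, then multiplication by a function of modulus at
most e^(c³/3), then Fourier. Plancherel twice gives the constant e^(c³/3 + cn), the factor e^(cn)
being the price of e^(-cv) on v ≥ -n; Fatou along c → 0 removes both. -/
lemma eLpNorm_airy_transform_le_of_support {h : ℝ → ℝ} (hh : MemLp h 2 volume) {n : ℝ}
    (hs : ∀ v, v < -n → h v = 0) :
    Continuous (fun p => ∫ v, airy (v + p) * h v) ∧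
    eLpNorm (fun p => ∫ v, airy (v + p) * h v) 2 volume ≤ eLpNorm h 2 volume := by
  have step : ∀ c : ℝ, 0 < c → Continuous (fun p => Real.exp (c * p) * ∫ v, airy (v + p) * h v) ∧
      eLpNorm (fun p => Real.exp (c * p) * ∫ v, airy (v + p) * h v) 2 volume ≤
        ENNReal.ofReal (Real.exp (c ^ 3 / 3 + c * n)) * eLpNorm h 2 volume := by
    intro c hc
    set g : ℝ → ℝ := fun v => Real.exp (-(c * v)) * h v with hg
    have hbound : ∀ v, ‖g v‖ ≤ Real.exp (c * n) * ‖h v‖ := fun v => by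
      rcases lt_or_ge v (-n) with hv | hv
      · simp [hg, hs v hv]
      · rw [hg, norm_mul, Real.norm_of_nonneg (Real.exp_pos _).le]
        gcongr; nlinarith
    have hmeas : AEStronglyMeasurable g volume :=
      (by fun_prop : Continuous fun v : ℝ => Real.exp (-(c * v))).aestronglyMeasurable.mul
        hh.aestronglyMeasurable
    have hg2 : MemLp g 2 volume := MemLp.of_le_mul hh hmeas (Eventually.of_forall hbound)
    have hg1 : Integrable g := by
      have hi : IntegrableOn (fun v : ℝ => Real.exp (-(2 * c) * v)) (Set.Ioi (-n)) :=
        exp_neg_integrableOn_Ioi _ (by positivity)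
      have hi' : Integrable (Set.indicator (Set.Ici (-n)) fun v : ℝ => Real.exp (-(2 * c) * v)) := by
        rw [integrable_indicator_iff measurableSet_Ici]
        exact (integrableOn_Ici_iff_integrableOn_Ioi (by simp)).2 hi
      refine ((hi'.add (hh.integrable_sq)).const_mul (1 / 2)).mono' hmeas
        -- The product e^(-cv)|h| is at most half the sum of the squares, and e^(-2cv) is integrable
        -- on the support.
        (Eventually.of_forall fun v => ?_)
      rcases lt_or_ge v (-n) with hv | hv
      · have : g v = 0 := by simp [hg, hs v hv]
        rw [this, norm_zero]
        simp [hv.not_ge, hs v hv]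
      · simp only [Pi.add_apply, Set.indicator_of_mem (Set.mem_Ici.2 hv)]
        rw [hg, norm_mul, Real.norm_of_nonneg (Real.exp_pos _).le]
        have e : Real.exp (-(2 * c) * v) = Real.exp (-(c * v)) ^ 2 := by
          rw [← Real.exp_nat_mul]; congr 1; push_cast; ring
        rw [e, ← sq_abs (h v), ← Real.norm_eq_abs]
        nlinarith [sq_nonneg (Real.exp (-(c * v)) - ‖h v‖)]
    have hgc1 : Integrable (fun v => ((g v : ℝ) : ℂ)) := hg1.ofReal
    have hgc2 : MemLp (fun v => ((g v : ℝ) : ℂ)) 2 volume := hg2.ofReal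
    obtain ⟨F1, F2⟩ := eLpNorm_fourier_eq hgc1 hgc2
    set W : ℝ → ℂ := fun ξ : ℝ => airyExp c 0 (2 * Real.pi * ξ) *
        FourierTransform.fourier (fun v : ℝ => ((g v : ℝ) : ℂ)) ξ with hW
    have hEc : Continuous fun ξ : ℝ => airyExp c 0 (2 * Real.pi * ξ) :=
      (continuous_airyExp c 0).comp (by fun_prop)
    have hWb : ∀ ξ, ‖W ξ‖ ≤ Real.exp (c ^ 3 / 3) *
        ‖FourierTransform.fourier (fun v : ℝ => ((g v : ℝ) : ℂ)) ξ‖ := fun ξ => by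
      rw [hW, norm_mul, norm_airyExp]
      gcongr
      simp only [Complex.zero_re, Complex.zero_im, zero_mul, sub_zero, add_zero]
      have : 0 ≤ c * (2 * Real.pi * ξ) ^ 2 := by positivity
      linarith
    have hWm : Continuous W := hEc.mul F1
    have hF2' : MemLp (FourierTransform.fourier (fun v : ℝ => ((g v : ℝ) : ℂ))) 2 volume :=
      ⟨F1.aestronglyMeasurable, by rw [F2]; exact hgc2.2⟩
    have hW2 : MemLp W 2 volume :=
      MemLp.of_le_mul hF2' hWm.aestronglyMeasurable (Eventually.of_forall hWb)
    have hW1 : Integrable W := by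
      have hE2 : MemLp (fun ξ : ℝ => airyExp c 0 (2 * Real.pi * ξ)) 2 volume := by
        rw [memLp_two_iff_integrable_sq_norm hEc.aestronglyMeasurable]
        have h0 := ((integrable_exp_neg_sq_add_abs (a := 2 * c) (by positivity) 0
          (2 * (c ^ 3 / 3))).comp_mul_left' (R := 2 * Real.pi) (by positivity))
        refine h0.congr (Eventually.of_forall fun ξ => ?_)
        simp only [norm_airyExp, ← Real.exp_nat_mul]
        congr 1; simp; ring
      exact hE2.integrable_mul hF2'
    obtain ⟨W1, W2⟩ := eLpNorm_fourier_eq hW1 hW2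
    have heq : ∀ p, ((Real.exp (c * p) * ∫ v, airy (v + p) * h v : ℝ) : ℂ) =
        FourierTransform.fourier W p := fun p => airy_transform_eq_fourier hc hgc1 p
    constructor
    · have : Continuous fun p => (FourierTransform.fourier W p).re := Complex.continuous_re.comp W1
      simpa only [← heq, Complex.ofReal_re] using this
    · calc eLpNorm (fun p => Real.exp (c * p) * ∫ v, airy (v + p) * h v) 2 volume
          = eLpNorm (FourierTransform.fourier W) 2 volume :=
            eLpNorm_congr_norm_ae (Eventually.of_forall fun p => by
              rw [← heq, Complex.norm_real])
        _ = eLpNorm W 2 volume := W2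
        _ ≤ ENNReal.ofReal (Real.exp (c ^ 3 / 3)) *
            eLpNorm (FourierTransform.fourier (fun v : ℝ => ((g v : ℝ) : ℂ))) 2 volume :=
            eLpNorm_le_mul_eLpNorm_of_ae_le_mul (Eventually.of_forall hWb) 2
        _ = ENNReal.ofReal (Real.exp (c ^ 3 / 3)) * eLpNorm g 2 volume := by
            rw [F2]; congr 1
            exact eLpNorm_congr_norm_ae (Eventually.of_forall fun p => by simp)
        _ ≤ ENNReal.ofReal (Real.exp (c ^ 3 / 3)) *
            (ENNReal.ofReal (Real.exp (c * n)) * eLpNorm h 2 volume) := by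
            gcongr
            exact eLpNorm_le_mul_eLpNorm_of_ae_le_mul (Eventually.of_forall hbound) 2
        _ = _ := by
            rw [← mul_assoc, ← ENNReal.ofReal_mul (Real.exp_pos _).le, ← Real.exp_add]
  constructor
  · have h1 := (step 1 one_pos).1
    have h2 : Continuous fun p : ℝ => Real.exp (-(1 * p)) := by fun_prop
    refine (h2.mul h1).congr fun p => ?_
    simp [← mul_assoc, ← Real.exp_add]
  · set c : ℕ → ℝ := fun k => 1 / ((k : ℝ) + 1)
    have hc : ∀ k, 0 < c k := fun k => by positivity
    have hc0 : Tendsto c atTop (𝓝 0) := tendsto_one_div_add_atTop_nhds_zero_nat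
    have hlim := Lp.eLpNorm_lim_le_liminf_eLpNorm (μ := volume) (p := 2)
      (f := fun k p => Real.exp (c k * p) * ∫ v, airy (v + p) * h v)
      (fun k => (step (c k) (hc k)).1.aestronglyMeasurable)
      (fun p => ∫ v, airy (v + p) * h v) (Eventually.of_forall fun p => by
        have : Tendsto (fun k => Real.exp (c k * p)) atTop (𝓝 (Real.exp (0 * p))) :=
          (Real.continuous_exp.tendsto _).comp (hc0.mul_const p)
        simpa using this.mul_const (∫ v, airy (v + p) * h v))
    refine hlim.trans ?_
    have ht : Tendsto (fun k => ENNReal.ofReal (Real.exp ((c k) ^ 3 / 3 + c k * n)) *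
        eLpNorm h 2 volume) atTop (𝓝 (1 * eLpNorm h 2 volume)) := by
      refine ENNReal.Tendsto.mul_const ?_ (Or.inl one_ne_zero)
      have : Tendsto (fun k => Real.exp ((c k) ^ 3 / 3 + c k * n)) atTop
          (𝓝 (Real.exp (0 ^ 3 / 3 + 0 * n))) :=
        (Real.continuous_exp.tendsto _).comp (((hc0.pow 3).div_const 3).add (hc0.mul_const n))
      simpa using ENNReal.tendsto_ofReal this
    rw [one_mul] at ht
    rw [← ht.liminf_eq]
    exact liminf_le_liminf (Eventually.of_forall fun k => (step (c k) (hc k)).2)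

/-- The Airy transform does not increase the `L²` norm. -/
lemma eLpNorm_airy_transform_le {h : ℝ → ℝ} (hh : MemLp h 2 volume)
    (hi : ∀ p : ℝ, Integrable (fun v => airy (v + p) * h v)) :
    eLpNorm (fun p => ∫ v, airy (v + p) * h v) 2 volume ≤ eLpNorm h 2 volume := by
  -- Truncation to v ≥ -n, where the previous lemma applies with a constant independent of n. The
  -- hypothesis `hi` gives pointwise convergence of the transforms, and Fatou does the rest.
  set hn : ℕ → ℝ → ℝ := fun n => Set.indicator (Set.Ici (-(n : ℝ))) h with hhn
  have h2 : ∀ n, MemLp (hn n) 2 volume := fun n => hh.indicator measurableSet_Ici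
  have h3 : ∀ n, _ := fun n => eLpNorm_airy_transform_le_of_support (h2 n) (n := n) fun v hv => by
    simp [hhn, hv.not_ge]
  have hlim := Lp.eLpNorm_lim_le_liminf_eLpNorm (μ := volume) (p := 2)
      (f := fun n p => ∫ v, airy (v + p) * hn n v) (fun n => (h3 n).1.aestronglyMeasurable)
      (fun p => ∫ v, airy (v + p) * h v) (Eventually.of_forall fun p => by
        refine tendsto_integral_of_dominated_convergence (fun v => ‖airy (v + p) * h v‖)
          (fun n => (by fun_prop : Continuous fun v => airy (v + p)).aestronglyMeasurable.mul
            (h2 n).aestronglyMeasurable) (hi p).norm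
          (fun n => Eventually.of_forall fun v => ?_) (Eventually.of_forall fun v => ?_)
        · rw [norm_mul, norm_mul]
          gcongr
          exact norm_indicator_le_norm_self _ _
        · refine tendsto_const_nhds.congr' ?_
          filter_upwards [eventually_ge_atTop ⌈-v⌉₊] with n hn'
          have : -(n : ℝ) ≤ v := by
            have := (Nat.le_ceil (-v)).trans (Nat.cast_le.2 hn'); linarith
          simp [hhn, this])
  refine hlim.trans ?_
  calc liminf (fun n => eLpNorm (fun p => ∫ v, airy (v + p) * hn n v) 2 volume) atTop
      ≤ liminf (fun _ : ℕ => eLpNorm h 2 volume) atTop :=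
        liminf_le_liminf (Eventually.of_forall fun n =>
          (h3 n).2.trans (eLpNorm_indicator_le h))
    _ = _ := liminf_const _


/-! ### Functions as elements of `L²(ℝ)` -/

/-- The real Hilbert space `L²(ℝ)`. -/
abbrev L2R : Type := Lp ℝ 2 (volume : Measure ℝ)

/-- The class in `L²(ℝ)` of a square integrable function (and `0` for other functions). -/
def toL2 (f : ℝ → ℝ) : L2R :=
  open Classical in if h : MemLp f 2 volume then h.toLp f else 0

lemma coeFn_toL2 {f : ℝ → ℝ} (hf : MemLp f 2 volume) : toL2 f =ᵐ[volume] f := by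
  rw [toL2, dif_pos hf]; exact hf.coeFn_toLp

lemma toL2_sub {f g : ℝ → ℝ} (hf : MemLp f 2 volume) (hg : MemLp g 2 volume) :
    toL2 (fun v => f v - g v) = toL2 f - toL2 g := by
  refine Lp.ext ((coeFn_toL2 (hf.sub hg)).trans ?_)
  filter_upwards [Lp.coeFn_sub (toL2 f) (toL2 g), coeFn_toL2 hf, coeFn_toL2 hg] with v h1 h2 h3
  rw [h1]; simp [h2, h3]

lemma toL2_const_mul {f : ℝ → ℝ} (hf : MemLp f 2 volume) (c : ℝ) :
    toL2 (fun v => c * f v) = c • toL2 f := by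
  refine Lp.ext ((coeFn_toL2 (hf.const_mul c)).trans ?_)
  filter_upwards [Lp.coeFn_smul c (toL2 f), coeFn_toL2 hf] with v h1 h2
  rw [h1]; simp [h2]

lemma inner_L2R (F G : L2R) : inner ℝ F G = ∫ v, F v * G v := by
  rw [L2.inner_def]; congr 1; funext v; simp [mul_comm]

lemma inner_toL2 {f : ℝ → ℝ} (hf : MemLp f 2 volume) (G : L2R) :
    inner ℝ (toL2 f) G = ∫ v, f v * G v := by
  rw [inner_L2R]
  refine integral_congr_ae ?_
  filter_upwards [coeFn_toL2 hf] with v hv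
  rw [hv]

lemma inner_toL2_toL2 {f g : ℝ → ℝ} (hf : MemLp f 2 volume) (hg : MemLp g 2 volume) :
    inner ℝ (toL2 f) (toL2 g) = ∫ v, f v * g v := by
  rw [inner_toL2 hf]
  refine integral_congr_ae ?_
  filter_upwards [coeFn_toL2 hg] with v hv
  rw [hv]

lemma norm_toL2_sq {f : ℝ → ℝ} (hf : MemLp f 2 volume) : ‖toL2 f‖ ^ 2 = ∫ v, f v ^ 2 := by
  rw [← real_inner_self_eq_norm_sq, inner_toL2_toL2 hf hf]; simp only [sq]

lemma norm_toL2_le {f b : ℝ → ℝ} (hf : MemLp f 2 volume) (hb : MemLp b 2 volume) {c : ℝ}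
    (hc : 0 ≤ c) (h : ∀ v, |f v| ≤ c * b v) : ‖toL2 f‖ ≤ c * ‖toL2 b‖ := by
  rw [← abs_of_nonneg (norm_nonneg (toL2 f)), ← abs_of_nonneg (mul_nonneg hc (norm_nonneg (toL2 b))),
    ← sq_le_sq, mul_pow, norm_toL2_sq hf, norm_toL2_sq hb, ← integral_const_mul]
  refine integral_mono hf.integrable_sq (hb.integrable_sq.const_mul _) fun v => ?_
  have := h v
  calc f v ^ 2 = |f v| ^ 2 := (sq_abs _).symm
    _ ≤ (c * b v) ^ 2 := by gcongr
    _ = _ := mul_pow _ _ _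

lemma tendsto_toL2 {ι : Type*} {l : Filter ι} [l.IsCountablyGenerated] {F : ι → ℝ → ℝ}
    {f b : ℝ → ℝ} (hb : MemLp b 2 volume) (hf : MemLp f 2 volume)
    (hF : ∀ᶠ i in l, AEStronglyMeasurable (F i) volume)
    (hFb : ∀ᶠ i in l, ∀ v, |F i v| ≤ b v)
    (hlim : ∀ v, Tendsto (fun i => F i v) l (𝓝 (f v))) :
    Tendsto (fun i => toL2 (F i)) l (𝓝 (toL2 f)) := by
  rw [tendsto_iff_norm_sub_tendsto_zero]
  have hm : ∀ᶠ i in l, MemLp (F i) 2 volume := by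
    filter_upwards [hF, hFb] with i h1 h2
    exact hb.of_le h1 (Eventually.of_forall fun v => (h2 v).trans (le_abs_self _))
  have hsq : Tendsto (fun i => ∫ v, (F i v - f v) ^ 2) l (𝓝 0) := by
    have h0 : (0 : ℝ) = ∫ _ : ℝ, (0 : ℝ) := by simp
    rw [h0]
    refine tendsto_integral_filter_of_dominated_convergence (fun v => (b v + |f v|) ^ 2) ?_ ?_
      ((hb.add hf.abs).integrable_sq) (Eventually.of_forall fun v => ?_)
    · filter_upwards [hF] with i hi
      exact (hi.sub hf.aestronglyMeasurable).pow 2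
    · filter_upwards [hFb] with i hi
      refine Eventually.of_forall fun v => ?_
      rw [Real.norm_of_nonneg (sq_nonneg _), ← sq_abs]
      gcongr
      exact (abs_sub _ _).trans (by gcongr; exact hi v)
    · have := ((hlim v).sub_const (f v)).pow 2
      simpa using this
  have h2 := (Real.continuous_sqrt.tendsto 0).comp hsq
  rw [Real.sqrt_zero] at h2
  refine h2.congr' ?_
  filter_upwards [hm] with i hi
  have hs : MemLp (fun v => F i v - f v) 2 volume := hi.sub hf
  rw [Function.comp_apply, ← toL2_sub hi hf, ← norm_toL2_sq hs, Real.sqrt_sq (norm_nonneg _)]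

/-- Differentiation in `L²` of a family dominated together with its derivative. -/
lemma hasDerivAt_toL2 {F F' : ℝ → ℝ → ℝ} {b : ℝ → ℝ} {τ₀ ε : ℝ} (hε : 0 < ε)
    (hb : MemLp b 2 volume) (hF : ∀ τ, MemLp (F τ) 2 volume) (hF' : MemLp (F' τ₀) 2 volume)
    (hFb : ∀ τ ∈ Metric.ball τ₀ ε, ∀ v, |F' τ v| ≤ b v)
    (hd : ∀ τ ∈ Metric.ball τ₀ ε, ∀ v, HasDerivAt (fun τ => F τ v) (F' τ v) τ) :
    HasDerivAt (fun τ => toL2 (F τ)) (toL2 (F' τ₀)) τ₀ := by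
  rw [hasDerivAt_iff_tendsto_slope]
  have h1 : Tendsto (fun τ => toL2 (fun v => (τ - τ₀)⁻¹ * (F τ v - F τ₀ v))) (𝓝[≠] τ₀)
      (𝓝 (toL2 (F' τ₀))) := by
    refine tendsto_toL2 hb hF' ?_ ?_ fun v => ?_
    · exact Eventually.of_forall fun τ => ((hF τ).sub (hF τ₀)).aestronglyMeasurable.const_mul _
    · filter_upwards [nhdsWithin_le_nhds (Metric.ball_mem_nhds τ₀ hε), self_mem_nhdsWithin]
        with τ hτ hne v
      -- The mean value inequality dominates the difference quotients by b, pointwise in v and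
      -- uniformly in τ.
      have h2 := (convex_ball τ₀ ε).norm_image_sub_le_of_norm_hasDerivWithin_le
        (f := fun τ => F τ v) (f' := fun τ => F' τ v) (C := b v)
        (fun x hx => (hd x hx v).hasDerivWithinAt) (fun x hx => hFb x hx v)
        (Metric.mem_ball_self hε) hτ
      have hpos : 0 < |τ - τ₀| := abs_pos.2 (sub_ne_zero.2 hne)
      rw [abs_mul, abs_inv, inv_mul_le_iff₀ hpos, mul_comm]
      exact h2
    · have := hasDerivAt_iff_tendsto_slope.1 (hd τ₀ (Metric.mem_ball_self hε) v)
      exact this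
  refine h1.congr fun τ => ?_
  have h3 : MemLp (fun v => F τ v - F τ₀ v) 2 volume := (hF τ).sub (hF τ₀)
  rw [toL2_const_mul h3, toL2_sub (hF τ) (hF τ₀), slope_def_module]

/-! ### The symbol and its weights -/

/-- The properties of the rescaled symbol that are used: values in `[0,1]`, monotonicity, and
integrability of `(1 + |v|) σ(v)` on the negative half-line. -/
structure IsSymbol (σ : ℝ → ℝ) : Prop where
  mem_Icc : ∀ v, σ v ∈ Set.Icc (0 : ℝ) 1
  mono : Monotone σ
  integrableOn : IntegrableOn (fun v => (1 + |v|) * σ v) (Set.Iic 0)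

namespace IsSymbol

lemma nonneg {σ : ℝ → ℝ} (hσ : IsSymbol σ) (v : ℝ) : 0 ≤ σ v := (hσ.mem_Icc v).1

lemma le_one {σ : ℝ → ℝ} (hσ : IsSymbol σ) (v : ℝ) : σ v ≤ 1 := (hσ.mem_Icc v).2

lemma measurable {σ : ℝ → ℝ} (hσ : IsSymbol σ) : Measurable σ := hσ.mono.measurable

lemma integrable_weight {σ : ℝ → ℝ} (hσ : IsSymbol σ) :
    Integrable (fun v => σ v * ((1 + |v|) * Real.exp (-max v 0))) := by
  rw [← integrableOn_univ, ← Set.Iic_union_Ioi (a := (0 : ℝ)), integrableOn_union]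
  have hm := hσ.measurable
  constructor
  · refine hσ.integrableOn.congr_fun (fun v hv => ?_) measurableSet_Iic
    simp only [max_eq_right (Set.mem_Iic.1 hv), neg_zero, Real.exp_zero]
    ring
  · have h1 : IntegrableOn (fun v : ℝ => 2 * Real.exp (-(1 / 2) * v)) (Set.Ioi 0) :=
      (exp_neg_integrableOn_Ioi 0 (by norm_num)).const_mul 2
    refine h1.mono' (hm.mul (by fun_prop : Continuous fun v : ℝ =>
      (1 + |v|) * Real.exp (-max v 0)).measurable).aestronglyMeasurable ?_
    rw [ae_restrict_iff' measurableSet_Ioi]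
    refine Eventually.of_forall fun v hv => ?_
    have hv : 0 < v := hv
    have h0 := hσ.nonneg v
    rw [Real.norm_of_nonneg (by positivity), abs_of_pos hv, max_eq_left hv.le]
    have h2 : 1 + v ≤ 2 * Real.exp (1 / 2 * v) := by linarith [Real.add_one_le_exp (1 / 2 * v)]
    calc _ ≤ 1 * ((2 * Real.exp (1 / 2 * v)) * Real.exp (-v)) := by
          gcongr; exact hσ.le_one v
      _ = 2 * Real.exp (-(1 / 2) * v) := by
          rw [one_mul, mul_assoc, ← Real.exp_add]; ring_nf

lemma integrable_envelope {σ : ℝ → ℝ} (hσ : IsSymbol σ) : Integrable (fun v => σ v * envelope v) := by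
  refine hσ.integrable_weight.mono'
    (hσ.measurable.mul continuous_envelope.measurable).aestronglyMeasurable
    (Eventually.of_forall fun v => ?_)
  rw [Real.norm_of_nonneg (mul_nonneg (hσ.nonneg v) (envelope_pos v).le), envelope]
  have h0 := hσ.nonneg v
  gcongr
  rw [Real.sqrt_le_left (by positivity)]
  nlinarith [abs_nonneg v]

/-- A positive infimum would make a nonzero constant integrable on a half-line. The limit ensures σ
< 1 far to the left, which the uniqueness argument needs. -/
lemma tendsto_atBot {σ : ℝ → ℝ} (hσ : IsSymbol σ) : Tendsto σ atBot (𝓝 0) := by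
  have hb : BddBelow (Set.range σ) := ⟨0, by rintro _ ⟨v, rfl⟩; exact hσ.nonneg v⟩
  have h1 := tendsto_atBot_ciInf hσ.mono hb
  suffices h : ⨅ i, σ i = 0 by rwa [h] at h1
  refine le_antisymm ?_ (le_ciInf hσ.nonneg)
  by_contra! hpos
  have h2 : IntegrableOn (fun _ : ℝ => ⨅ i, σ i) (Set.Iic (0 : ℝ)) := by
    refine hσ.integrableOn.mono' aestronglyMeasurable_const (Eventually.of_forall fun v => ?_)
    rw [Real.norm_of_nonneg hpos.le]
    have h3 : ⨅ i, σ i ≤ σ v := ciInf_le hb v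
    have := hσ.nonneg v
    nlinarith [abs_nonneg v]
  rw [integrableOn_const_iff] at h2
  rcases h2 with h2 | h2
  · simp at h2; linarith
  · simp at h2

end IsSymbol

/-- The square root of the weight `σ(v) env(v)`. -/
def weight (σ : ℝ → ℝ) (v : ℝ) : ℝ := √(σ v * envelope v)

lemma weight_nonneg (σ : ℝ → ℝ) (v : ℝ) : 0 ≤ weight σ v := Real.sqrt_nonneg _

lemma IsSymbol.memLp_weight {σ : ℝ → ℝ} (hσ : IsSymbol σ) : MemLp (weight σ) 2 volume := by
  have hm : AEStronglyMeasurable (weight σ) volume :=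
    ((hσ.measurable.mul continuous_envelope.measurable).sqrt).aestronglyMeasurable
  rw [memLp_two_iff_integrable_sq hm]
  refine hσ.integrable_envelope.congr (Eventually.of_forall fun v => ?_)
  exact (Real.sq_sqrt (mul_nonneg (hσ.nonneg v) (envelope_pos v).le)).symm

lemma weight_eq {σ : ℝ → ℝ} (hσ : IsSymbol σ) (v : ℝ) : weight σ v = √(σ v) * √(envelope v) :=
  Real.sqrt_mul (hσ.nonneg v) _

/-- Bounds on the shifted Airy functions, uniform for bounded shifts. -/
lemma exists_shift_bounds (T : ℝ) :
    ∃ B, 0 < B ∧ ∀ τ : ℝ, |τ| ≤ T → ∀ v : ℝ,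
      √(airyKernel (v - τ) (v - τ)) ≤ B * √(envelope v) ∧
      |airy (v - τ)| ≤ B * √(envelope v) ∧ |airy' (v - τ)| ≤ B * √(envelope v) ∧
      √(1 + |v|) * |airy (v - τ)| ≤ B * √(envelope v) := by
  obtain ⟨C, hC, h⟩ := exists_airy_le_envelope
  rcases lt_or_ge T 0 with hT | hT
  · exact ⟨1, one_pos, fun τ hτ => absurd ((abs_nonneg τ).trans hτ) (not_le.2 hT)⟩
  set D := (1 + T) * (C * ((1 + T) * Real.exp T)) with hD
  have hD0 : 0 < D := by positivity
  refine ⟨√D, Real.sqrt_pos.2 hD0, fun τ hτ v => ?_⟩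
  obtain ⟨h1, h2, h3⟩ := h (v - τ)
  have he := envelope_shift hτ v
  have hle : C * envelope (v - τ) ≤ C * ((1 + T) * Real.exp T) * envelope v := by
    rw [mul_assoc]; gcongr
  have hep := envelope_pos v
  have hle' : C * envelope (v - τ) ≤ D * envelope v := by
    refine hle.trans ?_
    gcongr
    rw [hD]
    exact le_mul_of_one_le_left (by positivity) (by linarith)
  rw [← Real.sqrt_mul hD0.le]
  have habs : 1 + |v| ≤ (1 + T) * (1 + |v - τ|) := by
    have : |v| ≤ |v - τ| + |τ| := by simpa using abs_add_le (v - τ) τ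
    nlinarith [abs_nonneg (v - τ)]
  have h4 : (1 + |v|) * airy (v - τ) ^ 2 ≤ D * envelope v := by
    calc _ ≤ ((1 + T) * (1 + |v - τ|)) * airy (v - τ) ^ 2 := by gcongr
      _ = (1 + T) * ((1 + |v - τ|) * airy (v - τ) ^ 2) := by ring
      _ ≤ (1 + T) * (C * ((1 + T) * Real.exp T) * envelope v) := by
        exact mul_le_mul_of_nonneg_left (h3.trans hle) (by positivity)
      _ = _ := by rw [hD]; ring
  refine ⟨Real.sqrt_le_sqrt (h1.trans hle'), ?_, Real.abs_le_sqrt (h2.trans hle'), ?_⟩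
  · refine Real.abs_le_sqrt (le_trans ?_ h4)
    nlinarith [abs_nonneg v, sq_nonneg (airy (v - τ)),
      mul_nonneg (abs_nonneg v) (sq_nonneg (airy (v - τ)))]
  · rw [← Real.sqrt_sq_eq_abs (airy (v - τ)), ← Real.sqrt_mul (by positivity)]
    exact Real.sqrt_le_sqrt h4

/-! ### Continuity of the kernel -/

lemma continuous_airyKernel : Continuous fun p : ℝ × ℝ => airyKernel p.1 p.2 := by
  obtain ⟨C, hC, h⟩ := exists_abs_airy_le
  simp only [airyKernel_eq_integral]
  refine continuous_iff_continuousAt.2 fun p₀ => ?_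
  refine continuousAt_of_dominated (bound := fun y =>
    C * Real.exp (1 - p₀.1) * (C * Real.exp (1 - p₀.2)) * Real.exp (-2 * y)) ?_ ?_ ?_ ?_
  · exact Eventually.of_forall fun p =>
      (by fun_prop : Continuous fun y => airy (p.1 + y) * airy (p.2 + y)).aestronglyMeasurable
  · filter_upwards [Metric.ball_mem_nhds p₀ one_pos] with p hp
    refine Eventually.of_forall fun y => ?_
    have hp1 : |p.1 - p₀.1| < 1 := lt_of_le_of_lt (le_max_left _ _) hp
    have hp2 : |p.2 - p₀.2| < 1 := lt_of_le_of_lt (le_max_right _ _) hp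
    rw [norm_mul]
    calc _ ≤ (C * Real.exp (-(p.1 + y))) * (C * Real.exp (-(p.2 + y))) :=
          mul_le_mul (h _).1 (h _).1 (abs_nonneg _) (by positivity)
      _ ≤ (C * Real.exp (1 - p₀.1 + -y)) * (C * Real.exp (1 - p₀.2 + -y)) := by
          gcongr
          · linarith [(abs_lt.1 hp1).1]
          · linarith [(abs_lt.1 hp2).1]
      _ = _ := by
          rw [show -2 * y = -y + -y by ring]
          simp only [Real.exp_add]; ring
  · exact (exp_neg_integrableOn_Ioi 0 two_pos).const_mul _
  · exact Eventually.of_forall fun y =>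
      (by fun_prop : Continuous fun p : ℝ × ℝ => airy (p.1 + y) * airy (p.2 + y)).continuousAt

/-- Substituting s = τ - y displays the shifted kernel as a superposition of rank one kernels with τ
only in the endpoint; `airyOp` is modelled on this. -/
lemma airyKernel_shift_eq_integral (u v τ : ℝ) :
    IntegrableOn (fun s => airy (u - s) * airy (v - s)) (Set.Iic τ) ∧
    airyKernel (u - τ) (v - τ) = ∫ s in Set.Iic τ, airy (u - s) * airy (v - s) := by
  have hmp := Measure.measurePreserving_sub_left (volume : Measure ℝ) τ
  have hemb : MeasurableEmbedding fun s : ℝ => τ - s :=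
    (Homeomorph.subLeft τ).measurableEmbedding
  have hpre : (fun s : ℝ => τ - s) ⁻¹' (Set.Ici 0) = Set.Iic τ := by ext s; simp
  have hfun : (fun s => airy (u - s) * airy (v - s)) =
      (fun y => airy (u - τ + y) * airy (v - τ + y)) ∘ fun s : ℝ => τ - s := by
    funext s; simp only [Function.comp]; congr 2 <;> ring
  constructor
  · rw [hfun, ← hpre, hmp.integrableOn_comp_preimage hemb]
    exact (integrableOn_Ici_iff_integrableOn_Ioi enorm_ne_top).2 (integrableOn_airy_mul _ _)
  · rw [airyKernel_eq_integral, ← integral_Ici_eq_integral_Ioi, ← hpre, hfun]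
    exact (hmp.setIntegral_preimage_emb hemb _ _).symm


/-! ### The vectors attached to the symbol -/

/-- `√σ(v) Ai(v - τ)`. -/
def airyVec (σ : ℝ → ℝ) (τ v : ℝ) : ℝ := √(σ v) * airy (v - τ)

/-- `√σ(v) Ai'(v - τ)`. -/
def airyVec' (σ : ℝ → ℝ) (τ v : ℝ) : ℝ := √(σ v) * airy' (v - τ)

/-- `K(z - τ, v - τ) √σ(v)`. -/
def kernelVec (σ : ℝ → ℝ) (τ z v : ℝ) : ℝ := airyKernel (z - τ) (v - τ) * √(σ v)

/-- The vector `√σ Ai(· - τ)` in `L²`. -/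
def airyL2 (σ : ℝ → ℝ) (τ : ℝ) : L2R := toL2 (airyVec σ τ)

/-- The vector `√σ Ai'(· - τ)` in `L²`. -/
def airyL2' (σ : ℝ → ℝ) (τ : ℝ) : L2R := toL2 (airyVec' σ τ)

/-- The vector `K(z - τ, · - τ) √σ` in `L²`. -/
def kernelL2 (σ : ℝ → ℝ) (τ z : ℝ) : L2R := toL2 (kernelVec σ τ z)

lemma exists_vec_bounds {σ : ℝ → ℝ} (hσ : IsSymbol σ) (T : ℝ) :
    ∃ B, 0 < B ∧ ∀ τ : ℝ, |τ| ≤ T → ∀ v : ℝ,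
      |airyVec σ τ v| ≤ B * weight σ v ∧ |airyVec' σ τ v| ≤ B * weight σ v ∧
      (∀ z, |kernelVec σ τ z v| ≤ √(airyKernel (z - τ) (z - τ)) * B * weight σ v) ∧
      √(σ v) * √(airyKernel (v - τ) (v - τ)) ≤ B * weight σ v := by
  obtain ⟨B, hB, h⟩ := exists_shift_bounds T
  refine ⟨B, hB, fun τ hτ v => ?_⟩
  obtain ⟨h1, h2, h3, -⟩ := h τ hτ v
  rw [weight_eq hσ]
  have hs := Real.sqrt_nonneg (σ v)
  refine ⟨?_, ?_, fun z => ?_, ?_⟩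
  · rw [airyVec, abs_mul, abs_of_nonneg hs]
    calc _ ≤ √(σ v) * (B * √(envelope v)) := by gcongr
      _ = _ := by ring
  · rw [airyVec', abs_mul, abs_of_nonneg hs]
    calc _ ≤ √(σ v) * (B * √(envelope v)) := by gcongr
      _ = _ := by ring
  · rw [kernelVec, abs_mul, abs_of_nonneg hs]
    calc _ ≤ (√(airyKernel (z - τ) (z - τ)) * √(airyKernel (v - τ) (v - τ))) * √(σ v) := by
          gcongr; exact abs_airyKernel_le _ _
      _ ≤ (√(airyKernel (z - τ) (z - τ)) * (B * √(envelope v))) * √(σ v) := by gcongr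
      _ = _ := by ring
  · calc _ ≤ √(σ v) * (B * √(envelope v)) := by gcongr
      _ = _ := by ring

lemma measurable_airyVec {σ : ℝ → ℝ} (hσ : IsSymbol σ) (τ : ℝ) : Measurable (airyVec σ τ) :=
  hσ.measurable.sqrt.mul (by fun_prop : Continuous fun v => airy (v - τ)).measurable

lemma measurable_airyVec' {σ : ℝ → ℝ} (hσ : IsSymbol σ) (τ : ℝ) : Measurable (airyVec' σ τ) :=
  hσ.measurable.sqrt.mul (by fun_prop : Continuous fun v => airy' (v - τ)).measurable

lemma measurable_kernelVec {σ : ℝ → ℝ} (hσ : IsSymbol σ) (τ z : ℝ) :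
    Measurable (kernelVec σ τ z) :=
  (continuous_airyKernel.comp (by fun_prop : Continuous fun v : ℝ => (z - τ, v - τ))).measurable.mul
    hσ.measurable.sqrt

lemma memLp_airyVec {σ : ℝ → ℝ} (hσ : IsSymbol σ) (τ : ℝ) : MemLp (airyVec σ τ) 2 volume := by
  obtain ⟨B, hB, h⟩ := exists_vec_bounds hσ |τ|
  exact MemLp.of_le_mul hσ.memLp_weight (measurable_airyVec hσ τ).aestronglyMeasurable
    (Eventually.of_forall fun v => ((h τ le_rfl v).1).trans (by
      rw [Real.norm_of_nonneg (weight_nonneg σ v)]))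

lemma memLp_airyVec' {σ : ℝ → ℝ} (hσ : IsSymbol σ) (τ : ℝ) : MemLp (airyVec' σ τ) 2 volume := by
  obtain ⟨B, hB, h⟩ := exists_vec_bounds hσ |τ|
  exact MemLp.of_le_mul hσ.memLp_weight (measurable_airyVec' hσ τ).aestronglyMeasurable
    (Eventually.of_forall fun v => ((h τ le_rfl v).2.1).trans (by
      rw [Real.norm_of_nonneg (weight_nonneg σ v)]))

lemma memLp_kernelVec {σ : ℝ → ℝ} (hσ : IsSymbol σ) (τ z : ℝ) :
    MemLp (kernelVec σ τ z) 2 volume := by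
  obtain ⟨B, hB, h⟩ := exists_vec_bounds hσ |τ|
  exact MemLp.of_le_mul hσ.memLp_weight (measurable_kernelVec hσ τ z).aestronglyMeasurable
    (Eventually.of_forall fun v => ((h τ le_rfl v).2.2.1 z).trans (by
      rw [Real.norm_of_nonneg (weight_nonneg σ v)]))

lemma exists_norm_kernelL2_le {σ : ℝ → ℝ} (hσ : IsSymbol σ) (T : ℝ) :
    ∃ B, 0 < B ∧ ∀ τ : ℝ, |τ| ≤ T → ∀ z : ℝ,
      ‖kernelL2 σ τ z‖ ≤ B * √(airyKernel (z - τ) (z - τ)) := by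
  obtain ⟨B, hB, h⟩ := exists_vec_bounds hσ T
  refine ⟨B * ‖toL2 (weight σ)‖ + 1, by positivity, fun τ hτ z => ?_⟩
  have := norm_toL2_le (memLp_kernelVec hσ τ z) hσ.memLp_weight
    (c := √(airyKernel (z - τ) (z - τ)) * B) (by positivity) fun v => (h τ hτ v).2.2.1 z
  refine this.trans ?_
  have := Real.sqrt_nonneg (airyKernel (z - τ) (z - τ))
  nlinarith

lemma hasDerivAt_airyL2 {σ : ℝ → ℝ} (hσ : IsSymbol σ) (τ : ℝ) :
    HasDerivAt (airyL2 σ) (-airyL2' σ τ) τ := by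
  obtain ⟨B, hB, h⟩ := exists_vec_bounds hσ (|τ| + 1)
  have := hasDerivAt_toL2 (F := airyVec σ) (F' := fun τ v => -1 * airyVec' σ τ v) (τ₀ := τ)
    one_pos (hσ.memLp_weight.const_mul B) (memLp_airyVec hσ) ((memLp_airyVec' hσ τ).const_mul _)
    (fun s hs v => by
      have hs' : |s| ≤ |τ| + 1 := by
        have h1 : |s - τ| < 1 := hs
        have h2 := abs_add_le (s - τ) τ
        rw [sub_add_cancel] at h2; linarith
      simpa using (h s hs' v).2.1)
    (fun s _ v => by
      exact ((hasDerivAt_airy_shift v s).const_mul (√(σ v))).congr_deriv (by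
        simp only [airyVec']; ring))
  rw [toL2_const_mul (memLp_airyVec' hσ τ), neg_one_smul] at this
  exact this

lemma continuous_airyL2 {σ : ℝ → ℝ} (hσ : IsSymbol σ) : Continuous (airyL2 σ) :=
  continuous_iff_continuousAt.2 fun τ => (hasDerivAt_airyL2 hσ τ).continuousAt

lemma abs_le_add_one_of_mem_ball {s τ : ℝ} (hs : s ∈ Metric.ball τ 1) : |s| ≤ |τ| + 1 := by
  have h1 : |s - τ| < 1 := hs
  have h2 := abs_add_le (s - τ) τ
  rw [sub_add_cancel] at h2; linarith

lemma continuous_airyL2' {σ : ℝ → ℝ} (hσ : IsSymbol σ) : Continuous (airyL2' σ) := by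
  refine continuous_iff_continuousAt.2 fun τ => ?_
  obtain ⟨B, hB, h⟩ := exists_vec_bounds hσ (|τ| + 1)
  refine tendsto_toL2 (hσ.memLp_weight.const_mul B) (memLp_airyVec' hσ τ)
    (Eventually.of_forall fun s => (memLp_airyVec' hσ s).aestronglyMeasurable) ?_ fun v => ?_
  · filter_upwards [Metric.ball_mem_nhds τ one_pos] with s hs v
    exact (h s (abs_le_add_one_of_mem_ball hs) v).2.1
  · exact (by unfold airyVec'; fun_prop : Continuous fun s => airyVec' σ s v).continuousAt

lemma hasDerivAt_kernelL2 {σ : ℝ → ℝ} (hσ : IsSymbol σ) (z τ : ℝ) :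
    HasDerivAt (fun τ => kernelL2 σ τ z) (airy (z - τ) • airyL2 σ τ) τ := by
  obtain ⟨B, hB, h⟩ := exists_vec_bounds hσ (|τ| + 1)
  obtain ⟨B', hB', h'⟩ := exists_shift_bounds (|τ| + 1)
  have := hasDerivAt_toL2 (F := fun τ => kernelVec σ τ z)
    (F' := fun τ v => airy (z - τ) * airyVec σ τ v) (τ₀ := τ)
    one_pos (hσ.memLp_weight.const_mul (B' * √(envelope z) * B)) (fun τ => memLp_kernelVec hσ τ z)
    ((memLp_airyVec hσ τ).const_mul _)
    (fun s hs v => by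
      have hs' := abs_le_add_one_of_mem_ball hs
      rw [abs_mul, mul_assoc]
      exact mul_le_mul (h' s hs' z).2.1 (h s hs' v).1 (abs_nonneg _) (by positivity))
    (fun s _ v => by
      exact ((hasDerivAt_airyKernel_shift z v s).mul_const (√(σ v))).congr_deriv (by
        simp only [airyVec]; ring))
  rwa [toL2_const_mul (memLp_airyVec hσ τ)] at this

lemma continuous_kernelL2 {σ : ℝ → ℝ} (hσ : IsSymbol σ) :
    Continuous fun p : ℝ × ℝ => kernelL2 σ p.1 p.2 := by
  refine continuous_iff_continuousAt.2 fun p₀ => ?_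
  obtain ⟨B, hB, h⟩ := exists_vec_bounds hσ (|p₀.1| + 1)
  have hK : Continuous fun p : ℝ × ℝ => √(airyKernel (p.2 - p.1) (p.2 - p.1)) :=
    (continuous_airyKernel.comp (by fun_prop : Continuous fun p : ℝ × ℝ =>
      (p.2 - p.1, p.2 - p.1))).sqrt
  set M := √(airyKernel (p₀.2 - p₀.1) (p₀.2 - p₀.1)) + 1 with hM
  refine tendsto_toL2 (hσ.memLp_weight.const_mul (M * B)) (memLp_kernelVec hσ p₀.1 p₀.2)
    (Eventually.of_forall fun p => (memLp_kernelVec hσ p.1 p.2).aestronglyMeasurable) ?_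
    fun v => ?_
  · have h1 : ∀ᶠ p in 𝓝 p₀, √(airyKernel (p.2 - p.1) (p.2 - p.1)) < M :=
      hK.continuousAt.eventually_lt_const (by simp [hM])
    filter_upwards [h1, continuous_fst.continuousAt.preimage_mem_nhds
      (Metric.ball_mem_nhds p₀.1 one_pos)] with p hp1 hp2 v
    refine ((h p.1 (abs_le_add_one_of_mem_ball hp2) v).2.2.1 p.2).trans ?_
    have := weight_nonneg σ v
    gcongr
  · have : Continuous fun p : ℝ × ℝ => kernelVec σ p.1 p.2 v := by
      unfold kernelVec
      exact (continuous_airyKernel.comp (by fun_prop : Continuous fun p : ℝ × ℝ =>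
        (p.2 - p.1, v - p.1))).mul continuous_const
    exact this.continuousAt

/-! ### The integral operator -/

/-- By Tonelli the squared norm is ∫ σ(v) K(v - τ, v - τ) dv, the trace of the operator. This
finiteness justifies the exchanges of integrals over s ≤ τ and over v. -/
lemma memLp_airyVec_prod {σ : ℝ → ℝ} (hσ : IsSymbol σ) (τ : ℝ) :
    MemLp (fun p : ℝ × ℝ => airyVec σ p.1 p.2) 2
      ((volume.restrict (Set.Iic τ)).prod volume) := by
  have hm : Measurable fun p : ℝ × ℝ => airyVec σ p.1 p.2 :=
    (hσ.measurable.comp measurable_snd).sqrt.mul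
      (by fun_prop : Continuous fun p : ℝ × ℝ => airy (p.2 - p.1)).measurable
  rw [memLp_two_iff_integrable_sq hm.aestronglyMeasurable]
  rw [integrable_prod_iff' (hm.pow_const 2).aestronglyMeasurable]
  have he : ∀ v s : ℝ, airyVec σ s v ^ 2 = σ v * (airy (v - s) * airy (v - s)) := fun v s => by
    rw [airyVec, mul_pow, Real.sq_sqrt (hσ.nonneg v)]; ring
  constructor
  · refine Eventually.of_forall fun v => ?_
    simp only [he]
    exact (airyKernel_shift_eq_integral v v τ).1.const_mul _
  · obtain ⟨B, hB, h⟩ := exists_vec_bounds hσ |τ|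
    have h1 : ∀ v, ∫ s in Set.Iic τ, ‖airyVec σ s v ^ 2‖ = σ v * airyKernel (v - τ) (v - τ) := by
      intro v
      have h2 : ∀ s, ‖airyVec σ s v ^ 2‖ = σ v * (airy (v - s) * airy (v - s)) := fun s => by
        rw [Real.norm_of_nonneg (sq_nonneg _), he]
      simp only [h2]
      rw [integral_const_mul, ← (airyKernel_shift_eq_integral v v τ).2]
    simp only [h1]
    refine (hσ.memLp_weight.integrable_sq.const_mul (B ^ 2)).mono'
      (hσ.measurable.mul (continuous_airyKernel.comp (by fun_prop : Continuous fun v : ℝ =>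
        (v - τ, v - τ))).measurable).aestronglyMeasurable (Eventually.of_forall fun v => ?_)
    have hK := airyKernel_self_nonneg (v - τ)
    rw [Real.norm_of_nonneg (mul_nonneg (hσ.nonneg v) hK), ← mul_pow]
    have h2 := (h τ le_rfl v).2.2.2
    calc σ v * airyKernel (v - τ) (v - τ)
        = (√(σ v) * √(airyKernel (v - τ) (v - τ))) ^ 2 := by
          rw [mul_pow, Real.sq_sqrt (hσ.nonneg v), Real.sq_sqrt hK]
      _ ≤ _ := by gcongr

lemma integrableOn_norm_airyL2_sq {σ : ℝ → ℝ} (hσ : IsSymbol σ) (τ : ℝ) :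
    IntegrableOn (fun s => ‖airyL2 σ s‖ ^ 2) (Set.Iic τ) := by
  have h := (memLp_airyVec_prod hσ τ).integrable_sq.integral_prod_left
  refine h.congr (Eventually.of_forall fun s => ?_)
  simp only [airyL2, norm_toL2_sq (memLp_airyVec hσ s)]

lemma continuous_rankOne_self {E : Type*} [NormedAddCommGroup E] [InnerProductSpace ℝ E] :
    Continuous fun x : E => InnerProductSpace.rankOne ℝ x x := by
  have h1 : Continuous fun p : E × E => InnerProductSpace.rankOne ℝ p.1 p.2 := by
    simp only [InnerProductSpace.rankOne_def]
    exact ((ContinuousLinearMap.smulRightL ℝ E E).continuous₂).comp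
      (((innerSL ℝ (E := E)).continuous.comp continuous_snd).prodMk continuous_fst)
  exact h1.comp (continuous_id.prodMk continuous_id)

/-- Used with the subspace of compact operators: an integral of compact operators is compact. -/
lemma integral_mem_of_isClosed {E : Type*} [NormedAddCommGroup E] [NormedSpace ℝ E]
    [CompleteSpace E] (S : Submodule ℝ E) (hS : IsClosed (S : Set E)) {f : ℝ → E}
    (hf : Continuous f) {μ : Measure ℝ} (hi : Integrable f μ) (hm : ∀ s, f s ∈ S) :
    ∫ s, f s ∂μ ∈ S := by
  have : CompleteSpace S := hS.completeSpace_coe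
  set F : ℝ → S := fun s => ⟨f s, hm s⟩
  have hF : Continuous F := hf.subtype_mk _
  have hFi : Integrable F μ :=
    hi.norm.mono' hF.aestronglyMeasurable (Eventually.of_forall fun s => le_rfl)
  have h2 : ∫ s, f s ∂μ = S.subtypeL (∫ s, F s ∂μ) := S.subtypeL.integral_comp_comm hFi
  rw [h2]; exact (∫ s, F s ∂μ).2

lemma integrableOn_rankOne {σ : ℝ → ℝ} (hσ : IsSymbol σ) (τ : ℝ) :
    IntegrableOn (fun s => InnerProductSpace.rankOne ℝ (airyL2 σ s) (airyL2 σ s)) (Set.Iic τ) := by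
  have hc := continuous_airyL2 hσ
  refine (integrableOn_norm_airyL2_sq hσ τ).mono' ?_ (Eventually.of_forall fun s => ?_)
  · exact (continuous_rankOne_self.comp hc).aestronglyMeasurable
  · rw [InnerProductSpace.norm_rankOne, sq]

/-- The integral operator on `L²(ℝ)` with kernel `√σ(u) K(u - τ, v - τ) √σ(v)`, as an integral of
rank one operators. -/
def airyOp (σ : ℝ → ℝ) (τ : ℝ) : L2R →L[ℝ] L2R :=
  ∫ s in Set.Iic τ, InnerProductSpace.rankOne ℝ (airyL2 σ s) (airyL2 σ s)

/-- The rank one integrand is norm continuous in s, so the fundamental theorem of calculus holds in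
operator norm. This is what the definition as an operator-valued integral is for. -/
lemma hasDerivAt_airyOp {σ : ℝ → ℝ} (hσ : IsSymbol σ) (τ : ℝ) :
    HasDerivAt (airyOp σ) (InnerProductSpace.rankOne ℝ (airyL2 σ τ) (airyL2 σ τ)) τ := by
  have hc := continuous_airyL2 hσ
  have hcont : Continuous fun s => InnerProductSpace.rankOne ℝ (airyL2 σ s) (airyL2 σ s) :=
    continuous_rankOne_self.comp hc
  have h1 : ∀ τ', airyOp σ τ' = airyOp σ τ +
      ∫ s in τ..τ', InnerProductSpace.rankOne ℝ (airyL2 σ s) (airyL2 σ s) := fun τ' => by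
    rw [← intervalIntegral.integral_Iic_sub_Iic (integrableOn_rankOne hσ τ)
      (integrableOn_rankOne hσ τ'), airyOp, airyOp]
    abel
  rw [show airyOp σ = fun τ' => airyOp σ τ + ∫ s in τ..τ',
    InnerProductSpace.rankOne ℝ (airyL2 σ s) (airyL2 σ s) from funext h1]
  exact (intervalIntegral.integral_hasDerivAt_right (hcont.intervalIntegrable _ _)
    (hcont.stronglyMeasurableAtFilter _ _) hcont.continuousAt).const_add _

lemma inner_airyOp {σ : ℝ → ℝ} (hσ : IsSymbol σ) (τ : ℝ) (f h : L2R) :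
    inner ℝ (airyOp σ τ f) h =
      ∫ s in Set.Iic τ, inner ℝ (airyL2 σ s) f * inner ℝ (airyL2 σ s) h := by
  rw [airyOp, ContinuousLinearMap.integral_apply (integrableOn_rankOne hσ τ), real_inner_comm,
    ← integral_inner ((integrableOn_rankOne hσ τ).apply_continuousLinearMap f)]
  congr 1; funext s
  rw [InnerProductSpace.rankOne_apply, real_inner_smul_right, real_inner_comm h]

lemma inner_airyOp_comm {σ : ℝ → ℝ} (hσ : IsSymbol σ) (τ : ℝ) (f h : L2R) :
    inner ℝ (airyOp σ τ f) h = inner ℝ f (airyOp σ τ h) := by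
  rw [inner_airyOp hσ, real_inner_comm, inner_airyOp hσ]
  simp only [mul_comm]

lemma isCompactOperator_airyOp {σ : ℝ → ℝ} (hσ : IsSymbol σ) (τ : ℝ) :
    IsCompactOperator (airyOp σ τ) := by
  set S := compactOperator (RingHom.id ℝ) L2R L2R with hS
  have hclosed : IsClosed (S : Set (L2R →L[ℝ] L2R)) := isClosed_setOfPred_isCompactOperator
  have hr : ∀ x : L2R, InnerProductSpace.rankOne ℝ x x ∈ S := fun x => by
    have h1 : IsCompactOperator (id : ℝ → ℝ) :=
      isCompactOperator_id_iff_finiteDimensional (𝕜 := ℝ).2 inferInstance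
    exact (h1.comp_clm (innerSL ℝ x)).clm_comp (ContinuousLinearMap.toSpanSingleton ℝ x)
  exact integral_mem_of_isClosed S hclosed
    (continuous_rankOne_self.comp (continuous_airyL2 hσ)) (integrableOn_rankOne hσ τ)
    fun s => hr (airyL2 σ s)

/-- Fubini between s and u. It is used with c(s) = Ai(z - s), to compute `kernelL2`, and with c(s) =
⟨g_s, f⟩, to compute the operator. -/
lemma integral_mul_transform {σ : ℝ → ℝ} (hσ : IsSymbol σ) (τ : ℝ) {c : ℝ → ℝ}
    (hc : MemLp c 2 (volume.restrict (Set.Iic τ))) (f : L2R) :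
    ∫ u, f u * (√(σ u) * ∫ s in Set.Iic τ, airy (u - s) * c s) =
      ∫ s in Set.Iic τ, c s * inner ℝ (airyL2 σ s) f := by
  have hprod : MemLp (fun p : ℝ × ℝ => c p.1 * f p.2) 2
      ((volume.restrict (Set.Iic τ)).prod volume) := by
    have hm := hc.aestronglyMeasurable.comp_fst (ν := (volume : Measure ℝ)) |>.mul
      ((Lp.memLp f).aestronglyMeasurable.comp_snd (μ := volume.restrict (Set.Iic τ)))
    refine (memLp_two_iff_integrable_sq hm).2 ?_
    refine (hc.integrable_sq.mul_prod (Lp.memLp f).integrable_sq).congr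
      (Eventually.of_forall fun p => ?_)
    simp [mul_pow]
  have hint := (memLp_airyVec_prod hσ τ).integrable_mul hprod
  have hswap := integral_integral_swap (f := fun s u => airyVec σ s u * (c s * f u)) hint
  calc _ = ∫ u, ∫ s in Set.Iic τ, airyVec σ s u * (c s * f u) := by
        congr 1; funext u
        rw [← integral_const_mul, ← integral_const_mul]
        congr 1; funext s; rw [airyVec]; ring
    _ = ∫ s in Set.Iic τ, ∫ u, airyVec σ s u * (c s * f u) := hswap.symm
    _ = _ := by
        congr 1; funext s
        rw [airyL2, inner_toL2 (memLp_airyVec hσ s), ← integral_const_mul]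
        congr 1; funext u; ring

lemma inner_kernelL2 {σ : ℝ → ℝ} (hσ : IsSymbol σ) (τ z : ℝ) (f : L2R) :
    inner ℝ (kernelL2 σ τ z) f =
      ∫ s in Set.Iic τ, airy (z - s) * inner ℝ (airyL2 σ s) f := by
  have hc : MemLp (fun s => airy (z - s)) 2 (volume.restrict (Set.Iic τ)) := by
    rw [memLp_two_iff_integrable_sq
      (by fun_prop : Continuous fun s => airy (z - s)).aestronglyMeasurable]
    simp only [sq]
    exact (airyKernel_shift_eq_integral z z τ).1
  rw [← integral_mul_transform hσ τ hc f, kernelL2, inner_toL2 (memLp_kernelVec hσ τ z)]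
  congr 1; funext v
  rw [← (airyKernel_shift_eq_integral v z τ).2, kernelVec, airyKernel_comm]
  ring

/-- The function `u ↦ √σ(u) ⟨κ_u, f⟩` representing the operator applied to `f`. -/
def opFun (σ : ℝ → ℝ) (τ : ℝ) (f : L2R) (u : ℝ) : ℝ := √(σ u) * inner ℝ (kernelL2 σ τ u) f

lemma exists_abs_opFun_le {σ : ℝ → ℝ} (hσ : IsSymbol σ) (T : ℝ) :
    ∃ B, 0 < B ∧ ∀ τ : ℝ, |τ| ≤ T → ∀ (f : L2R) (u : ℝ),
      |opFun σ τ f u| ≤ B * ‖f‖ * weight σ u := by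
  obtain ⟨B, hB, h⟩ := exists_vec_bounds hσ T
  obtain ⟨B', hB', h'⟩ := exists_norm_kernelL2_le hσ T
  refine ⟨B' * B, by positivity, fun τ hτ f u => ?_⟩
  have h1 := (h τ hτ u).2.2.2
  have h2 := h' τ hτ u
  have h3 := abs_real_inner_le_norm (kernelL2 σ τ u) f
  rw [opFun, abs_mul, abs_of_nonneg (Real.sqrt_nonneg _)]
  calc √(σ u) * |inner ℝ (kernelL2 σ τ u) f|
      ≤ √(σ u) * ((B' * √(airyKernel (u - τ) (u - τ))) * ‖f‖) := by
        gcongr; exact h3.trans (by gcongr)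
    _ = B' * ‖f‖ * (√(σ u) * √(airyKernel (u - τ) (u - τ))) := by ring
    _ ≤ B' * ‖f‖ * (B * weight σ u) := by gcongr
    _ = _ := by ring

lemma measurable_opFun {σ : ℝ → ℝ} (hσ : IsSymbol σ) (τ : ℝ) (f : L2R) :
    Measurable (opFun σ τ f) := by
  have h1 : Continuous fun u => kernelL2 σ τ u :=
    (continuous_kernelL2 hσ).comp (by fun_prop : Continuous fun u : ℝ => (τ, u))
  exact hσ.measurable.sqrt.mul (by fun_prop : Continuous fun u => inner ℝ (kernelL2 σ τ u) f).measurable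

lemma memLp_opFun {σ : ℝ → ℝ} (hσ : IsSymbol σ) (τ : ℝ) (f : L2R) :
    MemLp (opFun σ τ f) 2 volume := by
  obtain ⟨B, hB, h⟩ := exists_abs_opFun_le hσ |τ|
  exact MemLp.of_le_mul hσ.memLp_weight (measurable_opFun hσ τ f).aestronglyMeasurable
    (Eventually.of_forall fun u => (h τ le_rfl f u).trans (by
      rw [Real.norm_of_nonneg (weight_nonneg σ u)]))

/-- Tested against an arbitrary vector, the operator integral is the integral operator with the Airy
kernel; this ties the abstract resolvent to pointwise equations. -/
lemma airyOp_eq {σ : ℝ → ℝ} (hσ : IsSymbol σ) (τ : ℝ) (f : L2R) :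
    airyOp σ τ f = toL2 (opFun σ τ f) := by
  refine ext_inner_right ℝ fun h => ?_
  rw [inner_airyOp hσ, inner_toL2 (memLp_opFun hσ τ f)]
  have hc0 := continuous_airyL2 hσ
  have hcont : Continuous fun s => inner ℝ (airyL2 σ s) f := by fun_prop
  have hc : MemLp (fun s => inner ℝ (airyL2 σ s) f) 2 (volume.restrict (Set.Iic τ)) := by
    rw [memLp_two_iff_integrable_sq hcont.aestronglyMeasurable]
    refine ((integrableOn_norm_airyL2_sq hσ τ).mul_const (‖f‖ ^ 2)).mono'
      (hcont.pow 2).aestronglyMeasurable (Eventually.of_forall fun s => ?_)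
    rw [Real.norm_of_nonneg (sq_nonneg _), ← mul_pow, ← sq_abs]
    gcongr
    exact abs_real_inner_le_norm _ _
  rw [← integral_mul_transform hσ τ hc h]
  congr 1; funext u
  rw [opFun, inner_kernelL2 hσ]
  ring

lemma coeFn_airyOp {σ : ℝ → ℝ} (hσ : IsSymbol σ) (τ : ℝ) (f : L2R) :
    airyOp σ τ f =ᵐ[volume] opFun σ τ f := by
  rw [airyOp_eq hσ]; exact coeFn_toL2 (memLp_opFun hσ τ f)


/-! ### Invertibility of `1 - K` -/

lemma integral_sq_le_of_eLpNorm_le {f g : ℝ → ℝ} (hf : MemLp f 2 volume) (hg : MemLp g 2 volume)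
    (h : eLpNorm f 2 volume ≤ eLpNorm g 2 volume) : ∫ v, f v ^ 2 ≤ ∫ v, g v ^ 2 := by
  rw [← norm_toL2_sq hf, ← norm_toL2_sq hg, toL2, toL2, dif_pos hf, dif_pos hg, Lp.norm_toLp,
    Lp.norm_toLp]
  have := ENNReal.toReal_mono hg.2.ne h
  gcongr

/-- The support is bounded on the left, so the decay of Ai and Ai' to the right in horizontal strips
dominates the integral locally uniformly in z. -/
lemma differentiable_integral_airyC {w : ℝ → ℝ} (hw : MemLp w 2 volume) {c : ℝ}
    (hs : ∀ v, v < c → w v = 0) :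
    Differentiable ℂ fun z : ℂ => ∫ v : ℝ, airyC (v - z) * (w v : ℂ) := by
  intro z₀
  obtain ⟨C, hC, h⟩ := exists_norm_airyC_le (|z₀.im| + 1)
  have hwi : Integrable (fun v => Real.exp (-v) * |w v|) := by
    have hi : IntegrableOn (fun v : ℝ => Real.exp (-2 * v)) (Set.Ioi c) :=
      exp_neg_integrableOn_Ioi _ two_pos
    have hi' : Integrable (Set.indicator (Set.Ici c) fun v : ℝ => Real.exp (-2 * v)) := by
      rw [integrable_indicator_iff measurableSet_Ici]
      exact (integrableOn_Ici_iff_integrableOn_Ioi (by simp)).2 hi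
    refine (hi'.add hw.integrable_sq).mono'
      ((by fun_prop : Continuous fun v : ℝ => Real.exp (-v)).aestronglyMeasurable.mul
        hw.aestronglyMeasurable.norm) (Eventually.of_forall fun v => ?_)
    rcases lt_or_ge v c with hv | hv
    · simp [hs v hv, hv.not_ge]
    · simp only [Pi.add_apply, Set.indicator_of_mem (Set.mem_Ici.2 hv)]
      have e : Real.exp (-2 * v) = Real.exp (-v) ^ 2 := by
        rw [← Real.exp_nat_mul]; congr 1; push_cast; ring
      rw [Real.norm_of_nonneg (by positivity), e, ← sq_abs (w v)]
      nlinarith [sq_nonneg (Real.exp (-v) - |w v|), sq_nonneg (Real.exp (-v)), sq_nonneg (|w v|)]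
  have hm : ∀ {a : ℂ → ℂ}, Continuous a → ∀ z : ℂ,
      AEStronglyMeasurable (fun v : ℝ => a (v - z) * (w v : ℂ)) volume := fun {a} ha z =>
    (by fun_prop : Continuous fun v : ℝ => a (v - z)).aestronglyMeasurable.mul
      (Complex.continuous_ofReal.comp_aestronglyMeasurable hw.aestronglyMeasurable)
  have hb : ∀ z ∈ Metric.ball z₀ 1, ∀ v : ℝ,
      ‖airyC (v - z) * (w v : ℂ)‖ ≤ C * Real.exp (z₀.re + 1) * (Real.exp (-v) * |w v|) ∧
      ‖-airyC' (v - z) * (w v : ℂ)‖ ≤ C * Real.exp (z₀.re + 1) * (Real.exp (-v) * |w v|) := by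
    intro z hz v
    have hz' : ‖z - z₀‖ < 1 := by simpa [dist_eq_norm] using hz
    have hre : |z.re - z₀.re| ≤ 1 := by simpa using (Complex.abs_re_le_norm (z - z₀)).trans hz'.le
    have him : |z.im - z₀.im| ≤ 1 := by simpa using (Complex.abs_im_le_norm (z - z₀)).trans hz'.le
    have h1 : |((v : ℂ) - z).im| ≤ |z₀.im| + 1 := by
      have := abs_add_le (z.im - z₀.im) z₀.im
      rw [sub_add_cancel] at this
      simp only [Complex.sub_im, Complex.ofReal_im, zero_sub, abs_neg]; linarith
    have h2 : C * Real.exp (-((v : ℂ) - z).re) ≤ C * Real.exp (z₀.re + 1) * Real.exp (-v) := by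
      rw [mul_assoc, ← Real.exp_add]
      gcongr
      simp only [Complex.sub_re, Complex.ofReal_re]
      linarith [(abs_le.1 hre).2]
    rw [norm_mul, norm_mul, norm_neg, Complex.norm_real, Real.norm_eq_abs, ← mul_assoc]
    exact ⟨by gcongr; exact (h _ h1).1.trans h2, by gcongr; exact (h _ h1).2.trans h2⟩
  have hz0 : z₀ ∈ Metric.ball z₀ 1 := Metric.mem_ball_self one_pos
  have hbi := hwi.const_mul (C * Real.exp (z₀.re + 1))
  exact (hasDerivAt_integral_of_dominated_loc_of_deriv_le
    (F := fun z (v : ℝ) => airyC (v - z) * (w v : ℂ))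
    (F' := fun z (v : ℝ) => -airyC' (v - z) * (w v : ℂ)) (Metric.ball_mem_nhds z₀ one_pos)
    (Eventually.of_forall fun z => hm continuous_airyC z)
    (hbi.mono' (hm continuous_airyC z₀) (Eventually.of_forall fun v => (hb z₀ hz0 v).1))
    (hm continuous_airyC'.neg z₀)
    (Eventually.of_forall fun v z hz => (hb z hz v).2) hbi
    (Eventually.of_forall fun v z _ => by
      have h1 : HasDerivAt (fun z : ℂ => airyC (v - z)) (-airyC' (v - z)) z :=
        ((hasDerivAt_airyC (v - z)).comp z ((hasDerivAt_id z).const_sub (v : ℂ))).congr_deriv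
          (by ring)
      exact h1.mul_const _)).2.differentiableAt

/-- The chain ‖f‖² = ∫_{s ≤ τ} c² ≤ ∫ c² ≤ ∫ σ f² ≤ ‖f‖² must consist of equalities, where c(s) =
⟨g_s, f⟩ is the reflected Airy transform of √σ f. Analyticity of c then finishes the proof. -/
lemma eq_zero_of_airyOp_eq {σ : ℝ → ℝ} (hσ : IsSymbol σ) {τ : ℝ} {f : L2R}
    (hf : airyOp σ τ f = f) : f = 0 := by
  have hcL := continuous_airyL2 hσ
  set c : ℝ → ℝ := fun s => inner ℝ (airyL2 σ s) f with hc
  have hcc : Continuous c := by rw [hc]; fun_prop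
  set h : ℝ → ℝ := fun v => √(σ v) * f v with hh
  have hf2 := Lp.memLp f
  have hhm : AEStronglyMeasurable h volume :=
    hσ.measurable.sqrt.aestronglyMeasurable.mul hf2.aestronglyMeasurable
  have hh2 : MemLp h 2 volume := hf2.of_le hhm (Eventually.of_forall fun v => by
    rw [hh, norm_mul, Real.norm_of_nonneg (Real.sqrt_nonneg _)]
    exact mul_le_of_le_one_left (norm_nonneg _) (Real.sqrt_le_one.2 (hσ.le_one v)))
  have hcs : ∀ s, c s = ∫ v, airyVec σ s v * f v := fun s => inner_toL2 (memLp_airyVec hσ s) f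
  have hB : ∀ p, ∫ v, airy (v + p) * h v = c (-p) := fun p => by
    rw [hcs]; congr 1; funext v; rw [airyVec, hh, sub_neg_eq_add]; ring
  have hle := eLpNorm_airy_transform_le hh2 fun p => by
    refine ((memLp_airyVec hσ (-p)).integrable_mul hf2).congr (Eventually.of_forall fun v => ?_)
    simp only [Pi.mul_apply, airyVec, hh, sub_neg_eq_add]; ring
  simp only [hB] at hle
  have hcn2 : MemLp (fun p => c (-p)) 2 volume :=
    ⟨(by fun_prop : Continuous fun p => c (-p)).aestronglyMeasurable, hle.trans_lt hh2.2⟩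
  have hc2 : Integrable (fun s => c s ^ 2) := by
    simpa using hcn2.integrable_sq.comp_neg
  have h1 : ∫ s, c s ^ 2 ≤ ∫ v, h v ^ 2 := by
    have := integral_sq_le_of_eLpNorm_le hcn2 hh2 hle
    rwa [integral_neg_eq_self (fun s => c s ^ 2)] at this
  have hnorm : ∫ v, f v ^ 2 = ∫ s in Set.Iic τ, c s ^ 2 := by
    have e1 := inner_airyOp hσ τ f f
    rw [hf, inner_L2R] at e1
    simpa only [sq] using e1
  have hsplit : (∫ s in Set.Iic τ, c s ^ 2) + ∫ s in Set.Ioi τ, c s ^ 2 = ∫ s, c s ^ 2 := by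
    rw [← Set.compl_Iic]; exact integral_add_compl measurableSet_Iic hc2
  have hdef : ∀ v, (1 - σ v) * f v ^ 2 = f v ^ 2 - h v ^ 2 := fun v => by
    rw [hh, mul_pow, Real.sq_sqrt (hσ.nonneg v)]; ring
  have hdi : Integrable (fun v => (1 - σ v) * f v ^ 2) := by
    simp only [hdef]; exact hf2.integrable_sq.sub hh2.integrable_sq
  have hd : ∫ v, (1 - σ v) * f v ^ 2 = (∫ v, f v ^ 2) - ∫ v, h v ^ 2 := by
    simp only [hdef]; exact integral_sub hf2.integrable_sq hh2.integrable_sq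
  have hdn : ∀ v, 0 ≤ (1 - σ v) * f v ^ 2 := fun v =>
    mul_nonneg (by linarith [hσ.le_one v]) (sq_nonneg _)
  have n1 : 0 ≤ ∫ v, (1 - σ v) * f v ^ 2 := integral_nonneg hdn
  have n2 : 0 ≤ ∫ s in Set.Ioi τ, c s ^ 2 := integral_nonneg fun s => sq_nonneg _
  -- The two losses, from σ ≤ 1 and from dropping s > τ, are nonnegative with nonpositive sum.
  have z1 : ∫ v, (1 - σ v) * f v ^ 2 = 0 := by linarith
  have z2 : ∫ s in Set.Ioi τ, c s ^ 2 = 0 := by linarith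
  have hc0 : ∀ s ∈ Set.Ioi τ, c s = 0 := by
    rw [integral_eq_zero_iff_of_nonneg (fun s => sq_nonneg _) hc2.integrableOn] at z2
    have := Measure.eqOn_open_of_ae_eq z2 isOpen_Ioi (hcc.pow 2).continuousOn continuousOn_const
    intro s hs
    exact pow_eq_zero_iff two_ne_zero |>.1 (this hs)
  rw [integral_eq_zero_iff_of_nonneg hdn hdi] at z1
  -- Left of a the symbol is below 1, so f vanishes there almost everywhere, and √σ f may be
  -- replaced by a function supported on [a, ∞).
  obtain ⟨a, ha⟩ := eventually_atBot.1 (hσ.tendsto_atBot.eventually_lt_const one_pos)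
  set w : ℝ → ℝ := Set.indicator (Set.Ici a) h with hw
  have hw2 : MemLp w 2 volume := hh2.indicator measurableSet_Ici
  have hwh : h =ᵐ[volume] w := by
    filter_upwards [z1] with v hv
    rw [hw]
    by_cases hva : v ∈ Set.Ici a
    · rw [Set.indicator_of_mem hva]
    · rw [Set.indicator_of_notMem hva, hh]
      have h2 : σ v < 1 := ha v (le_of_not_ge hva)
      have h3 : f v ^ 2 = 0 := (mul_eq_zero.1 hv).resolve_left (by linarith)
      simp [pow_eq_zero_iff two_ne_zero |>.1 h3]
  set F : ℂ → ℂ := fun z => ∫ v : ℝ, airyC (v - z) * (w v : ℂ) with hF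
  have hFd : Differentiable ℂ F := differentiable_integral_airyC hw2 (c := a) fun v hv => by
    simp [hw, hv]
  have hFc : ∀ s : ℝ, F s = (c s : ℂ) := fun s => by
    rw [hcs, ← integral_complex_ofReal, hF]
    refine integral_congr_ae ?_
    filter_upwards [hwh] with v hv
    simp only [← hv, hh, airyVec]
    rw [← Complex.ofReal_sub, ← ofReal_airy]
    push_cast; ring
  -- The entire function F agrees with c on the real line, hence vanishes on (τ, ∞), which has
  -- accumulation points; the identity theorem applies.
  have hF0 : ∀ z, F z = 0 := by
    have han : AnalyticOnNhd ℂ F Set.univ := fun z _ => hFd.analyticAt z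
    have hfreq : ∃ᶠ z in 𝓝[≠] ((τ + 1 : ℝ) : ℂ), F z = 0 := by
      have ht : Tendsto (fun s : ℝ => (s : ℂ)) (𝓝[≠] (τ + 1)) (𝓝[≠] ((τ + 1 : ℝ) : ℂ)) := by
        refine tendsto_nhdsWithin_iff.2 ⟨Complex.continuous_ofReal.continuousAt.tendsto.mono_left
          nhdsWithin_le_nhds, ?_⟩
        filter_upwards [self_mem_nhdsWithin] with s hs
        simpa only [Set.mem_compl_iff, Set.mem_singleton_iff, Complex.ofReal_inj] using hs
      have he : ∀ᶠ s : ℝ in 𝓝[≠] (τ + 1), F s = 0 := by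
        filter_upwards [nhdsWithin_le_nhds (Ioi_mem_nhds (by linarith : τ < τ + 1))] with s hs
        rw [hFc, hc0 s hs, Complex.ofReal_zero]
      exact ht.frequently he.frequently
    intro z
    exact han.eqOn_zero_of_preconnected_of_frequently_eq_zero isPreconnected_univ
      (Set.mem_univ _) hfreq (Set.mem_univ z)
  have hc00 : ∀ s, c s = 0 := fun s => by
    have := hF0 s
    rw [hFc] at this
    exact_mod_cast this
  simp only [hc00] at hnorm
  have : ‖f‖ ^ 2 = 0 := by
    rw [← real_inner_self_eq_norm_sq, inner_L2R]
    simpa [sq] using hnorm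
  simpa using this

/-- Fredholm alternative: for a compact operator, 1 is an eigenvalue or lies in the resolvent set.
-/
lemma isUnit_one_sub_airyOp {σ : ℝ → ℝ} (hσ : IsSymbol σ) (τ : ℝ) :
    IsUnit (1 - airyOp σ τ) := by
  rcases (isCompactOperator_airyOp hσ τ).hasEigenvalue_or_mem_resolventSet (one_ne_zero (α := ℝ))
    with h | h
  · obtain ⟨f, hf⟩ := h.exists_hasEigenvector
    have h1 : airyOp σ τ f = f := by simpa using hf.apply_eq_smul
    exact absurd (eq_zero_of_airyOp_eq hσ h1) hf.2
  · simpa [resolventSet, spectrum.mem_resolventSet_iff] using h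

/-! ### The resolvent and its derivative -/

/-- The resolvent `(1 - K)⁻¹`. -/
def airyRes (σ : ℝ → ℝ) (τ : ℝ) : L2R →L[ℝ] L2R := Ring.inverse (1 - airyOp σ τ)

lemma airyRes_sub {σ : ℝ → ℝ} (hσ : IsSymbol σ) (τ : ℝ) (f : L2R) :
    airyRes σ τ f - airyOp σ τ (airyRes σ τ f) = f := by
  have h := Ring.mul_inverse_cancel _ (isUnit_one_sub_airyOp hσ τ)
  have := congrArg (fun A : L2R →L[ℝ] L2R => A f) h
  simpa [airyRes] using this

lemma airyRes_eq_of_sub {σ : ℝ → ℝ} (hσ : IsSymbol σ) (τ : ℝ) {f g : L2R}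
    (hfg : g - airyOp σ τ g = f) : airyRes σ τ f = g := by
  have h := Ring.inverse_mul_cancel _ (isUnit_one_sub_airyOp hσ τ)
  have := congrArg (fun A : L2R →L[ℝ] L2R => A g) h
  rw [← hfg]
  simpa [airyRes] using this

lemma inner_airyRes_comm {σ : ℝ → ℝ} (hσ : IsSymbol σ) (τ : ℝ) (f h : L2R) :
    inner ℝ (airyRes σ τ f) h = inner ℝ f (airyRes σ τ h) := by
  have h1 := airyRes_sub hσ τ f
  have h2 := airyRes_sub hσ τ h
  calc inner ℝ (airyRes σ τ f) h
      = inner ℝ (airyRes σ τ f) (airyRes σ τ h - airyOp σ τ (airyRes σ τ h)) := by rw [h2]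
    _ = inner ℝ (airyRes σ τ f - airyOp σ τ (airyRes σ τ f)) (airyRes σ τ h) := by
        rw [inner_sub_right, inner_sub_left, inner_airyOp_comm hσ]
    _ = _ := by rw [h1]

/-- The vector `(1 - K)⁻¹ √σ Ai(· - τ)`. -/
def waveL2 (σ : ℝ → ℝ) (τ : ℝ) : L2R := airyRes σ τ (airyL2 σ τ)

lemma hasDerivAt_airyRes {σ : ℝ → ℝ} (hσ : IsSymbol σ) (τ : ℝ) :
    HasDerivAt (airyRes σ)
      (airyRes σ τ * InnerProductSpace.rankOne ℝ (airyL2 σ τ) (airyL2 σ τ) * airyRes σ τ) τ := by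
  obtain ⟨u, hu⟩ := isUnit_one_sub_airyOp hσ τ
  have h1 := hasFDerivAt_ringInverse (𝕜 := ℝ) u
  have h2 := (hasDerivAt_airyOp hσ τ).const_sub 1
  rw [hu] at h1
  have h3 := h1.comp_hasDerivAt τ h2
  refine h3.congr_deriv ?_
  have h4 : (↑u⁻¹ : L2R →L[ℝ] L2R) = airyRes σ τ := by rw [airyRes, ← hu, Ring.inverse_unit]
  simp [ContinuousLinearMap.mulLeftRight_apply, h4]

/-- The derivative R (g ⊗ g) R of the resolvent collapses, by the symmetry of R, to the rank one
operator built from R g. -/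
lemma hasDerivAt_airyRes_apply {σ : ℝ → ℝ} (hσ : IsSymbol σ) {τ : ℝ} {x : ℝ → L2R} {x' : L2R}
    (hx : HasDerivAt x x' τ) :
    HasDerivAt (fun τ => airyRes σ τ (x τ))
      (inner ℝ (waveL2 σ τ) (x τ) • waveL2 σ τ + airyRes σ τ x') τ := by
  refine ((hasDerivAt_airyRes hσ τ).clm_apply hx).congr_deriv ?_
  simp only [mul_apply_eq_comp, InnerProductSpace.rankOne_apply, map_smul, waveL2,
    inner_airyRes_comm hσ]

/-- `q = ⟨g, (1-K)⁻¹ g⟩` with `g = √σ Ai(· - τ)`. -/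
def waveQ (σ : ℝ → ℝ) (τ : ℝ) : ℝ := inner ℝ (airyL2 σ τ) (waveL2 σ τ)

/-- `p = ⟨g', (1-K)⁻¹ g⟩`. -/
def waveP (σ : ℝ → ℝ) (τ : ℝ) : ℝ := inner ℝ (airyL2' σ τ) (waveL2 σ τ)

/-- The wave function `Φ(z; τ) = Ai(z - τ) + ⟨κ_z, (1-K)⁻¹ g⟩`. -/
def wave (σ : ℝ → ℝ) (z τ : ℝ) : ℝ := airy (z - τ) + inner ℝ (kernelL2 σ τ z) (waveL2 σ τ)

/-- The companion `Ai'(z - τ) + ⟨(1-K)⁻¹ κ_z, g'⟩` of the wave function. -/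
def coWave (σ : ℝ → ℝ) (z τ : ℝ) : ℝ :=
  airy' (z - τ) + inner ℝ (airyRes σ τ (kernelL2 σ τ z)) (airyL2' σ τ)

lemma hasDerivAt_waveL2 {σ : ℝ → ℝ} (hσ : IsSymbol σ) (τ : ℝ) :
    HasDerivAt (waveL2 σ) (waveQ σ τ • waveL2 σ τ - airyRes σ τ (airyL2' σ τ)) τ := by
  refine (hasDerivAt_airyRes_apply hσ (hasDerivAt_airyL2 hσ τ)).congr_deriv ?_
  rw [map_neg, waveQ, real_inner_comm, sub_eq_add_neg]

/-- Both factors of ⟨g, Rg⟩ contribute -p, since R is symmetric; the term q² comes from the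
derivative of R. -/
lemma hasDerivAt_waveQ {σ : ℝ → ℝ} (hσ : IsSymbol σ) (τ : ℝ) :
    HasDerivAt (waveQ σ) (waveQ σ τ ^ 2 - 2 * waveP σ τ) τ := by
  refine ((hasDerivAt_airyL2 hσ τ).inner ℝ (hasDerivAt_waveL2 hσ τ)).congr_deriv ?_
  rw [inner_sub_right, real_inner_smul_right, inner_neg_left, ← inner_airyRes_comm hσ]
  change _ * waveQ σ τ - inner ℝ (waveL2 σ τ) (airyL2' σ τ) + -waveP σ τ = _
  rw [real_inner_comm]
  change _ * waveQ σ τ - waveP σ τ + -waveP σ τ = _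
  ring

lemma hasDerivAt_wave {σ : ℝ → ℝ} (hσ : IsSymbol σ) (z τ : ℝ) :
    HasDerivAt (wave σ z) (waveQ σ τ * wave σ z τ - coWave σ z τ) τ := by
  refine ((hasDerivAt_airy_shift z τ).fun_add
    ((hasDerivAt_kernelL2 hσ z τ).inner ℝ (hasDerivAt_waveL2 hσ τ))).congr_deriv ?_
  rw [inner_sub_right, real_inner_smul_right, real_inner_smul_left, ← inner_airyRes_comm hσ,
    coWave, wave]
  change _ + (_ + _ * waveQ σ τ) = _
  ring

/-- The derivative of R contributes ⟨φ, κ_z⟩ φ and that of κ_z contributes Ai(z - τ) φ; together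
they form Φ(z) φ. -/
lemma hasDerivAt_airyRes_kernelL2 {σ : ℝ → ℝ} (hσ : IsSymbol σ) (z τ : ℝ) :
    HasDerivAt (fun τ => airyRes σ τ (kernelL2 σ τ z)) (wave σ z τ • waveL2 σ τ) τ := by
  refine (hasDerivAt_airyRes_apply hσ (hasDerivAt_kernelL2 hσ z τ)).congr_deriv ?_
  rw [map_smul, wave, real_inner_comm, add_comm (airy _), add_smul]
  rfl


/-! ### Commutation with the multiplication operator -/

/-- The symmetric kernel `√σ(v) K(v - τ, w - τ) √σ(w)`. -/
def kerFun (σ : ℝ → ℝ) (τ v w : ℝ) : ℝ := √(σ v) * airyKernel (v - τ) (w - τ) * √(σ w)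

lemma kerFun_comm (σ : ℝ → ℝ) (τ v w : ℝ) : kerFun σ τ v w = kerFun σ τ w v := by
  rw [kerFun, kerFun, airyKernel_comm]; ring

lemma measurable_kerFun {σ : ℝ → ℝ} (hσ : IsSymbol σ) (τ : ℝ) :
    Measurable fun p : ℝ × ℝ => kerFun σ τ p.1 p.2 :=
  ((hσ.measurable.comp measurable_fst).sqrt.mul (continuous_airyKernel.comp
    (by fun_prop : Continuous fun p : ℝ × ℝ => (p.1 - τ, p.2 - τ))).measurable).mul
    (hσ.measurable.comp measurable_snd).sqrt

lemma exists_abs_kerFun_le {σ : ℝ → ℝ} (hσ : IsSymbol σ) (T : ℝ) :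
    ∃ B, 0 < B ∧ ∀ τ : ℝ, |τ| ≤ T → ∀ v w, |kerFun σ τ v w| ≤ (B * weight σ v) * (B * weight σ w) := by
  obtain ⟨B, hB, h⟩ := exists_vec_bounds hσ T
  refine ⟨B, hB, fun τ hτ v w => ?_⟩
  have h1 := (h τ hτ v).2.2.2
  have h2 := (h τ hτ w).2.2.2
  have hw := weight_nonneg σ v
  rw [kerFun, abs_mul, abs_mul, abs_of_nonneg (Real.sqrt_nonneg _),
    abs_of_nonneg (Real.sqrt_nonneg _)]
  calc _ ≤ √(σ v) * (√(airyKernel (v - τ) (v - τ)) * √(airyKernel (w - τ) (w - τ))) * √(σ w) := by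
        gcongr; exact abs_airyKernel_le _ _
    _ = (√(σ v) * √(airyKernel (v - τ) (v - τ))) * (√(σ w) * √(airyKernel (w - τ) (w - τ))) := by
        ring
    _ ≤ _ := mul_le_mul h1 h2 (by positivity) (by positivity)

lemma opFun_eq_integral {σ : ℝ → ℝ} (hσ : IsSymbol σ) (τ : ℝ) (f : L2R) (v : ℝ) :
    opFun σ τ f v = ∫ w, kerFun σ τ v w * f w := by
  rw [opFun, kernelL2, inner_toL2 (memLp_kernelVec hσ τ v), ← integral_const_mul]
  congr 1; funext w; rw [kernelVec, kerFun]; ring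

lemma coeFn_airyRes {σ : ℝ → ℝ} (hσ : IsSymbol σ) (τ : ℝ) {f : ℝ → ℝ} (hf : MemLp f 2 volume) :
    ∀ᵐ v, airyRes σ τ (toL2 f) v = f v + opFun σ τ (airyRes σ τ (toL2 f)) v := by
  have h := airyRes_sub hσ τ (toL2 f)
  have h' : airyRes σ τ (toL2 f) = toL2 f + airyOp σ τ (airyRes σ τ (toL2 f)) := by
    rw [← sub_eq_iff_eq_add]; exact h
  filter_upwards [Lp.coeFn_add (toL2 f) (airyOp σ τ (airyRes σ τ (toL2 f))), coeFn_toL2 hf,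
    coeFn_airyOp hσ τ (airyRes σ τ (toL2 f))] with v h1 h2 h3
  rw [← h2, ← h3]
  conv_lhs => rw [h']
  rw [h1]; rfl

lemma coeFn_waveL2 {σ : ℝ → ℝ} (hσ : IsSymbol σ) (τ : ℝ) :
    ∀ᵐ v, waveL2 σ τ v = airyVec σ τ v + opFun σ τ (waveL2 σ τ) v :=
  coeFn_airyRes hσ τ (memLp_airyVec hσ τ)

/-- The resolvent equation read pointwise: the L² vector is √σ times a function defined for every v,
also where σ vanishes. -/
lemma waveL2_eq {σ : ℝ → ℝ} (hσ : IsSymbol σ) (τ : ℝ) :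
    ∀ᵐ v, waveL2 σ τ v = √(σ v) * wave σ v τ := by
  filter_upwards [coeFn_waveL2 hσ τ] with v hv
  rw [hv, airyVec, opFun, wave]; ring

/-- Truncation of the identity function. -/
def clip (n : ℕ) (v : ℝ) : ℝ := max (-(n : ℝ)) (min v n)

lemma continuous_clip (n : ℕ) : Continuous (clip n) := by unfold clip; fun_prop

lemma abs_clip_le (n : ℕ) (v : ℝ) : |clip n v| ≤ n := by
  rw [clip, abs_le]
  exact ⟨le_max_left _ _, max_le (by linarith [Nat.cast_nonneg (α := ℝ) n]) (min_le_right _ _)⟩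

/-- The truncation is 1-Lipschitz, so the truncated commutator kernels are dominated by the full
one. -/
lemma abs_clip_sub_le (n : ℕ) (v w : ℝ) : |clip n v - clip n w| ≤ |v - w| := by
  unfold clip
  grind

lemma abs_clip_le_abs (n : ℕ) (v : ℝ) : |clip n v| ≤ |v| := by
  have h := abs_clip_sub_le n v 0
  have h0 : clip n 0 = 0 := by simp [clip]
  simpa [h0] using h

lemma tendsto_clip (v : ℝ) : Tendsto (fun n => clip n v) atTop (𝓝 v) := by
  refine tendsto_const_nhds.congr' ?_
  filter_upwards [eventually_ge_atTop ⌈|v|⌉₊] with n hn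
  have h : |v| ≤ n := (Nat.le_ceil _).trans (Nat.cast_le.2 hn)
  rw [clip, min_eq_left (abs_le.1 h).2, max_eq_right (abs_le.1 h).1]

lemma mul_kernelVec (σ : ℝ → ℝ) (τ z v : ℝ) :
    v * kernelVec σ τ z v =
      z * kernelVec σ τ z v - airy (z - τ) * airyVec' σ τ v + airy' (z - τ) * airyVec σ τ v := by
  have h := sub_mul_airyKernel (z - τ) (v - τ)
  simp only [kernelVec, airyVec, airyVec']
  linear_combination (-√(σ v)) * h

/-- The commutator of the operator with multiplication by v has rank two, because (u - v) K(u, v) is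
a Wronskian. -/
lemma sub_mul_kerFun (σ : ℝ → ℝ) (τ v w : ℝ) :
    (v - w) * kerFun σ τ v w = airyVec σ τ v * airyVec' σ τ w - airyVec' σ τ v * airyVec σ τ w := by
  have h := sub_mul_airyKernel (v - τ) (w - τ)
  simp only [kerFun, airyVec, airyVec']
  linear_combination (√(σ v) * √(σ w)) * h

/-- The solution vectors are bounded by the weight. -/
lemma exists_abs_airyRes_kernelL2_le {σ : ℝ → ℝ} (hσ : IsSymbol σ) (τ z : ℝ) :
    ∃ C, 0 < C ∧ ∀ᵐ v, |airyRes σ τ (kernelL2 σ τ z) v| ≤ C * weight σ v := by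
  obtain ⟨B, hB, h⟩ := exists_vec_bounds hσ |τ|
  obtain ⟨B', hB', h'⟩ := exists_abs_opFun_le hσ |τ|
  refine ⟨√(airyKernel (z - τ) (z - τ)) * B + B' * ‖airyRes σ τ (kernelL2 σ τ z)‖ + 1,
    by positivity, ?_⟩
  filter_upwards [coeFn_airyRes hσ τ (memLp_kernelVec hσ τ z)] with v hv
  have h1 := (h τ le_rfl v).2.2.1 z
  have h2 := h' τ le_rfl (airyRes σ τ (kernelL2 σ τ z)) v
  have h3 := weight_nonneg σ v
  change airyRes σ τ (kernelL2 σ τ z) v = _ at hv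
  rw [hv]
  refine (abs_add_le _ _).trans ((add_le_add h1 h2).trans ?_)
  nlinarith

lemma integrable_kerFun_mul {σ : ℝ → ℝ} (hσ : IsSymbol σ) (τ : ℝ) (f h : L2R) {b : ℝ × ℝ → ℝ}
    (hb : Continuous b) {M : ℝ} (hM : ∀ p, |b p| ≤ M) :
    Integrable (fun p : ℝ × ℝ => b p * (f p.1 * kerFun σ τ p.1 p.2 * h p.2)) := by
  obtain ⟨B, hB, hk⟩ := exists_abs_kerFun_le hσ |τ|
  have hf := (Lp.memLp f).integrable_mul hσ.memLp_weight
  have hh := (Lp.memLp h).integrable_mul hσ.memLp_weight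
  have hM0 : 0 ≤ M := (abs_nonneg _).trans (hM (0, 0))
  refine ((hf.norm.mul_prod hh.norm).const_mul (M * B ^ 2)).mono' ?_
    (Eventually.of_forall fun p => ?_)
  · exact hb.aestronglyMeasurable.mul
      (((Lp.memLp f).aestronglyMeasurable.comp_fst.mul
        (measurable_kerFun hσ τ).aestronglyMeasurable).mul
        (Lp.memLp h).aestronglyMeasurable.comp_snd)
  · simp only [norm_mul, Pi.mul_apply, Real.norm_eq_abs, abs_of_nonneg (weight_nonneg σ _)]
    calc _ ≤ M * (|f p.1| * ((B * weight σ p.1) * (B * weight σ p.2)) * |h p.2|) := by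
          gcongr
          · exact hM p
          · exact hk τ le_rfl _ _
      _ = _ := by ring

/-- Multiplication by v is unbounded, and v times a solution vector need not be square integrable,
so the commutator is first formed with the bounded function `clip n`. -/
lemma integral_clip_commutator {σ : ℝ → ℝ} (hσ : IsSymbol σ) (τ : ℝ) (r φ : L2R) (n : ℕ) :
    (∫ v, clip n v * (φ v * opFun σ τ r v)) - ∫ v, clip n v * (r v * opFun σ τ φ v) =
      ∫ p : ℝ × ℝ, (clip n p.1 - clip n p.2) * (φ p.1 * kerFun σ τ p.1 p.2 * r p.2) := by
  have hc := continuous_clip n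
  have i1 := integrable_kerFun_mul hσ τ φ r (b := fun p => clip n p.1)
    (by fun_prop) (fun p => abs_clip_le n p.1)
  have i2 := integrable_kerFun_mul hσ τ φ r (b := fun p => clip n p.2)
    (by fun_prop) (fun p => abs_clip_le n p.2)
  have e1 : ∫ v, clip n v * (φ v * opFun σ τ r v) =
      ∫ p : ℝ × ℝ, clip n p.1 * (φ p.1 * kerFun σ τ p.1 p.2 * r p.2) := by
    rw [Measure.volume_eq_prod, integral_prod _ i1]
    congr 1; funext v
    rw [opFun_eq_integral hσ, ← integral_const_mul, ← integral_const_mul]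
    congr 1; funext w; ring
  have e2 : ∫ v, clip n v * (r v * opFun σ τ φ v) =
      ∫ p : ℝ × ℝ, clip n p.2 * (φ p.1 * kerFun σ τ p.1 p.2 * r p.2) := by
    rw [Measure.volume_eq_prod, integral_prod_symm _ i2]
    congr 1; funext v
    rw [opFun_eq_integral hσ, ← integral_const_mul, ← integral_const_mul]
    congr 1; funext w; rw [kerFun_comm]; ring
  rw [e1, e2, ← integral_sub i1 i2]
  congr 1; funext p; ring

lemma tendsto_integral_clip_mul {f : ℝ → ℝ} (hm : AEStronglyMeasurable f volume)
    (hf : Integrable fun v => v * f v) :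
    Tendsto (fun n => ∫ v, clip n v * f v) atTop (𝓝 (∫ v, v * f v)) := by
  refine tendsto_integral_of_dominated_convergence (fun v => ‖v * f v‖)
    (fun n => (continuous_clip n).aestronglyMeasurable.mul hm) hf.norm
    (fun n => Eventually.of_forall fun v => ?_)
    (Eventually.of_forall fun v => (tendsto_clip v).mul_const _)
  rw [norm_mul, norm_mul]
  gcongr
  exact abs_clip_le_abs n v

/-- A dominating function for `v √σ(v) Ai(v - s)` tested against the solution vectors. -/
lemma exists_weighted_bound {σ : ℝ → ℝ} (hσ : IsSymbol σ) (T : ℝ) :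
    ∃ B, 0 < B ∧ ∀ s : ℝ, |s| ≤ T → ∀ v,
      weight σ v * ((1 + |v|) * |airyVec σ s v|) ≤
        B * (σ v * ((1 + |v|) * Real.exp (-max v 0))) := by
  obtain ⟨B, hB, h⟩ := exists_shift_bounds T
  refine ⟨B, hB, fun s hs v => ?_⟩
  have h1 := (h s hs v).2.2.2
  have hp : (0 : ℝ) ≤ 1 + |v| := by positivity
  rw [weight_eq hσ, airyVec, abs_mul, abs_of_nonneg (Real.sqrt_nonneg _)]
  have e1 : √(1 + |v|) * √(1 + |v|) = 1 + |v| := Real.mul_self_sqrt hp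
  have e2 : √(envelope v) * √(envelope v) = envelope v := Real.mul_self_sqrt (envelope_pos v).le
  have e3 : √(σ v) * √(σ v) = σ v := Real.mul_self_sqrt (hσ.nonneg v)
  calc √(σ v) * √(envelope v) * ((1 + |v|) * (√(σ v) * |airy (v - s)|))
      = (√(σ v) * √(σ v)) * √(envelope v) * √(1 + |v|) * (√(1 + |v|) * |airy (v - s)|) := by
        linear_combination (-(√(σ v) * √(σ v) * √(envelope v) * |airy (v - s)|)) * e1
    _ ≤ (√(σ v) * √(σ v)) * √(envelope v) * √(1 + |v|) * (B * √(envelope v)) := by gcongr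
    _ = σ v * √(1 + |v|) * B * (√(envelope v) * √(envelope v)) := by rw [e3]; ring
    _ = _ := by
        rw [e2, envelope]
        linear_combination (σ v * B * Real.exp (-max v 0)) * e1

/-- Here the integrability of (1 + |v|) σ(v) on the left enters: the solution vector is bounded by
√σ (1 + |v|)^(1/4) and g by √σ (1 + |v|)^(-1/4) there, up to constants, and the factor v remains. -/
lemma integrable_mul_airyVec {σ : ℝ → ℝ} (hσ : IsSymbol σ) (τ z : ℝ) :
    Integrable fun v => v * (airyRes σ τ (kernelL2 σ τ z) v * airyVec σ τ v) := by
  obtain ⟨C, hC, hr⟩ := exists_abs_airyRes_kernelL2_le hσ τ z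
  obtain ⟨B, hB, h⟩ := exists_weighted_bound hσ |τ|
  refine (hσ.integrable_weight.const_mul (C * B)).mono'
    (continuous_id.aestronglyMeasurable.mul ((Lp.memLp _).aestronglyMeasurable.mul
      (memLp_airyVec hσ τ).aestronglyMeasurable)) ?_
  filter_upwards [hr] with v hv
  have h1 := h τ le_rfl v
  have hw := weight_nonneg σ v
  rw [norm_mul, norm_mul, Real.norm_eq_abs, Real.norm_eq_abs, Real.norm_eq_abs]
  calc _ ≤ (1 + |v|) * ((C * weight σ v) * |airyVec σ τ v|) := by gcongr; linarith
    _ = C * (weight σ v * ((1 + |v|) * |airyVec σ τ v|)) := by ring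
    _ ≤ C * (B * (σ v * ((1 + |v|) * Real.exp (-max v 0)))) := by gcongr
    _ = _ := by ring

lemma inner_airyRes_kernelL2_airyL2 {σ : ℝ → ℝ} (hσ : IsSymbol σ) (τ z : ℝ) :
    inner ℝ (airyRes σ τ (kernelL2 σ τ z)) (airyL2 σ τ) = wave σ z τ - airy (z - τ) := by
  rw [inner_airyRes_comm hσ, wave]; simp [waveL2]

/-- The commutator identity `⟨(1-K)⁻¹ κ_z, v g⟩ = z ⟨κ_z, φ⟩ - p Φ + q X`. -/
lemma integral_mul_airyVec {σ : ℝ → ℝ} (hσ : IsSymbol σ) (τ z : ℝ) :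
    ∫ v, v * (airyRes σ τ (kernelL2 σ τ z) v * airyVec σ τ v) =
      z * (wave σ z τ - airy (z - τ)) - waveP σ τ * wave σ z τ + waveQ σ τ * coWave σ z τ := by
  set r := airyRes σ τ (kernelL2 σ τ z) with hr
  set φ := waveL2 σ τ with hφ
  have mG := memLp_airyVec hσ τ
  have mk := memLp_airyVec' hσ τ
  have mκ := memLp_kernelVec hσ τ z
  have mr := Lp.memLp r
  have mφ := Lp.memLp φ
  have hrv : ∀ᵐ v, r v = kernelVec σ τ z v + opFun σ τ r v := coeFn_airyRes hσ τ mκ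
  have hφv : ∀ᵐ v, φ v = airyVec σ τ v + opFun σ τ φ v := coeFn_waveL2 hσ τ
  have iA := integrable_mul_airyVec hσ τ z
  have hBfun : ∀ v, v * (kernelVec σ τ z v * φ v) = z * (kernelVec σ τ z v * φ v) -
      airy (z - τ) * (airyVec' σ τ v * φ v) + airy' (z - τ) * (airyVec σ τ v * φ v) := fun v => by
    linear_combination φ v * mul_kernelVec σ τ z v
  have j1 := (mκ.integrable_mul mφ).const_mul z
  have j2 := (mk.integrable_mul mφ).const_mul (airy (z - τ))
  have j3 := (mG.integrable_mul mφ).const_mul (airy' (z - τ))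
  have iB : Integrable fun v => v * (kernelVec σ τ z v * φ v) := by
    simp only [hBfun]; exact (j1.sub j2).add j3
  have hB : ∫ v, v * (kernelVec σ τ z v * φ v) = z * (wave σ z τ - airy (z - τ)) -
      airy (z - τ) * waveP σ τ + airy' (z - τ) * waveQ σ τ := by
    simp only [hBfun]
    have k1 : ∫ v, z * (kernelVec σ τ z v * φ v) = z * (wave σ z τ - airy (z - τ)) := by
      rw [integral_const_mul, ← inner_toL2 mκ, wave]; simp [kernelL2, hφ]
    have k2 : ∫ v, airy (z - τ) * (airyVec' σ τ v * φ v) = airy (z - τ) * waveP σ τ := by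
      rw [integral_const_mul, ← inner_toL2 mk]; rfl
    have k3 : ∫ v, airy' (z - τ) * (airyVec σ τ v * φ v) = airy' (z - τ) * waveQ σ τ := by
      rw [integral_const_mul, ← inner_toL2 mG]; rfl
    have s1 := integral_add (j1.sub j2) j3
    have s2 := integral_sub j1 j2
    simp only [Pi.sub_apply, Pi.mul_apply] at s1 s2
    rw [s1, s2, k1, k2, k3]
  have tA := tendsto_integral_clip_mul (mr.aestronglyMeasurable.mul mG.aestronglyMeasurable) iA
  have tB := tendsto_integral_clip_mul (mκ.aestronglyMeasurable.mul mφ.aestronglyMeasurable) iB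
  have bdd : ∀ (n : ℕ) {f : ℝ → ℝ}, Integrable f → Integrable fun v => clip n v * f v :=
    fun n f hf => hf.bdd_mul (continuous_clip n).aestronglyMeasurable
      (Eventually.of_forall fun v => abs_clip_le n v)
  -- Insert g = φ - Kφ and κ_z = r - Kr; the products r φ cancel and φ Kr - r Kφ is left.
  have hdiff : ∀ n : ℕ, (∫ v, clip n v * (r v * airyVec σ τ v)) -
      ∫ v, clip n v * (kernelVec σ τ z v * φ v) =
      ∫ p : ℝ × ℝ, (clip n p.1 - clip n p.2) * (φ p.1 * kerFun σ τ p.1 p.2 * r p.2) := by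
    intro n
    have c1 : Integrable fun v => clip n v * (r v * airyVec σ τ v) := bdd n (mr.integrable_mul mG)
    have c2 : Integrable fun v => clip n v * (kernelVec σ τ z v * φ v) :=
      bdd n (mκ.integrable_mul mφ)
    have c3 : Integrable fun v => clip n v * (φ v * opFun σ τ r v) :=
      bdd n (mφ.integrable_mul (memLp_opFun hσ τ r))
    have c4 : Integrable fun v => clip n v * (r v * opFun σ τ φ v) :=
      bdd n (mr.integrable_mul (memLp_opFun hσ τ φ))
    rw [← integral_clip_commutator hσ τ r φ n, ← integral_sub c1 c2, ← integral_sub c3 c4]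
    refine integral_congr_ae ?_
    filter_upwards [hrv, hφv] with v h1 h2
    have h1' : kernelVec σ τ z v = r v - opFun σ τ r v := by linarith
    have h2' : airyVec σ τ v = φ v - opFun σ τ φ v := by linarith
    rw [h1', h2']; ring
  set D : ℝ × ℝ → ℝ := fun p =>
    (φ p.1 * airyVec σ τ p.1) * (airyVec' σ τ p.2 * r p.2) -
      (φ p.1 * airyVec' σ τ p.1) * (airyVec σ τ p.2 * r p.2) with hD
  have d1 : Integrable (fun p : ℝ × ℝ => (φ p.1 * airyVec σ τ p.1) * (airyVec' σ τ p.2 * r p.2)) :=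
    (mφ.integrable_mul mG).mul_prod (mk.integrable_mul mr)
  have d2 : Integrable (fun p : ℝ × ℝ => (φ p.1 * airyVec' σ τ p.1) * (airyVec σ τ p.2 * r p.2)) :=
    (mφ.integrable_mul mk).mul_prod (mG.integrable_mul mr)
  have hDk : ∀ p : ℝ × ℝ, D p = (p.1 - p.2) * (φ p.1 * kerFun σ τ p.1 p.2 * r p.2) := fun p => by
    rw [hD]; linear_combination (-(φ p.1 * r p.2)) * sub_mul_kerFun σ τ p.1 p.2
  have tD : Tendsto (fun n => ∫ p : ℝ × ℝ, (clip n p.1 - clip n p.2) *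
      (φ p.1 * kerFun σ τ p.1 p.2 * r p.2)) atTop (𝓝 (∫ p, D p)) := by
    refine tendsto_integral_of_dominated_convergence (fun p => ‖D p‖) (fun n => ?_)
      (d1.sub d2).norm (fun n => Eventually.of_forall fun p => ?_)
      (Eventually.of_forall fun p => ?_)
    · have hc := continuous_clip n
      exact (integrable_kerFun_mul hσ τ φ r (b := fun p => clip n p.1 - clip n p.2)
        (by fun_prop) (M := n + n) (fun p => (abs_sub _ _).trans
          (add_le_add (abs_clip_le n _) (abs_clip_le n _)))).aestronglyMeasurable
    · rw [hDk, norm_mul, norm_mul (p.1 - p.2)]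
      gcongr
      exact abs_clip_sub_le n _ _
    · rw [hDk]
      exact ((tendsto_clip _).sub (tendsto_clip _)).mul_const _
  -- The limiting kernel is a difference of two products, so its double integral factors into the
  -- four inner products for q, p, X - Ai' and Φ - Ai.
  have hDint : ∫ p, D p = waveQ σ τ * (coWave σ z τ - airy' (z - τ)) -
      waveP σ τ * (wave σ z τ - airy (z - τ)) := by
    rw [hD, integral_sub d1 d2, Measure.volume_eq_prod,
      integral_prod_mul (fun v => φ v * airyVec σ τ v) (fun v => airyVec' σ τ v * r v),
      integral_prod_mul (fun v => φ v * airyVec' σ τ v) (fun v => airyVec σ τ v * r v)]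
    have k1 : ∫ v, φ v * airyVec σ τ v = waveQ σ τ := by
      simp only [mul_comm (φ _)]; rw [← inner_toL2 mG]; rfl
    have k2 : ∫ v, φ v * airyVec' σ τ v = waveP σ τ := by
      simp only [mul_comm (φ _)]; rw [← inner_toL2 mk]; rfl
    have k3 : ∫ v, airyVec' σ τ v * r v = coWave σ z τ - airy' (z - τ) := by
      rw [← inner_toL2 mk, real_inner_comm, coWave]; simp [airyL2', hr]
    have k4 : ∫ v, airyVec σ τ v * r v = wave σ z τ - airy (z - τ) := by
      rw [← inner_toL2 mG, real_inner_comm, ← inner_airyRes_kernelL2_airyL2 hσ]; rfl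
    rw [k1, k2, k3, k4]
  have hfin := tendsto_nhds_unique (tA.sub tB) (tD.congr fun n => (hdiff n).symm)
  simp only [Pi.mul_apply] at hfin
  rw [hB, hDint] at hfin
  linarith

/-! ### The second order equation for the wave function. -/

/-- A product rule that asks only for continuity of b, since a vanishes at τ. It avoids
differentiating `airyL2'` in L², which would require v √σ Ai to be square integrable. -/
lemma hasDerivAt_inner_of_eq_zero {E : Type*} [NormedAddCommGroup E] [InnerProductSpace ℝ E]
    {a b : ℝ → E} {a' : E} {τ : ℝ} (ha : HasDerivAt a a' τ) (h0 : a τ = 0)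
    (hb : ContinuousAt b τ) :
    HasDerivAt (fun s => inner ℝ (a s) (b s)) (inner ℝ a' (b τ)) τ := by
  rw [hasDerivAt_iff_tendsto_slope] at ha ⊢
  refine (ha.inner (hb.tendsto.mono_left nhdsWithin_le_nhds)).congr fun s => ?_
  rw [slope_def_module, slope_def_module, h0, inner_zero_left, sub_zero, sub_zero,
    real_inner_smul_left, smul_eq_mul]

/-- With the first vector frozen, a weak derivative of g' is enough; by Ai'' = v Ai it produces the
moment computed in `integral_mul_airyVec`. -/
lemma hasDerivAt_inner_airyL2' {σ : ℝ → ℝ} (hσ : IsSymbol σ) (τ z : ℝ) :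
    HasDerivAt (fun s => inner ℝ (airyRes σ τ (kernelL2 σ τ z)) (airyL2' σ s))
      (-(∫ v, v * (airyRes σ τ (kernelL2 σ τ z) v * airyVec σ τ v)) +
        τ * (wave σ z τ - airy (z - τ))) τ := by
  set r := airyRes σ τ (kernelL2 σ τ z) with hr
  have mr := Lp.memLp r
  obtain ⟨C, hC, hrb⟩ := exists_abs_airyRes_kernelL2_le hσ τ z
  obtain ⟨B, hB, hB'⟩ := exists_weighted_bound hσ (|τ| + 1)
  have hfun : (fun s => inner ℝ r (airyL2' σ s)) = fun s => ∫ v, r v * airyVec' σ s v := by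
    funext s
    rw [real_inner_comm, airyL2', inner_toL2 (memLp_airyVec' hσ s)]
    congr 1; funext v; ring
  rw [hfun]
  have key := hasDerivAt_integral_of_dominated_loc_of_deriv_le (𝕜 := ℝ) (μ := volume)
    (F := fun s v => r v * airyVec' σ s v) (x₀ := τ) (s := Metric.ball τ 1)
    (F' := fun s v => r v * (√(σ v) * -((v - s) * airy (v - s))))
    (bound := fun v => (C * (|τ| + 2) * B) * (σ v * ((1 + |v|) * Real.exp (-max v 0))))
    (Metric.ball_mem_nhds τ one_pos)
    (Eventually.of_forall fun s => mr.aestronglyMeasurable.mul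
      (memLp_airyVec' hσ s).aestronglyMeasurable)
    (mr.integrable_mul (memLp_airyVec' hσ τ))
    (mr.aestronglyMeasurable.mul (hσ.measurable.sqrt.mul
      (by fun_prop : Continuous fun v => -((v - τ) * airy (v - τ))).measurable).aestronglyMeasurable)
    (by
      filter_upwards [hrb] with v hv s hs
      have hs' := abs_le_add_one_of_mem_ball hs
      have h1 := hB' s hs' v
      have hw := weight_nonneg σ v
      have h2 : |v - s| ≤ (|τ| + 2) * (1 + |v|) := by
        refine (abs_sub v s).trans ?_
        nlinarith [abs_nonneg v, abs_nonneg τ, mul_nonneg (abs_nonneg v) (abs_nonneg τ)]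
      have e : ‖r v * (√(σ v) * -((v - s) * airy (v - s)))‖ =
          |r v| * (|v - s| * |airyVec σ s v|) := by
        rw [airyVec]
        simp only [norm_mul, norm_neg, Real.norm_eq_abs, abs_mul]; ring
      rw [e]
      calc _ ≤ (C * weight σ v) * (((|τ| + 2) * (1 + |v|)) * |airyVec σ s v|) := by gcongr
        _ = (C * (|τ| + 2)) * (weight σ v * ((1 + |v|) * |airyVec σ s v|)) := by ring
        _ ≤ (C * (|τ| + 2)) * (B * (σ v * ((1 + |v|) * Real.exp (-max v 0)))) := by gcongr
        _ = _ := by ring)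
    (hσ.integrable_weight.const_mul _)
    (Eventually.of_forall fun v s _ =>
      ((hasDerivAt_airy'_shift v s).const_mul (√(σ v))).const_mul (r v))
  refine key.2.congr_deriv ?_
  have e2 : ∀ v, r v * (√(σ v) * -((v - τ) * airy (v - τ))) =
      τ * (r v * airyVec σ τ v) - v * (r v * airyVec σ τ v) := fun v => by rw [airyVec]; ring
  simp only [e2]
  have s1 := integral_sub ((mr.integrable_mul (memLp_airyVec hσ τ)).const_mul τ)
    (integrable_mul_airyVec hσ τ z)
  simp only [Pi.mul_apply] at s1
  rw [s1, integral_const_mul]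
  have k4 : ∫ v, r v * airyVec σ τ v = wave σ z τ - airy (z - τ) := by
    simp only [mul_comm (r _)]
    rw [← inner_toL2 (memLp_airyVec hσ τ), real_inner_comm, ← inner_airyRes_kernelL2_airyL2 hσ]; rfl
  rw [k4]; ring

/-- The inner product is split into its increment in the resolvent vector, which vanishes at τ, and
a term with that vector frozen at τ. The first gives pΦ and the commutator in the second gives
another pΦ, whence 2p. -/
lemma hasDerivAt_coWave {σ : ℝ → ℝ} (hσ : IsSymbol σ) (z τ : ℝ) :
    HasDerivAt (coWave σ z) (-(z - τ) * wave σ z τ + 2 * waveP σ τ * wave σ z τ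
      - waveQ σ τ * coWave σ z τ) τ := by
  have h1 := hasDerivAt_airy'_shift z τ
  have h2 := hasDerivAt_inner_airyL2' hσ τ z
  have h3 := hasDerivAt_inner_of_eq_zero
    ((hasDerivAt_airyRes_kernelL2 hσ z τ).sub_const (airyRes σ τ (kernelL2 σ τ z))) (sub_self _)
    (continuous_airyL2' hσ).continuousAt
  have hsum := (h1.fun_add h3).fun_add h2
  have hfun : coWave σ z = fun s => airy' (z - s) +
      inner ℝ (airyRes σ s (kernelL2 σ s z) - airyRes σ τ (kernelL2 σ τ z)) (airyL2' σ s) +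
      inner ℝ (airyRes σ τ (kernelL2 σ τ z)) (airyL2' σ s) := by
    funext s; rw [coWave, inner_sub_left]; ring
  refine (hsum.congr_deriv ?_).congr_of_eventuallyEq
    (Eventually.of_forall fun s => congrFun hfun s)
  have h4 : inner ℝ (waveL2 σ τ) (airyL2' σ τ) = waveP σ τ := real_inner_comm _ _
  rw [integral_mul_airyVec hσ, real_inner_smul_left, h4]
  ring

/-- The second derivative of the wave function. -/
lemma hasDerivAt_deriv_wave {σ : ℝ → ℝ} (hσ : IsSymbol σ) (z τ : ℝ) :
    HasDerivAt (fun τ => waveQ σ τ * wave σ z τ - coWave σ z τ)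
      ((z - τ + 2 * (waveQ σ τ ^ 2 - 2 * waveP σ τ)) * wave σ z τ) τ := by
  refine (((hasDerivAt_waveQ hσ τ).fun_mul (hasDerivAt_wave hσ z τ)).fun_sub
    (hasDerivAt_coWave hσ z τ)).congr_deriv ?_
  ring


/-! ### The derivative of `q` as a Stieltjes integral -/

/-- The Stieltjes function is the right-continuous version of σ; the two agree at points of
continuity, that is, off a countable set. An almost everywhere statement suffices, as it is
integrated in v. -/
lemma measureReal_Ioc_stieltjesFunction {σ : ℝ → ℝ} (hm : Monotone σ) {h : ℝ} (hh : 0 ≤ h) :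
    ∀ᵐ v : ℝ, hm.stieltjesFunction.measure.real (Set.Ioc v (v + h)) = σ (v + h) - σ v := by
  have hc := hm.countable_not_continuousAt
  have h1 : ∀ᵐ v : ℝ, ContinuousAt σ v := hc.ae_notMem volume |>.mono fun v hv => by simpa using hv
  have h2 : ∀ᵐ v : ℝ, ContinuousAt σ (v + h) :=
    (quasiMeasurePreserving_add_right volume h).ae h1
  have he : ∀ v, ContinuousAt σ v → hm.stieltjesFunction v = σ v := fun v hv =>
    hv.continuousWithinAt.rightLim_eq
  filter_upwards [h1, h2] with v k1 k2
  rw [Measure.real, StieltjesFunction.measure_Ioc, he _ k1, he _ k2,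
    ENNReal.toReal_ofReal (sub_nonneg.2 (hm (by linarith)))]

/-- The pairs `(v, w)` with `v < w ≤ v + h`. -/
def strip (h : ℝ) : Set (ℝ × ℝ) := {p | p.1 < p.2 ∧ p.2 ≤ p.1 + h}

lemma measurableSet_strip (h : ℝ) : MeasurableSet (strip h) :=
  (measurableSet_lt measurable_fst measurable_snd).inter
    (measurableSet_le measurable_snd (measurable_fst.add_const h))

lemma strip_indicator_left (h : ℝ) (g : ℝ → ℝ) (v : ℝ) :
    (fun w => (strip h).indicator (fun p : ℝ × ℝ => g p.1) (v, w)) =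
      (Set.Ioc v (v + h)).indicator fun _ => g v := by
  funext w; simp only [Set.indicator, strip, Set.mem_ofPred_eq, Set.mem_Ioc]; congr

lemma strip_indicator_right (h : ℝ) (g : ℝ → ℝ) (w : ℝ) :
    (fun v => (strip h).indicator (fun p : ℝ × ℝ => g p.1) (v, w)) =
      (Set.Ico (w - h) w).indicator g := by
  funext v
  simp only [Set.indicator, strip, Set.mem_ofPred_eq, Set.mem_Ico]
  congr 1
  rw [eq_iff_iff, sub_le_iff_le_add]; tauto

lemma integrable_strip {σ : ℝ → ℝ} (hm : Monotone σ) {h : ℝ} (hh : 0 ≤ h) {g : ℝ → ℝ}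
    (hg : Measurable g) (hi : Integrable fun v => g v * (σ (v + h) - σ v)) :
    Integrable ((strip h).indicator fun p : ℝ × ℝ => g p.1)
      ((volume : Measure ℝ).prod hm.stieltjesFunction.measure) := by
  have hmeas : Measurable ((strip h).indicator fun p : ℝ × ℝ => g p.1) :=
    (hg.comp measurable_fst).indicator (measurableSet_strip h)
  rw [integrable_prod_iff hmeas.aestronglyMeasurable]
  constructor
  · refine Eventually.of_forall fun v => ?_
    rw [strip_indicator_left, integrable_indicator_iff measurableSet_Ioc]
    exact integrableOn_const measure_Ioc_lt_top.ne
  · refine hi.norm.congr ?_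
    filter_upwards [measureReal_Ioc_stieltjesFunction hm hh] with v hv
    have e : (fun w => ‖(strip h).indicator (fun p : ℝ × ℝ => g p.1) (v, w)‖) =
        (Set.Ioc v (v + h)).indicator fun _ => ‖g v‖ := by
      funext w
      rw [← norm_indicator_eq_indicator_norm (fun _ => g v), ← strip_indicator_left]
    rw [e, integral_indicator_const _ measurableSet_Ioc, hv, norm_mul, smul_eq_mul, mul_comm,
      Real.norm_of_nonneg (sub_nonneg.2 (hm (by linarith : v ≤ v + h)))]

/-- Integration of an increment of `σ` as a double integral. -/
lemma integral_mul_increment {σ : ℝ → ℝ} (hm : Monotone σ) {h : ℝ} (hh : 0 ≤ h) {g : ℝ → ℝ}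
    (hg : Measurable g) (hi : Integrable fun v => g v * (σ (v + h) - σ v)) :
    Integrable (fun w => ∫ v in Set.Ico (w - h) w, g v) hm.stieltjesFunction.measure ∧
    ∫ v, g v * (σ (v + h) - σ v) =
      ∫ w, (∫ v in Set.Ico (w - h) w, g v) ∂hm.stieltjesFunction.measure := by
  have hp := integrable_strip hm hh hg hi
  have e1 : ∀ w, ∫ v, (strip h).indicator (fun p : ℝ × ℝ => g p.1) (v, w) =
      ∫ v in Set.Ico (w - h) w, g v := fun w => by
    rw [strip_indicator_right, integral_indicator measurableSet_Ico]
  constructor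
  · have := hp.integral_prod_right
    simpa only [e1] using this
  · have e2 := integral_prod _ hp
    rw [integral_prod_symm _ hp] at e2
    simp only [e1] at e2
    rw [e2]
    refine integral_congr_ae ?_
    filter_upwards [measureReal_Ioc_stieltjesFunction hm hh] with v hv
    rw [strip_indicator_left, integral_indicator_const _ measurableSet_Ioc, hv, smul_eq_mul,
      mul_comm]

lemma IsSymbol.integrable_envelope_shift {σ : ℝ → ℝ} (hσ : IsSymbol σ) (h : ℝ) :
    Integrable fun v => σ (v + h) * envelope v := by
  have h1 : Integrable fun v => σ v * envelope (v - h) := by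
    refine (hσ.integrable_envelope.const_mul ((1 + |h|) * Real.exp |h|)).mono'
      (hσ.measurable.mul (by fun_prop : Continuous fun v => envelope (v - h)).measurable).aestronglyMeasurable
      (Eventually.of_forall fun v => ?_)
    have h0 := hσ.nonneg v
    rw [Real.norm_of_nonneg (mul_nonneg h0 (envelope_pos _).le)]
    calc _ ≤ σ v * ((1 + |h|) * Real.exp |h| * envelope v) := by
          gcongr; exact envelope_shift le_rfl v
      _ = _ := by ring
  simpa using h1.comp_add_right h

lemma IsSymbol.integrable_mul_increment {σ : ℝ → ℝ} (hσ : IsSymbol σ) {h C : ℝ} {g : ℝ → ℝ}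
    (hg : Measurable g) (hb : ∀ v, |g v| ≤ C * envelope v) :
    Integrable fun v => g v * (σ (v + h) - σ v) := by
  refine (((hσ.integrable_envelope_shift h).add hσ.integrable_envelope).const_mul C).mono'
    (hg.mul ((hσ.measurable.comp (measurable_id.add_const h)).sub
      hσ.measurable)).aestronglyMeasurable (Eventually.of_forall fun v => ?_)
  have h0 := hσ.nonneg v
  have h1 := hσ.nonneg (v + h)
  rw [norm_mul]
  calc _ ≤ (C * envelope v) * (σ (v + h) + σ v) := by
        refine mul_le_mul (hb v) ?_ (norm_nonneg _) ((abs_nonneg _).trans (hb v))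
        rw [Real.norm_eq_abs, abs_le]; constructor <;> linarith
    _ = _ := by simp only [Pi.add_apply]; ring

lemma envelope_le_mul {v w : ℝ} (h : |v - w| ≤ 1) : envelope v ≤ 2 * Real.exp 1 * envelope w := by
  have := envelope_shift (T := 1) (τ := w - v) (by rwa [abs_sub_comm]) w
  simpa [one_add_one_eq_two] using this

/-- The increment formula with step 1 makes w ↦ ∫ of the envelope over [w - 1, w) integrable for dσ,
and the envelope changes by a bounded factor on unit intervals. -/
lemma IsSymbol.integrable_envelope_stieltjes {σ : ℝ → ℝ} (hσ : IsSymbol σ) :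
    Integrable envelope hσ.mono.stieltjesFunction.measure := by
  have h1 := (integral_mul_increment hσ.mono zero_le_one continuous_envelope.measurable
    (hσ.integrable_mul_increment (h := 1) continuous_envelope.measurable (C := 1) fun v => by
      rw [abs_of_pos (envelope_pos v), one_mul])).1
  refine (h1.const_mul (2 * Real.exp 1)).mono' continuous_envelope.aestronglyMeasurable
    (Eventually.of_forall fun w => ?_)
  rw [Real.norm_of_nonneg (envelope_pos w).le, ← integral_const_mul]
  have hi : IntegrableOn (fun v => 2 * Real.exp 1 * envelope v) (Set.Ico (w - 1) w) :=
    ((by fun_prop : Continuous fun v => 2 * Real.exp 1 * envelope v).integrableOn_Icc).mono_set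
      Set.Ico_subset_Icc_self
  have hc : envelope w = ∫ _ in Set.Ico (w - 1) w, envelope w := by simp
  rw [hc]
  refine setIntegral_mono_on (integrableOn_const measure_Ico_lt_top.ne) hi measurableSet_Ico
    fun v hv => envelope_le_mul ?_
  rw [abs_le]; constructor <;> linarith [hv.1, hv.2]

/-! ### Continuity and bounds for the wave function -/

lemma continuous_waveL2 {σ : ℝ → ℝ} (hσ : IsSymbol σ) : Continuous (waveL2 σ) :=
  continuous_iff_continuousAt.2 fun τ => (hasDerivAt_waveL2 hσ τ).continuousAt

lemma continuous_wave {σ : ℝ → ℝ} (hσ : IsSymbol σ) :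
    Continuous fun p : ℝ × ℝ => wave σ p.1 p.2 := by
  have h1 := continuous_waveL2 hσ
  have h2 : Continuous fun p : ℝ × ℝ => kernelL2 σ p.2 p.1 :=
    (continuous_kernelL2 hσ).comp continuous_swap
  unfold wave
  exact (by fun_prop : Continuous fun p : ℝ × ℝ => airy (p.1 - p.2)).add
    (h2.inner (h1.comp continuous_snd))

lemma continuous_wave_comp {σ : ℝ → ℝ} (hσ : IsSymbol σ) {X : Type*} [TopologicalSpace X]
    {a b : X → ℝ} (ha : Continuous a) (hb : Continuous b) : Continuous fun x => wave σ (a x) (b x) := by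
  have h := (continuous_wave hσ).comp (ha.prodMk hb)
  exact h

lemma exists_abs_wave_le {σ : ℝ → ℝ} (hσ : IsSymbol σ) (T : ℝ) :
    ∃ C, 0 < C ∧ ∀ τ : ℝ, |τ| ≤ T → ∀ z, |wave σ z τ| ≤ C * √(envelope z) := by
  obtain ⟨B, hB, h⟩ := exists_shift_bounds T
  obtain ⟨B', hB', h'⟩ := exists_norm_kernelL2_le hσ T
  obtain ⟨M, hM⟩ := (isCompact_Icc (a := -T) (b := T)).exists_bound_of_continuousOn
    (continuous_waveL2 hσ).continuousOn
  refine ⟨B + B' * B * max M 0, by positivity, fun τ hτ z => ?_⟩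
  have h1 := (h τ hτ z).1
  have h2 := (h τ hτ z).2.1
  have h3 := h' τ hτ z
  have h4 : ‖waveL2 σ τ‖ ≤ max M 0 := (hM τ (abs_le.1 hτ)).trans (le_max_left _ _)
  rw [wave]
  refine (abs_add_le _ _).trans ?_
  calc _ ≤ B * √(envelope z) + (B' * (B * √(envelope z))) * max M 0 := by
        refine add_le_add h2 ((abs_real_inner_le_norm _ _).trans ?_)
        exact mul_le_mul (h3.trans (by gcongr)) h4 (norm_nonneg _) (by positivity)
    _ = _ := by ring

/-! ### The increment of `waveQ` and its limit. -/

lemma wave_eq_integral {σ : ℝ → ℝ} (hσ : IsSymbol σ) (τ z : ℝ) :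
    wave σ z τ = airy (z - τ) + ∫ v, airyKernel (z - τ) (v - τ) * (σ v * wave σ v τ) := by
  rw [wave, kernelL2, inner_toL2 (memLp_kernelVec hσ τ z)]
  congr 1
  refine integral_congr_ae ?_
  filter_upwards [waveL2_eq hσ τ] with v hv
  rw [hv, kernelVec]
  linear_combination (airyKernel (z - τ) (v - τ) * wave σ v τ) * Real.mul_self_sqrt (hσ.nonneg v)

lemma waveQ_eq_integral {σ : ℝ → ℝ} (hσ : IsSymbol σ) (τ : ℝ) :
    waveQ σ τ = ∫ v, airy (v - τ) * (σ v * wave σ v τ) := by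
  rw [waveQ, airyL2, inner_toL2 (memLp_airyVec hσ τ)]
  refine integral_congr_ae ?_
  filter_upwards [waveL2_eq hσ τ] with v hv
  rw [hv, airyVec]
  linear_combination (airy (v - τ) * wave σ v τ) * Real.mul_self_sqrt (hσ.nonneg v)

/-- Two solutions of the same linear integral equation with different symbols. -/
lemma integral_symbol_difference {τ C : ℝ} {s₁ s₂ f₁ f₂ : ℝ → ℝ}
    (hs₁ : Measurable s₁) (hs₂ : Measurable s₂) (hf₁ : Measurable f₁) (hf₂ : Measurable f₂)
    (i₁ : Integrable fun v => s₁ v * envelope v) (i₂ : Integrable fun v => s₂ v * envelope v)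
    (b₁ : ∀ v, |f₁ v| ≤ C * √(envelope v)) (b₂ : ∀ v, |f₂ v| ≤ C * √(envelope v))
    (e₁ : ∀ z, f₁ z = airy (z - τ) + ∫ v, airyKernel (z - τ) (v - τ) * (s₁ v * f₁ v))
    (e₂ : ∀ z, f₂ z = airy (z - τ) + ∫ v, airyKernel (z - τ) (v - τ) * (s₂ v * f₂ v)) :
    (∫ v, airy (v - τ) * (s₂ v * f₂ v)) - ∫ v, airy (v - τ) * (s₁ v * f₁ v) =
      ∫ v, f₁ v * f₂ v * (s₂ v - s₁ v) := by
  obtain ⟨B, hB, h⟩ := exists_shift_bounds |τ|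
  have hC : 0 ≤ C := by
    by_contra! hc
    have h0 : 0 < √(envelope 0) := Real.sqrt_pos.2 (envelope_pos 0)
    nlinarith [b₁ 0, abs_nonneg (f₁ 0)]
  have hK : ∀ v w, |airyKernel (v - τ) (w - τ)| ≤ (B * √(envelope v)) * (B * √(envelope w)) :=
    fun v w => (abs_airyKernel_le _ _).trans
      (mul_le_mul (h τ le_rfl v).1 (h τ le_rfl w).1 (Real.sqrt_nonneg _) (by positivity))
  have he : ∀ v, √(envelope v) * √(envelope v) = envelope v := fun v =>
    Real.mul_self_sqrt (envelope_pos v).le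
  have prod_int : ∀ {s f g : ℝ → ℝ} {D : ℝ}, Measurable s → Measurable f → Measurable g →
      Integrable (fun v => s v * envelope v) → (∀ v, |f v| ≤ C * √(envelope v)) →
      (∀ v, |g v| ≤ D * √(envelope v)) → Integrable fun v => g v * (s v * f v) := by
    intro s f g D ms mf mg is bf bg
    refine (is.norm.const_mul (C * D)).mono' (mg.mul (ms.mul mf)).aestronglyMeasurable
      (Eventually.of_forall fun v => ?_)
    simp only [norm_mul, Real.norm_eq_abs, abs_of_pos (envelope_pos v)]
    calc _ ≤ (D * √(envelope v)) * (|s v| * (C * √(envelope v))) := by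
          refine mul_le_mul (bg v) ?_ (by positivity) ((abs_nonneg _).trans (bg v))
          gcongr; exact bf v
      _ = C * D * (|s v| * (√(envelope v) * √(envelope v))) := by ring
      _ = _ := by rw [he]
  have ma : Measurable fun v => airy (v - τ) :=
    (by fun_prop : Continuous fun v => airy (v - τ)).measurable
  have ba : ∀ v, |airy (v - τ)| ≤ B * √(envelope v) := fun v => (h τ le_rfl v).2.1
  have mE : Measurable fun v => √(envelope v) := continuous_envelope.sqrt.measurable
  have bE : ∀ v, |√(envelope v)| ≤ 1 * √(envelope v) := fun v => by
    rw [abs_of_nonneg (Real.sqrt_nonneg _), one_mul]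
  set A₁ : ℝ → ℝ := fun z => ∫ v, airyKernel (z - τ) (v - τ) * (s₁ v * f₁ v) with hA₁
  set A₂ : ℝ → ℝ := fun z => ∫ v, airyKernel (z - τ) (v - τ) * (s₂ v * f₂ v) with hA₂
  have hdbl : Integrable fun p : ℝ × ℝ =>
      (s₂ p.1 * f₂ p.1) * (airyKernel (p.1 - τ) (p.2 - τ) * (s₁ p.2 * f₁ p.2)) := by
    have j1 := (prod_int hs₂ hf₂ mE i₂ b₂ bE).norm
    have j2 := (prod_int hs₁ hf₁ mE i₁ b₁ bE).norm
    refine ((j1.mul_prod j2).const_mul (B ^ 2)).mono' ?_ (Eventually.of_forall fun p => ?_)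
    · refine (((hs₂.comp measurable_fst).mul (hf₂.comp measurable_fst)).mul
        (Measurable.mul ?_ ((hs₁.comp measurable_snd).mul
          (hf₁.comp measurable_snd)))).aestronglyMeasurable
      exact (continuous_airyKernel.comp
        (by fun_prop : Continuous fun p : ℝ × ℝ => (p.1 - τ, p.2 - τ))).measurable
    · simp only [norm_mul, Real.norm_eq_abs, abs_of_nonneg (Real.sqrt_nonneg _)]
      calc _ ≤ (|s₂ p.1| * |f₂ p.1|) * (((B * √(envelope p.1)) * (B * √(envelope p.2))) *
            (|s₁ p.2| * |f₁ p.2|)) := by gcongr; exact hK _ _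
        _ = _ := by ring
  -- Each equation is tested against the other solution; by symmetry of the kernel the two double
  -- integrals coincide, and only the Airy terms and the difference of the symbols survive.
  have hsym : ∫ v, s₂ v * f₂ v * A₁ v = ∫ v, s₁ v * f₁ v * A₂ v := by
    simp only [hA₁, hA₂, ← integral_const_mul]
    rw [integral_integral_swap hdbl]
    congr 1; funext w; congr 1; funext v
    rw [airyKernel_comm]; ring
  have k1 := prod_int hs₂ hf₂ ma i₂ b₂ ba
  have k2 := prod_int hs₁ hf₁ ma i₁ b₁ ba
  have k3 := prod_int hs₂ hf₂ hf₁ i₂ b₂ b₁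
  have k4 := prod_int hs₁ hf₁ hf₂ i₁ b₁ b₂
  have l1 : ∫ v, s₂ v * f₂ v * A₁ v =
      (∫ v, f₁ v * (s₂ v * f₂ v)) - ∫ v, airy (v - τ) * (s₂ v * f₂ v) := by
    rw [← integral_sub k3 k1]
    congr 1; funext v; rw [e₁ v]; ring
  have l2 : ∫ v, s₁ v * f₁ v * A₂ v =
      (∫ v, f₂ v * (s₁ v * f₁ v)) - ∫ v, airy (v - τ) * (s₁ v * f₁ v) := by
    rw [← integral_sub k4 k2]
    congr 1; funext v; rw [e₂ v]; ring
  have l3 : ∫ v, f₁ v * f₂ v * (s₂ v - s₁ v) =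
      (∫ v, f₁ v * (s₂ v * f₂ v)) - ∫ v, f₂ v * (s₁ v * f₁ v) := by
    rw [← integral_sub k3 k4]
    congr 1; funext v; ring
  rw [l3]; linarith

/-- Translation of all variables by h turns the equation at τ + h into the one at τ with symbol σ(·
+ h); the difference of symbols is then an increment of σ. -/
lemma waveQ_sub {σ : ℝ → ℝ} (hσ : IsSymbol σ) (τ h : ℝ) :
    waveQ σ (τ + h) - waveQ σ τ =
      ∫ v, wave σ v τ * wave σ (v + h) (τ + h) * (σ (v + h) - σ v) := by
  obtain ⟨C₁, hC₁, b₁⟩ := exists_abs_wave_le hσ |τ|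
  obtain ⟨C₂, hC₂, b₂⟩ := exists_abs_wave_le hσ |τ + h|
  set D := √((1 + |h|) * Real.exp |h|) with hD
  have hsh : ∀ v, √(envelope (v + h)) ≤ D * √(envelope v) := fun v => by
    rw [hD, ← Real.sqrt_mul (by positivity)]
    have := envelope_shift (T := |h|) (τ := -h) (by rw [abs_neg]) v
    exact Real.sqrt_le_sqrt (by simpa using this)
  have shift : ∀ f : ℝ → ℝ, ∫ v, f (v + h) = ∫ v, f v := fun f => integral_add_right_eq_self f h
  have key := integral_symbol_difference (τ := τ) (C := max C₁ (C₂ * D))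
    (s₁ := σ) (s₂ := fun v => σ (v + h)) (f₁ := fun v => wave σ v τ)
    (f₂ := fun v => wave σ (v + h) (τ + h)) hσ.measurable
    (hσ.measurable.comp (measurable_id.add_const h))
    (continuous_wave_comp hσ continuous_id continuous_const).measurable
    (continuous_wave_comp hσ (by fun_prop) continuous_const).measurable
    hσ.integrable_envelope (hσ.integrable_envelope_shift h)
    (fun v => (b₁ τ le_rfl v).trans (by gcongr; exact le_max_left _ _))
    (fun v => (b₂ _ le_rfl (v + h)).trans (by
      calc _ ≤ C₂ * (D * √(envelope v)) := by gcongr; exact hsh v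
        _ = (C₂ * D) * √(envelope v) := by ring
        _ ≤ _ := by gcongr; exact le_max_right _ _))
    (fun z => wave_eq_integral hσ τ z)
    (fun z => by
      rw [wave_eq_integral hσ, ← shift]
      simp only [add_sub_add_right_eq_sub])
  rw [← key, waveQ_eq_integral hσ, waveQ_eq_integral hσ, ← shift]
  simp only [add_sub_add_right_eq_sub]

lemma integrable_wave_sq {σ : ℝ → ℝ} (hσ : IsSymbol σ) (τ : ℝ) :
    Integrable (fun w => wave σ w τ ^ 2) hσ.mono.stieltjesFunction.measure := by
  obtain ⟨C, hC, b⟩ := exists_abs_wave_le hσ |τ|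
  have hc : Continuous fun w => wave σ w τ :=
    continuous_wave_comp hσ continuous_id continuous_const
  refine (hσ.integrable_envelope_stieltjes.const_mul (C ^ 2)).mono'
    (hc.pow 2).aestronglyMeasurable (Eventually.of_forall fun w => ?_)
  rw [Real.norm_of_nonneg (sq_nonneg _), ← sq_abs]
  calc _ ≤ (C * √(envelope w)) ^ 2 := by gcongr; exact b τ le_rfl w
    _ = _ := by rw [mul_pow, Real.sq_sqrt (envelope_pos w).le]

/-- The derivative of `q` is `∫ Φ² dσ`. -/
lemma waveQ_sq_sub_eq_integral {σ : ℝ → ℝ} (hσ : IsSymbol σ) (τ : ℝ) :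
    waveQ σ τ ^ 2 - 2 * waveP σ τ =
      ∫ w, wave σ w τ ^ 2 ∂hσ.mono.stieltjesFunction.measure := by
  obtain ⟨C, hC, b⟩ := exists_abs_wave_le hσ (|τ| + 1)
  set g : ℝ → ℝ → ℝ := fun h v => wave σ v τ * wave σ (v + h) (τ + h) with hg
  have hgc : Continuous fun p : ℝ × ℝ => g p.1 p.2 :=
    (continuous_wave_comp hσ continuous_snd continuous_const).mul
      (continuous_wave_comp hσ (by fun_prop) (by fun_prop))
  have hgc' : ∀ h, Continuous (g h) := fun h =>
    (continuous_wave_comp hσ continuous_id continuous_const).mul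
      (continuous_wave_comp hσ (by fun_prop) continuous_const)
  set E := 2 * Real.exp 1 with hE
  have hE0 : 0 < E := by positivity
  have hgb : ∀ h v w, 0 < h → h ≤ 1 → v ∈ Set.Icc (w - h) w → |g h v| ≤ C ^ 2 * E * envelope w := by
    intro h v w h0 h1 hv
    have t1 : |τ| ≤ |τ| + 1 := by linarith
    have t2 : |τ + h| ≤ |τ| + 1 := (abs_add_le _ _).trans (by rw [abs_of_pos h0]; linarith)
    have hs : ∀ v, |v - w| ≤ 1 → √(envelope v) ≤ √(E * envelope w) := fun v hv =>
      Real.sqrt_le_sqrt (envelope_le_mul hv)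
    have a1 := hs v (by rw [abs_le]; constructor <;> linarith [hv.1, hv.2])
    have a2 := hs (v + h) (by rw [abs_le]; constructor <;> linarith [hv.1, hv.2])
    rw [hg, abs_mul]
    calc _ ≤ (C * √(E * envelope w)) * (C * √(E * envelope w)) :=
          mul_le_mul ((b τ t1 v).trans (by gcongr)) ((b _ t2 (v + h)).trans (by gcongr))
            (abs_nonneg _) (by positivity)
      _ = C ^ 2 * (√(E * envelope w) * √(E * envelope w)) := by ring
      _ = _ := by
          rw [Real.mul_self_sqrt (mul_nonneg hE0.le (envelope_pos w).le)]; ring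
  have hgv : ∀ h, 0 < h → h ≤ 1 → ∀ v, |g h v| ≤ C ^ 2 * E * envelope v := fun h h0 h1 v =>
    hgb h v v h0 h1 ⟨by linarith, le_rfl⟩
  have hpair : ∀ h, 0 < h → h ≤ 1 →
      Integrable (fun w => ∫ v in Set.Ico (w - h) w, g h v) hσ.mono.stieltjesFunction.measure ∧
      waveQ σ (τ + h) - waveQ σ τ =
        ∫ w, (∫ v in Set.Ico (w - h) w, g h v) ∂hσ.mono.stieltjesFunction.measure := by
    intro h h0 h1
    rw [waveQ_sub hσ]
    exact integral_mul_increment hσ.mono h0.le (hgc' h).measurable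
      (hσ.integrable_mul_increment (hgc' h).measurable (hgv h h0 h1))
  have hIco : ∀ h w, 0 < h → ∫ v in Set.Ico (w - h) w, g h v = ∫ v in (w - h)..w, g h v := by
    intro h w h0
    rw [intervalIntegral.integral_of_le (by linarith), integral_Ico_eq_integral_Ioc]
  have hsmall : ∀ᶠ h : ℝ in 𝓝[>] 0, 0 < h ∧ h ≤ 1 := by
    filter_upwards [Ioc_mem_nhdsGT one_pos] with h hh using hh
  -- For fixed w the average of g h over [w - h, w) tends to g 0 w = Φ(w)², by joint continuity; the
  -- envelope dominates uniformly for h ≤ 1.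
  have hlim : Tendsto (fun h : ℝ => ∫ w, h⁻¹ * (∫ v in Set.Ico (w - h) w, g h v)
      ∂hσ.mono.stieltjesFunction.measure) (𝓝[>] 0)
      (𝓝 (∫ w, wave σ w τ ^ 2 ∂hσ.mono.stieltjesFunction.measure)) := by
    refine tendsto_integral_filter_of_dominated_convergence
      (fun w => C ^ 2 * E * envelope w) ?_ ?_
      (hσ.integrable_envelope_stieltjes.const_mul _) (Eventually.of_forall fun w => ?_)
    · filter_upwards [hsmall] with h hh
      exact ((hpair h hh.1 hh.2).1.const_mul _).aestronglyMeasurable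
    · filter_upwards [hsmall] with h hh
      refine Eventually.of_forall fun w => ?_
      rw [hIco h w hh.1, norm_mul, norm_inv, Real.norm_of_nonneg hh.1.le,
        inv_mul_le_iff₀ hh.1]
      have := intervalIntegral.norm_integral_le_of_norm_le_const (a := w - h) (b := w)
        (f := g h) (C := C ^ 2 * E * envelope w) fun v hv => hgb h v w hh.1 hh.2 (by
          rw [Set.uIoc_of_le (by linarith [hh.1])] at hv; exact ⟨hv.1.le, hv.2⟩)
      rw [sub_sub_cancel, abs_of_pos hh.1] at this
      linarith
    · rw [Metric.tendsto_nhds]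
      intro ε hε
      have h0 : g 0 w = wave σ w τ ^ 2 := by simp [hg, sq]
      obtain ⟨δ, hδ, hcl⟩ := Metric.continuousAt_iff.1 (hgc.continuousAt (x := ((0 : ℝ), w)))
        (ε / 2) (half_pos hε)
      filter_upwards [hsmall, Ioo_mem_nhdsGT hδ] with h hh hh'
      rw [hIco h w hh.1, Real.dist_eq]
      have e : h⁻¹ * (∫ v in (w - h)..w, g h v) - wave σ w τ ^ 2 =
          h⁻¹ * ∫ v in (w - h)..w, (g h v - wave σ w τ ^ 2) := by
        rw [intervalIntegral.integral_sub ((hgc' h).intervalIntegrable _ _)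
          (by simp), intervalIntegral.integral_const, sub_sub_cancel, smul_eq_mul, mul_sub,
          inv_mul_cancel_left₀ hh.1.ne']
      have := intervalIntegral.norm_integral_le_of_norm_le_const (a := w - h) (b := w)
        (f := fun v => g h v - wave σ w τ ^ 2) (C := ε / 2) fun v hv => by
          rw [Set.uIoc_of_le (by linarith [hh.1])] at hv
          have hd : dist ((h, v) : ℝ × ℝ) (0, w) < δ := by
            rw [Prod.dist_eq, max_lt_iff, Real.dist_eq, Real.dist_eq, sub_zero,
              abs_of_pos hh.1, abs_lt]
            exact ⟨hh'.2, by linarith [hv.1, hh'.2], by linarith [hv.2]⟩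
          have := hcl hd
          rw [h0, Real.dist_eq] at this
          exact this.le
      rw [sub_sub_cancel, abs_of_pos hh.1] at this
      rw [e, abs_mul, abs_inv, abs_of_pos hh.1, inv_mul_lt_iff₀ hh.1]
      rw [Real.norm_eq_abs] at this
      nlinarith [hh.1]
  -- The derivative of q is already known to exist, so identifying its one-sided limit is enough.
  have hder := (hasDerivAt_waveQ hσ τ).tendsto_slope_zero_right
  refine tendsto_nhds_unique hder (hlim.congr' ?_)
  filter_upwards [hsmall] with h hh
  rw [(hpair h hh.1 hh.2).2, integral_const_mul, smul_eq_mul]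


/-! ### Hadamard's inequality -/

/-- The determinant of the rows in an orthonormal basis is the volume form, which is bounded by the
product of the lengths. -/
lemma abs_det_le_prod_norm {n : ℕ} (M : Matrix (Fin n) (Fin n) ℝ) :
    |M.det| ≤ ∏ i, ‖(WithLp.toLp 2 (M i) : EuclideanSpace ℝ (Fin n))‖ := by
  have : Fact (Module.finrank ℝ (EuclideanSpace ℝ (Fin n)) = n) := ⟨by simp⟩
  set e := EuclideanSpace.basisFun (Fin n) ℝ
  have h := e.toBasis.orientation.abs_volumeForm_apply_le
    (fun i => (WithLp.toLp 2 (M i) : EuclideanSpace ℝ (Fin n)))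
  rw [e.toBasis.orientation.volumeForm_robust' e] at h
  have hd : e.toBasis.det (fun i => (WithLp.toLp 2 (M i) : EuclideanSpace ℝ (Fin n))) = M.det := by
    rw [Module.Basis.det_apply, ← Matrix.det_transpose]
    congr 1
  rwa [hd] at h

/-- Hadamard's inequality for a matrix whose entries are bounded by products. -/
lemma abs_det_le_of_abs_le_mul {n : ℕ} (M : Matrix (Fin n) (Fin n) ℝ) {a c : Fin n → ℝ}
    (ha : ∀ i, 0 ≤ a i) (hc : ∀ j, 0 ≤ c j) (h : ∀ i j, |M i j| ≤ a i * c j) :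
    |M.det| ≤ √((n : ℝ) ^ n) * ((∏ i, a i) * ∏ j, c j) := by
  -- Normalisation to entries of modulus at most 1, so that rows have length at most √n. Where a i *
  -- c j = 0 the quotient is 0 by convention, which is consistent because M i j vanishes there.
  set N : Matrix (Fin n) (Fin n) ℝ := Matrix.of fun i j => M i j / (a i * c j) with hN
  have hMN : M = Matrix.of fun i j => a i * (Matrix.of fun i j => c j * N i j) i j := by
    ext i j
    simp only [hN, Matrix.of_apply]
    rcases eq_or_ne (a i * c j) 0 with h0 | h0
    · have := h i j
      rw [h0, abs_nonpos_iff] at this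
      simp [this]
    · field_simp [left_ne_zero_of_mul h0, right_ne_zero_of_mul h0]
  have hrow : ∀ i, ‖(WithLp.toLp 2 (N i) : EuclideanSpace ℝ (Fin n))‖ ≤ √(n : ℝ) := fun i => by
    rw [EuclideanSpace.norm_eq]
    refine Real.sqrt_le_sqrt ?_
    calc _ ≤ ∑ _j : Fin n, (1 : ℝ) := by
          refine Finset.sum_le_sum fun j _ => ?_
          have h1 : |N i j| ≤ 1 := by
            simp only [hN, Matrix.of_apply, abs_div, abs_of_nonneg (mul_nonneg (ha i) (hc j))]
            exact div_le_one_of_le₀ (h i j) (mul_nonneg (ha i) (hc j))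
          simpa using pow_le_one₀ (abs_nonneg _) h1 (n := 2)
      _ = n := by simp
  have hdN : |N.det| ≤ √((n : ℝ) ^ n) := by
    refine (abs_det_le_prod_norm N).trans ?_
    calc _ ≤ ∏ _i : Fin n, √(n : ℝ) := Finset.prod_le_prod (fun i _ => norm_nonneg _) fun i _ => hrow i
      _ = √((n : ℝ) ^ n) := by
          simp only [Finset.prod_const, Finset.card_univ, Fintype.card_fin]
          rw [Real.sqrt_eq_rpow, Real.sqrt_eq_rpow, ← Real.rpow_natCast, ← Real.rpow_natCast,
            ← Real.rpow_mul (Nat.cast_nonneg _), ← Real.rpow_mul (Nat.cast_nonneg _), mul_comm]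
  have hp : 0 ≤ (∏ i, a i) * ∏ j, c j :=
    mul_nonneg (Finset.prod_nonneg fun i _ => ha i) (Finset.prod_nonneg fun j _ => hc j)
  rw [hMN, Matrix.det_mul_column, Matrix.det_mul_row, ← mul_assoc, abs_mul,
    abs_of_nonneg hp, mul_comm]
  exact mul_le_mul_of_nonneg_right hdN hp

/-! ### Fredholm expansions of a dominated symmetric kernel -/

/-- A symmetric measurable kernel and a vector, dominated by `b ∈ L²`. -/
structure IsDominated (k : ℝ → ℝ → ℝ) (g b : ℝ → ℝ) : Prop where
  symm : ∀ v w, k v w = k w v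
  measurable_kernel : Measurable fun p : ℝ × ℝ => k p.1 p.2
  measurable_vec : Measurable g
  abs_kernel_le : ∀ v w, |k v w| ≤ b v * b w
  abs_vec_le : ∀ v, |g v| ≤ b v
  memLp : MemLp b 2 volume

/-- The matrix `k(u_i, u_j)`. -/
def gram (k : ℝ → ℝ → ℝ) {n : ℕ} (u : Fin n → ℝ) : Matrix (Fin n) (Fin n) ℝ :=
  Matrix.of fun i j => k (u i) (u j)

/-- The matrix `k(u_i, u_j)` with the `i`-th row replaced by `g(u_j)`. -/
def bordered (k : ℝ → ℝ → ℝ) (g : ℝ → ℝ) {n : ℕ} (u : Fin n → ℝ) (i : Fin n) :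
    Matrix (Fin n) (Fin n) ℝ := (gram k u).updateRow i fun j => g (u j)

/-- The coefficients of the Fredholm determinant, without the factors `(-1)ⁿ / n!`. -/
def fredDet (k : ℝ → ℝ → ℝ) (n : ℕ) : ℝ := ∫ u : Fin n → ℝ, (gram k u).det

/-- The coefficients of `det(1 - k) (1 - k)⁻¹ g`, without the factors `(-1)ⁿ / n!`. -/
def fredVec (k : ℝ → ℝ → ℝ) (g : ℝ → ℝ) (n : ℕ) (v : ℝ) : ℝ :=
  ∫ u : Fin n → ℝ, (bordered k g (Fin.cons v u : Fin (n + 1) → ℝ) 0).det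

lemma measurable_det {α : Type*} [MeasurableSpace α] {n : ℕ} {M : α → Matrix (Fin n) (Fin n) ℝ}
    (h : ∀ i j, Measurable fun x => M x i j) : Measurable fun x => (M x).det := by
  simp only [Matrix.det_apply]
  exact Finset.measurable_sum _ fun π _ =>
    (Finset.measurable_prod _ fun i _ => h _ _).const_smul _

/-- The determinant of the bordered matrix is expanded along the new column. -/
lemma det_bordered_cons (k : ℝ → ℝ → ℝ) (g : ℝ → ℝ) {n : ℕ} (v : ℝ) (u : Fin n → ℝ) :
    (bordered k g (Fin.cons v u : Fin (n + 1) → ℝ) 0).det =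
      g v * (gram k u).det - ∑ i, k (u i) v * (bordered k g u i).det := by
  rw [Matrix.det_succ_column_zero, Fin.sum_univ_succ]
  have h0 : (bordered k g (Fin.cons v u : Fin (n + 1) → ℝ) 0).submatrix (Fin.succAbove 0) Fin.succ =
      gram k u := by
    ext i j
    simp [bordered, gram, Matrix.updateRow_apply]
  have h1 : ∀ i : Fin n, (-1 : ℝ) ^ (i.succ : ℕ) *
      (bordered k g (Fin.cons v u : Fin (n + 1) → ℝ) 0) i.succ 0 *
      ((bordered k g (Fin.cons v u : Fin (n + 1) → ℝ) 0).submatrix i.succ.succAbove Fin.succ).det =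
      -(k (u i) v * (bordered k g u i).det) := by
    intro i
    obtain ⟨n, rfl⟩ : ∃ m, n = m + 1 := ⟨n - 1, by have := i.pos; omega⟩
    -- The row g sits at position 0 in the minor and at position i in the bordered matrix, with the
    -- other rows in the same order; expanding both along this row leaves the sign (-1)^i.
    have hsub : ((bordered k g (Fin.cons v u : Fin (n + 1 + 1) → ℝ) 0).submatrix
        i.succ.succAbove Fin.succ).det = (-1 : ℝ) ^ (i : ℕ) * (bordered k g u i).det := by
      rw [Matrix.det_succ_row_zero, Matrix.det_succ_row _ i, Finset.mul_sum]
      refine Finset.sum_congr rfl fun l _ => ?_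
      have e1 : ((bordered k g (Fin.cons v u : Fin (n + 1 + 1) → ℝ) 0).submatrix
          i.succ.succAbove Fin.succ).submatrix Fin.succ l.succAbove =
          (bordered k g u i).submatrix i.succAbove l.succAbove := by
        ext a b
        simp [bordered, gram, Matrix.updateRow_apply, Fin.succAbove_ne]
      have e2 : ((bordered k g (Fin.cons v u : Fin (n + 1 + 1) → ℝ) 0).submatrix
          i.succ.succAbove Fin.succ) 0 l = bordered k g u i i l := by
        simp [bordered]
      rw [e1, e2, pow_add]
      have : ((-1 : ℝ) ^ (i : ℕ)) * (-1) ^ (i : ℕ) = 1 := by rw [← mul_pow]; simp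
      linear_combination (-((-1 : ℝ) ^ (l : ℕ) * bordered k g u i i l *
        ((bordered k g u i).submatrix i.succAbove l.succAbove).det)) * this
    have e3 : (bordered k g (Fin.cons v u : Fin (n + 1 + 1) → ℝ) 0) i.succ 0 = k (u i) v := by
      simp [bordered, gram, Matrix.updateRow_apply]
    rw [hsub, e3, Fin.val_succ, pow_succ]
    have : ((-1 : ℝ) ^ (i : ℕ)) * (-1) ^ (i : ℕ) = 1 := by rw [← mul_pow]; simp
    linear_combination (-(k (u i) v * (bordered k g u i).det)) * this
  rw [Finset.sum_congr rfl fun i _ => h1 i, h0, Finset.sum_neg_distrib]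
  simp [bordered, sub_eq_add_neg]

lemma det_bordered_comp_perm (k : ℝ → ℝ → ℝ) (g : ℝ → ℝ) {n : ℕ} (u : Fin n → ℝ)
    (π : Equiv.Perm (Fin n)) (i : Fin n) :
    (bordered k g (u ∘ π) i).det = (bordered k g u (π i)).det := by
  rw [← Matrix.det_submatrix_equiv_self π (bordered k g u (π i))]
  congr 1
  ext a b
  simp [bordered, gram, Matrix.updateRow_apply]

lemma integral_comp_perm {n : ℕ} (π : Equiv.Perm (Fin n)) (f : (Fin n → ℝ) → ℝ) :
    ∫ u, f (u ∘ π) = ∫ u, f u := by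
  have h := volume_measurePreserving_piCongrLeft (fun _ : Fin n => ℝ) π.symm
  rw [← h.integral_comp' f]
  congr 1; funext u
  congr 1; funext i
  have := Equiv.piCongrLeft_apply_apply (fun _ : Fin n => ℝ) π.symm u (π i)
  simp only [Equiv.symm_apply_apply] at this
  rw [MeasurableEquiv.coe_piCongrLeft]
  exact this.symm

namespace IsDominated

variable {k : ℝ → ℝ → ℝ} {g b : ℝ → ℝ}

lemma nonneg (H : IsDominated k g b) (v : ℝ) : 0 ≤ b v := (abs_nonneg _).trans (H.abs_vec_le v)

lemma integrable_sq (H : IsDominated k g b) : Integrable fun v => b v ^ 2 := H.memLp.integrable_sq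

lemma integrable_prod_sq (H : IsDominated k g b) (n : ℕ) :
    Integrable fun u : Fin n → ℝ => ∏ i, b (u i) ^ 2 :=
  Integrable.fintype_prod (f := fun (_ : Fin n) (v : ℝ) => b v ^ 2) fun _ => H.integrable_sq

lemma integral_prod_sq (b : ℝ → ℝ) (n : ℕ) :
    ∫ u : Fin n → ℝ, ∏ i, b (u i) ^ 2 = (∫ v, b v ^ 2) ^ n := by
  rw [integral_fintype_prod_volume_eq_prod (fun (_ : Fin n) (v : ℝ) => b v ^ 2)]
  simp

lemma abs_det_gram_le (H : IsDominated k g b) {n : ℕ} (u : Fin n → ℝ) :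
    |(gram k u).det| ≤ √((n : ℝ) ^ n) * ∏ i, b (u i) ^ 2 := by
  refine (abs_det_le_of_abs_le_mul (gram k u) (fun i => H.nonneg (u i)) (fun i => H.nonneg (u i))
    fun i j => H.abs_kernel_le _ _).trans_eq ?_
  rw [← Finset.prod_mul_distrib]; simp only [sq]

/-- The row g carries no factor b(u i), so Hadamard yields one factor too few; the prefactor
restores the full product of squares. -/
lemma abs_det_bordered_le (H : IsDominated k g b) {n : ℕ} (u : Fin n → ℝ) (i : Fin n) :
    b (u i) * |(bordered k g u i).det| ≤ √((n : ℝ) ^ n) * ∏ j, b (u j) ^ 2 := by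
  have h := abs_det_le_of_abs_le_mul (bordered k g u i)
    (a := Function.update (fun j => b (u j)) i 1) (c := fun j => b (u j))
    (fun j => by
      rcases eq_or_ne j i with rfl | hj
      · simp
      · simpa [hj] using H.nonneg _)
    (fun j => H.nonneg _) fun j l => by
      rcases eq_or_ne j i with rfl | hj
      · simpa [bordered] using H.abs_vec_le _
      · simpa [bordered, hj, gram] using H.abs_kernel_le _ _
  rw [Finset.prod_update_of_mem (Finset.mem_univ i), one_mul] at h
  calc _ ≤ b (u i) * _ := mul_le_mul_of_nonneg_left h (H.nonneg _)
    _ = √((n : ℝ) ^ n) * ((b (u i) * ∏ x ∈ Finset.univ \ {i}, b (u x)) * ∏ j, b (u j)) := by ring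
    _ = _ := by
        rw [Finset.sdiff_singleton_eq_erase,
          Finset.mul_prod_erase _ (fun x => b (u x)) (Finset.mem_univ i), ← Finset.prod_mul_distrib]
        simp only [sq]

lemma abs_det_bordered_cons_le (H : IsDominated k g b) {n : ℕ} (v : ℝ) (u : Fin n → ℝ) :
    |(bordered k g (Fin.cons v u : Fin (n + 1) → ℝ) 0).det| ≤
      √(((n + 1 : ℕ) : ℝ) ^ (n + 1)) * b v * ∏ i, b (u i) ^ 2 := by
  refine (abs_det_le_of_abs_le_mul _ (a := Fin.cons 1 fun j => b (u j))
    (c := Fin.cons (b v) fun j => b (u j)) (fun j => ?_) (fun j => ?_) fun i j => ?_).trans_eq ?_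
  · refine Fin.cases ?_ (fun j => ?_) j
    · simp
    · simpa using H.nonneg _
  · refine Fin.cases ?_ (fun j => ?_) j
    · simpa using H.nonneg _
    · simpa using H.nonneg _
  · refine Fin.cases ?_ (fun i => ?_) i <;> refine Fin.cases ?_ (fun j => ?_) j
    · simpa [bordered] using H.abs_vec_le _
    · simpa [bordered] using H.abs_vec_le _
    · simpa [bordered, gram, Matrix.updateRow_apply] using H.abs_kernel_le _ _
    · simpa [bordered, gram, Matrix.updateRow_apply] using H.abs_kernel_le _ _
  · simp only [Fin.prod_univ_succ, Fin.cons_zero, Fin.cons_succ, sq, Finset.prod_mul_distrib]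
    ring

lemma measurable_kernel_apply (H : IsDominated k g b) {n : ℕ} (i j : Fin n) :
    Measurable fun u : Fin n → ℝ => k (u i) (u j) :=
  H.measurable_kernel.comp (f := fun u : Fin n → ℝ => (u i, u j))
    ((measurable_pi_apply i).prodMk (measurable_pi_apply j))

lemma measurable_det_gram (H : IsDominated k g b) (n : ℕ) :
    Measurable fun u : Fin n → ℝ => (gram k u).det :=
  measurable_det fun i j => H.measurable_kernel_apply i j

lemma measurable_det_bordered (H : IsDominated k g b) {n : ℕ} (i : Fin n) :
    Measurable fun u : Fin n → ℝ => (bordered k g u i).det := by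
  refine measurable_det fun j l => ?_
  rcases eq_or_ne j i with rfl | hj
  · have h : Measurable fun u : Fin n → ℝ => g (u l) := H.measurable_vec.comp (measurable_pi_apply l)
    simpa [bordered] using h
  · simpa [bordered, hj, gram] using H.measurable_kernel_apply j l

lemma measurable_det_bordered_cons (H : IsDominated k g b) (n : ℕ) :
    Measurable fun p : ℝ × (Fin n → ℝ) =>
      (bordered k g (Fin.cons p.1 p.2 : Fin (n + 1) → ℝ) 0).det := by
  have h : Measurable fun p : ℝ × (Fin n → ℝ) => (Fin.cons p.1 p.2 : Fin (n + 1) → ℝ) := by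
    refine measurable_pi_lambda _ fun i => ?_
    refine Fin.cases ?_ (fun i => ?_) i
    · simpa using measurable_fst
    · have h : Measurable fun p : ℝ × (Fin n → ℝ) => p.2 i :=
        (measurable_pi_apply i).comp measurable_snd
      simpa using h
  exact (H.measurable_det_bordered (0 : Fin (n + 1))).comp h

lemma integrable_det_gram (H : IsDominated k g b) (n : ℕ) :
    Integrable fun u : Fin n → ℝ => (gram k u).det :=
  ((H.integrable_prod_sq n).const_mul (√((n : ℝ) ^ n))).mono'
    (H.measurable_det_gram n).aestronglyMeasurable
    (Eventually.of_forall fun u => H.abs_det_gram_le u)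

lemma abs_fredDet_le (H : IsDominated k g b) (n : ℕ) :
    |fredDet k n| ≤ √((n : ℝ) ^ n) * (∫ v, b v ^ 2) ^ n := by
  rw [fredDet, ← integral_prod_sq, ← integral_const_mul]
  exact norm_integral_le_of_norm_le (f := fun u : Fin n → ℝ => (gram k u).det)
    ((H.integrable_prod_sq n).const_mul _) (Eventually.of_forall fun u => H.abs_det_gram_le u)

lemma abs_fredVec_le (H : IsDominated k g b) (n : ℕ) (v : ℝ) :
    |fredVec k g n v| ≤ √(((n + 1 : ℕ) : ℝ) ^ (n + 1)) * (∫ v, b v ^ 2) ^ n * b v := by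
  have e : √(((n + 1 : ℕ) : ℝ) ^ (n + 1)) * (∫ v, b v ^ 2) ^ n * b v =
      ∫ u : Fin n → ℝ, √(((n + 1 : ℕ) : ℝ) ^ (n + 1)) * b v * ∏ i, b (u i) ^ 2 := by
    rw [integral_const_mul, integral_prod_sq]; ring
  rw [e]
  exact norm_integral_le_of_norm_le ((H.integrable_prod_sq n).const_mul _)
    (f := fun u : Fin n → ℝ => (bordered k g (Fin.cons v u : Fin (n + 1) → ℝ) 0).det)
    (Eventually.of_forall fun u => H.abs_det_bordered_cons_le v u)

lemma measurable_fredVec (H : IsDominated k g b) (n : ℕ) : Measurable (fredVec k g n) :=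
  ((H.measurable_det_bordered_cons n).stronglyMeasurable.integral_prod_right).measurable

lemma memLp_fredVec (H : IsDominated k g b) (n : ℕ) : MemLp (fredVec k g n) 2 volume :=
  MemLp.of_le_mul H.memLp (H.measurable_fredVec n).aestronglyMeasurable
    (Eventually.of_forall fun v => by
      rw [Real.norm_of_nonneg (H.nonneg v)]; exact H.abs_fredVec_le n v)

lemma integrable_mul_det_bordered (H : IsDominated k g b) {n : ℕ} (i : Fin n) {θ : ℝ → ℝ} {T : ℝ}
    (hθ : Measurable θ) (hT : ∀ v, |θ v| ≤ T * b v) :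
    Integrable fun u : Fin n → ℝ => θ (u i) * (bordered k g u i).det := by
  refine ((H.integrable_prod_sq n).const_mul (|T| * √((n : ℝ) ^ n))).mono'
    ((hθ.comp (measurable_pi_apply i)).mul (H.measurable_det_bordered i)).aestronglyMeasurable
    (Eventually.of_forall fun u => ?_)
  rw [norm_mul]
  calc _ ≤ (|T| * b (u i)) * |(bordered k g u i).det| := by
        refine mul_le_mul_of_nonneg_right ((hT _).trans ?_) (abs_nonneg _)
        exact mul_le_mul_of_nonneg_right (le_abs_self T) (H.nonneg _)
    _ = |T| * (b (u i) * |(bordered k g u i).det|) := by ring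
    _ ≤ |T| * (√((n : ℝ) ^ n) * ∏ j, b (u j) ^ 2) := by
        exact mul_le_mul_of_nonneg_left (H.abs_det_bordered_le u i) (abs_nonneg T)
    _ = _ := by ring

/-- By symmetry every row may be moved to the first place. -/
lemma integral_mul_det_bordered (H : IsDominated k g b) {n : ℕ} (i : Fin (n + 1)) {θ : ℝ → ℝ}
    {T : ℝ} (hθ : Measurable θ) (hT : ∀ v, |θ v| ≤ T * b v) :
    ∫ u : Fin (n + 1) → ℝ, θ (u i) * (bordered k g u i).det = ∫ v, θ v * fredVec k g n v := by
  have h0 := H.integrable_mul_det_bordered (0 : Fin (n + 1)) hθ hT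
  -- Exchanging the variables 0 and i permutes rows and columns simultaneously, which leaves the
  -- determinant unchanged.
  have hswap : ∫ u : Fin (n + 1) → ℝ, θ (u i) * (bordered k g u i).det =
      ∫ u : Fin (n + 1) → ℝ, θ (u 0) * (bordered k g u 0).det := by
    rw [← integral_comp_perm (Equiv.swap 0 i)]
    congr 1; funext u
    rw [det_bordered_comp_perm]; simp
  have hmp := (volume_preserving_piFinSuccAbove (fun _ : Fin (n + 1) => ℝ) 0).symm
  have hi := hmp.integrable_comp_of_integrable h0
  have e := integral_prod _ hi
  rw [hswap, ← hmp.integral_comp', Measure.volume_eq_prod]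
  refine e.trans ?_
  congr 1; funext v
  rw [fredVec, ← integral_const_mul]
  congr 1; funext u
  have hc : (MeasurableEquiv.piFinSuccAbove (fun _ : Fin (n + 1) => ℝ) 0).symm (v, u) =
      (Fin.cons v u : Fin (n + 1) → ℝ) := by
    rw [← Fin.insertNth_zero']; rfl
  rw [Function.comp_apply, hc, Fin.cons_zero]

/-- The recursion between the Fredholm coefficients. -/
lemma fredVec_succ (H : IsDominated k g b) (n : ℕ) (v : ℝ) :
    fredVec k g (n + 1) v =
      g v * fredDet k (n + 1) - (n + 1) * ∫ w, k v w * fredVec k g n w := by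
  have hm : Measurable fun w => k w v := H.measurable_kernel.comp measurable_prodMk_right
  have hb : ∀ w, |k w v| ≤ b v * b w := fun w => by rw [mul_comm]; exact H.abs_kernel_le w v
  have hi := fun i : Fin (n + 1) => H.integrable_mul_det_bordered i hm hb
  rw [fredVec]
  simp only [det_bordered_cons]
  rw [integral_sub ((H.integrable_det_gram _).const_mul _) (integrable_finsetSum _ fun i _ => hi i),
    integral_const_mul, integral_finsetSum _ fun i _ => hi i]
  simp only [H.integral_mul_det_bordered _ hm hb, fredDet]
  simp [H.symm v]

lemma fredVec_zero (k : ℝ → ℝ → ℝ) (g : ℝ → ℝ) (v : ℝ) : fredVec k g 0 v = g v := by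
  rw [fredVec]
  simp only [det_bordered_cons]
  simp [gram, Measure.volume_pi_eq_dirac (default : Fin 0 → ℝ)]

end IsDominated


/-! ### Differentiation of the Fredholm determinant -/

lemma det_updateRow_eq_sum {n : ℕ} (M : Matrix (Fin n) (Fin n) ℝ) (i : Fin n) (r : Fin n → ℝ) :
    (M.updateRow i r).det = ∑ π : Equiv.Perm (Fin n),
      (Equiv.Perm.sign π : ℝ) * ((∏ j ∈ Finset.univ.erase i, M j (π j)) * r (π i)) := by
  rw [← Matrix.det_transpose, Matrix.det_apply']
  refine Finset.sum_congr rfl fun π _ => ?_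
  congr 1
  rw [← Finset.prod_erase_mul _ _ (Finset.mem_univ i)]
  simp only [Matrix.transpose_apply, Matrix.updateRow_self]
  congr 1
  refine Finset.prod_congr rfl fun j hj => ?_
  rw [Matrix.updateRow_ne (Finset.ne_of_mem_erase hj)]

lemma hasDerivAt_det {n : ℕ} {M : ℝ → Matrix (Fin n) (Fin n) ℝ} {M' : Matrix (Fin n) (Fin n) ℝ}
    {τ : ℝ} (h : ∀ i j, HasDerivAt (fun s => M s i j) (M' i j) τ) :
    HasDerivAt (fun s => (M s).det) (∑ i, ((M τ).updateRow i (M' i)).det) τ := by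
  have e : (fun s => (M s).det) = fun s => ∑ π : Equiv.Perm (Fin n),
      (Equiv.Perm.sign π : ℝ) * ∏ i, M s i (π i) := by
    funext s
    rw [← Matrix.det_transpose, Matrix.det_apply']
    rfl
  rw [e]
  have h1 := HasDerivAt.fun_sum (u := Finset.univ) fun (π : Equiv.Perm (Fin n)) _ =>
    (HasDerivAt.fun_finsetProd (u := Finset.univ) fun i _ => h i (π i)).const_mul
      (Equiv.Perm.sign π : ℝ)
  refine h1.congr_deriv ?_
  simp only [det_updateRow_eq_sum, smul_eq_mul, Finset.mul_sum]
  exact Finset.sum_comm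

/-- `n^{n/2} Nⁿ / n!` is summable, with a shifted numerator. -/
lemma summable_hadamard (N : ℝ) (hN : 0 ≤ N) :
    Summable fun n : ℕ => √(((n + 1 : ℕ) : ℝ) ^ (n + 1)) * N ^ n / n.factorial := by
  -- By m^m ≤ e^m m! and n + 1 ≤ 4^n, the root is at most √e (2√e)^n √n!, so the terms are bounded
  -- by √e x^n / √n!.
  set x := 2 * Real.exp (1 / 2) * N with hx
  have hx0 : 0 ≤ x := by positivity
  have hs : Summable fun n : ℕ => Real.exp (1 / 2) *
      ((2 * x ^ 2) ^ n / n.factorial + (1 / 2 : ℝ) ^ n) :=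
    ((Real.summable_pow_div_factorial _).add (summable_geometric_of_lt_one (by norm_num)
      (by norm_num))).mul_left _
  refine Summable.of_nonneg_of_le (fun n => by positivity) (fun n => ?_) hs
  have hf : (0 : ℝ) < n.factorial := by positivity
  have h1 : (((n + 1 : ℕ) : ℝ) ^ (n + 1)) ≤ Real.exp 1 ^ (n + 1) * (n + 1).factorial := by
    have := Real.pow_div_factorial_le_exp ((n + 1 : ℕ) : ℝ) (by positivity) (n + 1)
    rw [div_le_iff₀ (by positivity)] at this
    refine this.trans_eq ?_
    rw [← Real.exp_nat_mul, mul_one]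
  have h2 : ((n + 1).factorial : ℝ) ≤ 4 ^ n * n.factorial := by
    rw [Nat.factorial_succ]
    push_cast
    gcongr
    have : n + 1 ≤ 4 ^ n := Nat.lt_pow_self (by norm_num)
    exact_mod_cast this
  have he : Real.exp (1 / 2) ^ 2 = Real.exp 1 := by rw [← Real.exp_nat_mul]; norm_num
  have hsq : √(n.factorial : ℝ) ^ 2 = n.factorial := Real.sq_sqrt hf.le
  have h3 : √(((n + 1 : ℕ) : ℝ) ^ (n + 1)) ≤
      Real.exp (1 / 2) * ((2 * Real.exp (1 / 2)) ^ n * √n.factorial) := by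
    refine Real.sqrt_le_iff.2 ⟨by positivity, h1.trans ?_⟩
    calc _ ≤ Real.exp 1 ^ (n + 1) * (4 ^ n * n.factorial) := by gcongr
      _ = Real.exp (1 / 2) ^ 2 * ((4 * Real.exp (1 / 2) ^ 2) ^ n * √(n.factorial : ℝ) ^ 2) := by
          rw [he, hsq, mul_pow, pow_succ]; ring
      _ = _ := by
          rw [mul_pow 4, show (4 : ℝ) ^ n = 2 ^ (n * 2) by rw [mul_comm, pow_mul]; norm_num]; ring
  -- The left side is the geometric mean of (2x²)^n / n! and 2^(-n), both of which are summable.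
  have h4 : x ^ n / √n.factorial ≤ (2 * x ^ 2) ^ n / n.factorial + (1 / 2 : ℝ) ^ n := by
    have hA : 0 ≤ (2 * x ^ 2) ^ n / (n.factorial : ℝ) := by positivity
    have hB : 0 ≤ (1 / 2 : ℝ) ^ n := by positivity
    have hAB : (x ^ n / √n.factorial) ^ 2 =
        (2 * x ^ 2) ^ n / (n.factorial : ℝ) * (1 / 2 : ℝ) ^ n := by
      rw [div_pow, hsq, div_mul_eq_mul_div, ← mul_pow, ← pow_mul, mul_comm n 2, pow_mul]
      congr 2; ring
    refine (le_abs_self _).trans (abs_le_of_sq_le_sq ?_ (by positivity))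
    rw [hAB]; nlinarith
  calc _ ≤ Real.exp (1 / 2) * ((2 * Real.exp (1 / 2)) ^ n * √n.factorial) * N ^ n /
        n.factorial := by gcongr
    _ = Real.exp (1 / 2) * (x ^ n * (√n.factorial / n.factorial)) := by
        rw [hx, mul_pow (2 * Real.exp (1 / 2))]; ring
    _ = Real.exp (1 / 2) * (x ^ n / √n.factorial) := by
        rw [Real.sqrt_div_self, div_eq_mul_inv (x ^ n)]
    _ ≤ _ := by gcongr

/-! ### The determinant series of the shifted kernel. -/

lemma exists_isDominated {σ : ℝ → ℝ} (hσ : IsSymbol σ) (T : ℝ) :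
    ∃ b : ℝ → ℝ, ∀ τ : ℝ, |τ| ≤ T → IsDominated (kerFun σ τ) (airyVec σ τ) b := by
  obtain ⟨B, hB, h⟩ := exists_vec_bounds hσ T
  obtain ⟨B', hB', h'⟩ := exists_abs_kerFun_le hσ T
  refine ⟨fun v => max B B' * weight σ v, fun τ hτ => ⟨kerFun_comm σ τ, measurable_kerFun hσ τ,
    measurable_airyVec hσ τ, fun v w => (h' τ hτ v w).trans ?_, fun v => (h τ hτ v).1.trans ?_,
    hσ.memLp_weight.const_mul _⟩⟩
  · have h1 := weight_nonneg σ v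
    have h2 := weight_nonneg σ w
    gcongr <;> exact le_max_right _ _
  · have h1 := weight_nonneg σ v
    gcongr; exact le_max_left _ _

lemma hasDerivAt_kerFun (σ : ℝ → ℝ) (v w τ : ℝ) :
    HasDerivAt (fun τ => kerFun σ τ v w) (airyVec σ τ v * airyVec σ τ w) τ := by
  refine (((hasDerivAt_airyKernel_shift v w τ).const_mul (√(σ v))).mul_const (√(σ w))).congr_deriv ?_
  rw [airyVec, airyVec]; ring

/-- The derivative of the kernel has rank one, so differentiating row i replaces it by a multiple of
g: a bordered determinant with prefactor g(u i). By symmetry all n + 1 rows contribute equally. -/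
lemma hasDerivAt_fredDet {σ : ℝ → ℝ} (hσ : IsSymbol σ) (n : ℕ) (τ : ℝ) :
    HasDerivAt (fun τ => fredDet (kerFun σ τ) (n + 1))
      ((n + 1) * ∫ v, airyVec σ τ v * fredVec (kerFun σ τ) (airyVec σ τ) n v) τ := by
  obtain ⟨b, hb⟩ := exists_isDominated hσ (|τ| + 1)
  have Hτ := hb τ (by linarith)
  have habs : ∀ s, |s| ≤ |τ| + 1 → ∀ v, |airyVec σ s v| ≤ 1 * b v := fun s hs v => by
    rw [one_mul]; exact (hb s hs).abs_vec_le v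
  have hd : ∀ s (u : Fin (n + 1) → ℝ), HasDerivAt (fun s => (gram (kerFun σ s) u).det)
      (∑ i, airyVec σ s (u i) * (bordered (kerFun σ s) (airyVec σ s) u i).det) s := by
    intro s u
    refine (hasDerivAt_det (M := fun s => gram (kerFun σ s) u)
      (M' := Matrix.of fun i j => airyVec σ s (u i) * airyVec σ s (u j))
      fun i j => hasDerivAt_kerFun σ (u i) (u j) s).congr_deriv ?_
    refine Finset.sum_congr rfl fun i _ => ?_
    rw [bordered, ← Matrix.det_updateRow_smul]
    rfl
  have hi := fun i : Fin (n + 1) => Hτ.integrable_mul_det_bordered i Hτ.measurable_vec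
    (habs τ (by linarith))
  have key := hasDerivAt_integral_of_dominated_loc_of_deriv_le (𝕜 := ℝ) (μ := volume)
    (F := fun s (u : Fin (n + 1) → ℝ) => (gram (kerFun σ s) u).det) (x₀ := τ)
    (s := Metric.ball τ 1)
    (F' := fun s u => ∑ i, airyVec σ s (u i) * (bordered (kerFun σ s) (airyVec σ s) u i).det)
    (bound := fun u => ∑ _i : Fin (n + 1), √(((n + 1 : ℕ) : ℝ) ^ (n + 1)) * ∏ j, b (u j) ^ 2)
    (Metric.ball_mem_nhds τ one_pos)
    (by
      filter_upwards [Metric.ball_mem_nhds τ one_pos] with s hs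
      exact ((hb s (abs_le_add_one_of_mem_ball hs)).measurable_det_gram _).aestronglyMeasurable)
    (Hτ.integrable_det_gram _)
    (integrable_finsetSum _ fun i _ => hi i).aestronglyMeasurable
    (Eventually.of_forall fun u s hs => by
      have H := hb s (abs_le_add_one_of_mem_ball hs)
      refine (norm_sum_le _ _).trans (Finset.sum_le_sum fun i _ => ?_)
      rw [norm_mul]
      exact (mul_le_mul_of_nonneg_right (H.abs_vec_le _) (abs_nonneg _)).trans
        (H.abs_det_bordered_le u i))
    (integrable_finsetSum _ fun i _ => (Hτ.integrable_prod_sq _).const_mul _)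
    (Eventually.of_forall fun u s _ => hd s u)
  refine key.2.congr_deriv ?_
  rw [integral_finsetSum _ fun i _ => hi i]
  simp only [Hτ.integral_mul_det_bordered _ Hτ.measurable_vec (habs τ (by linarith))]
  simp

/-- The terms of the Fredholm determinant. -/
def fredTerm (σ : ℝ → ℝ) (τ : ℝ) (n : ℕ) : ℝ :=
  (-1) ^ n / (n.factorial : ℝ) * fredDet (kerFun σ τ) n

/-- The terms of the series for `det(1 - K) (1 - K)⁻¹ g`. -/
def fredL2 (σ : ℝ → ℝ) (τ : ℝ) (n : ℕ) : L2R :=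
  ((-1) ^ n / (n.factorial : ℝ)) • toL2 (fredVec (kerFun σ τ) (airyVec σ τ) n)

/-- The Fredholm determinant as a function of the shift. -/
def fredSum (σ : ℝ → ℝ) (τ : ℝ) : ℝ := ∑' n, fredTerm σ τ n

lemma fredTerm_zero (σ : ℝ → ℝ) (τ : ℝ) : fredTerm σ τ 0 = 1 := by
  simp [fredTerm, fredDet, Measure.volume_pi_eq_dirac (default : Fin 0 → ℝ)]

lemma fredL2_zero (σ : ℝ → ℝ) (τ : ℝ) : fredL2 σ τ 0 = airyL2 σ τ := by
  have : fredVec (kerFun σ τ) (airyVec σ τ) 0 = airyVec σ τ :=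
    funext (IsDominated.fredVec_zero _ _)
  simp [fredL2, this, airyL2]

/-- Fredholm's recursion in L²: the alternating sign and 1/(n + 1)! absorb the coefficient n + 1 of
`fredVec_succ`. Summed over n, it says that (1 - K) applied to the series is det(1 - K) g. -/
lemma fredL2_succ {σ : ℝ → ℝ} (hσ : IsSymbol σ) (τ : ℝ) (n : ℕ) :
    fredL2 σ τ (n + 1) = fredTerm σ τ (n + 1) • airyL2 σ τ + airyOp σ τ (fredL2 σ τ n) := by
  obtain ⟨b, hb⟩ := exists_isDominated hσ |τ|
  have H := hb τ le_rfl
  have hn : (0 : ℝ) < (n.factorial : ℝ) := by positivity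
  rw [fredL2, fredL2, map_smul]
  refine Lp.ext ?_
  filter_upwards [Lp.coeFn_smul ((-1) ^ (n + 1) / ((n + 1).factorial : ℝ))
      (toL2 (fredVec (kerFun σ τ) (airyVec σ τ) (n + 1))),
    Lp.coeFn_add (fredTerm σ τ (n + 1) • airyL2 σ τ) (((-1) ^ n / (n.factorial : ℝ)) •
      airyOp σ τ (toL2 (fredVec (kerFun σ τ) (airyVec σ τ) n))),
    Lp.coeFn_smul (fredTerm σ τ (n + 1)) (airyL2 σ τ),
    Lp.coeFn_smul ((-1) ^ n / (n.factorial : ℝ))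
      (airyOp σ τ (toL2 (fredVec (kerFun σ τ) (airyVec σ τ) n))),
    coeFn_toL2 (H.memLp_fredVec (n + 1)), coeFn_toL2 (memLp_airyVec hσ τ),
    coeFn_airyOp hσ τ (toL2 (fredVec (kerFun σ τ) (airyVec σ τ) n))] with v h1 h2 h3 h4 h5 h6 h7
  have h8 : ∫ w, kerFun σ τ v w * (toL2 (fredVec (kerFun σ τ) (airyVec σ τ) n)) w =
      ∫ w, kerFun σ τ v w * fredVec (kerFun σ τ) (airyVec σ τ) n w := by
    refine integral_congr_ae ?_
    filter_upwards [coeFn_toL2 (H.memLp_fredVec n)] with w hw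
    rw [hw]
  have h6' : airyL2 σ τ v = airyVec σ τ v := h6
  rw [h1, h2, Pi.smul_apply, Pi.add_apply, h3, h4, Pi.smul_apply, Pi.smul_apply, h5, h6', h7,
    opFun_eq_integral hσ, h8, H.fredVec_succ, fredTerm, Nat.factorial_succ]
  simp only [smul_eq_mul]
  push_cast
  field_simp
  ring

lemma norm_fredL2_le {k : ℝ → ℝ → ℝ} {g b : ℝ → ℝ} (H : IsDominated k g b) (n : ℕ) :
    ‖((-1) ^ n / (n.factorial : ℝ)) • toL2 (fredVec k g n)‖ ≤
      √(((n + 1 : ℕ) : ℝ) ^ (n + 1)) * (∫ v, b v ^ 2) ^ n / n.factorial * ‖toL2 b‖ := by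
  have hN : 0 ≤ ∫ v, b v ^ 2 := integral_nonneg fun v => sq_nonneg _
  have h := norm_toL2_le (H.memLp_fredVec n) H.memLp (by positivity) (H.abs_fredVec_le n)
  rw [norm_smul, norm_div, norm_pow, norm_neg, norm_one, one_pow, Real.norm_natCast]
  calc _ ≤ 1 / (n.factorial : ℝ) * _ := mul_le_mul_of_nonneg_left h (by positivity)
    _ = _ := by ring

lemma abs_fredTerm_le {σ : ℝ → ℝ} {g b : ℝ → ℝ} {τ : ℝ} (H : IsDominated (kerFun σ τ) g b)
    (n : ℕ) : |fredTerm σ τ n| ≤ √((n : ℝ) ^ n) * (∫ v, b v ^ 2) ^ n / n.factorial := by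
  rw [fredTerm, abs_mul, abs_div, abs_pow, abs_neg, abs_one, one_pow, Nat.abs_cast]
  calc _ ≤ 1 / (n.factorial : ℝ) * _ := mul_le_mul_of_nonneg_left (H.abs_fredDet_le n) (by positivity)
    _ = _ := by ring

lemma sqrt_pow_self_le (n : ℕ) : √((n : ℝ) ^ n) ≤ √(((n + 1 : ℕ) : ℝ) ^ (n + 1)) := by
  refine Real.sqrt_le_sqrt ?_
  rw [pow_succ]
  push_cast
  have h1 : (n : ℝ) ^ n ≤ ((n : ℝ) + 1) ^ n := by gcongr; linarith
  have h2 : (0 : ℝ) ≤ ((n : ℝ) + 1) ^ n := by positivity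
  nlinarith [Nat.cast_nonneg (α := ℝ) n]

lemma summable_fredTerm {σ : ℝ → ℝ} (hσ : IsSymbol σ) (τ : ℝ) : Summable (fredTerm σ τ) := by
  obtain ⟨b, hb⟩ := exists_isDominated hσ |τ|
  have H := hb τ le_rfl
  have hN : 0 ≤ ∫ v, b v ^ 2 := integral_nonneg fun v => sq_nonneg _
  refine Summable.of_norm_bounded (summable_hadamard _ hN) fun n => (abs_fredTerm_le H n).trans ?_
  have := sqrt_pow_self_le n
  refine div_le_div_of_nonneg_right (mul_le_mul_of_nonneg_right this (by positivity)) (by positivity)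

lemma summable_fredL2 {σ : ℝ → ℝ} (hσ : IsSymbol σ) (τ : ℝ) : Summable (fredL2 σ τ) := by
  obtain ⟨b, hb⟩ := exists_isDominated hσ |τ|
  have H := hb τ le_rfl
  have hN : 0 ≤ ∫ v, b v ^ 2 := integral_nonneg fun v => sq_nonneg _
  exact Summable.of_norm_bounded ((summable_hadamard _ hN).mul_right ‖toL2 b‖) (norm_fredL2_le H)

/-- Fredholm's formula for the resolvent. -/
lemma tsum_fredL2 {σ : ℝ → ℝ} (hσ : IsSymbol σ) (τ : ℝ) :
    ∑' n, fredL2 σ τ n = fredSum σ τ • waveL2 σ τ := by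
  have hs := summable_fredL2 hσ τ
  have ht := summable_fredTerm hσ τ
  have h1 : ∑' n, fredL2 σ τ n - airyOp σ τ (∑' n, fredL2 σ τ n) = fredSum σ τ • airyL2 σ τ := by
    rw [sub_eq_iff_eq_add, fredSum, hs.tsum_eq_zero_add, ht.tsum_eq_zero_add, fredL2_zero,
      fredTerm_zero, add_smul, one_smul, add_assoc]
    congr 1
    have hK : Summable fun n => airyOp σ τ (fredL2 σ τ n) := hs.map (airyOp σ τ) (by fun_prop)
    have ht' : Summable fun n => fredTerm σ τ (n + 1) := (summable_nat_add_iff 1).2 ht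
    rw [← fredL2_zero, ← hs.tsum_eq_zero_add, (airyOp σ τ).map_tsum hs, fredL2_zero,
      ← ht'.tsum_smul_const, ← (ht'.smul_const (airyL2 σ τ)).tsum_add hK]
    simp only [fredL2_succ hσ]
  rw [← airyRes_eq_of_sub hσ τ h1, map_smul, waveL2]

/-- The logarithmic derivative of the Fredholm determinant. -/
lemma hasDerivAt_fredSum {σ : ℝ → ℝ} (hσ : IsSymbol σ) (τ : ℝ) :
    HasDerivAt (fredSum σ) (-(waveQ σ τ) * fredSum σ τ) τ := by
  obtain ⟨b, hb⟩ := exists_isDominated hσ (|τ| + 1)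
  have Hτ := hb τ (by linarith)
  have hN : 0 ≤ ∫ v, b v ^ 2 := integral_nonneg fun v => sq_nonneg _
  have hd : ∀ (n : ℕ) (s : ℝ), HasDerivAt (fun s => fredTerm σ s (n + 1))
      (-inner ℝ (airyL2 σ s) (fredL2 σ s n)) s := by
    intro n s
    refine ((hasDerivAt_fredDet hσ n s).const_mul
      ((-1) ^ (n + 1) / ((n + 1).factorial : ℝ))).congr_deriv ?_
    obtain ⟨b', hb'⟩ := exists_isDominated hσ |s|
    have H := hb' s le_rfl
    rw [fredL2, real_inner_smul_right, airyL2,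
      inner_toL2_toL2 (memLp_airyVec hσ s) (H.memLp_fredVec n), Nat.factorial_succ]
    have hn : (0 : ℝ) < (n.factorial : ℝ) := by positivity
    push_cast
    field_simp
    ring
  have key := hasDerivAt_tsum_of_isPreconnected (𝕜 := ℝ) (t := Metric.ball τ 1)
    (u := fun n : ℕ => ‖toL2 b‖ * (√(((n + 1 : ℕ) : ℝ) ^ (n + 1)) * (∫ v, b v ^ 2) ^ n /
      n.factorial * ‖toL2 b‖))
    (g := fun n s => fredTerm σ s (n + 1))
    (g' := fun n s => -inner ℝ (airyL2 σ s) (fredL2 σ s n))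
    (y₀ := τ) (y := τ)
    (((summable_hadamard _ hN).mul_right ‖toL2 b‖).mul_left _) Metric.isOpen_ball
    (convex_ball τ 1).isPreconnected (fun n s _ => hd n s)
    (fun n s hs => by
      have H := hb s (abs_le_add_one_of_mem_ball hs)
      rw [norm_neg]
      refine (norm_inner_le_norm _ _).trans (mul_le_mul ?_ (norm_fredL2_le H n) (norm_nonneg _)
        (norm_nonneg _))
      have := norm_toL2_le (memLp_airyVec hσ s) H.memLp zero_le_one fun v => by
        rw [one_mul]; exact H.abs_vec_le v
      rwa [one_mul] at this)
    (Metric.mem_ball_self one_pos) ((summable_nat_add_iff 1).2 (summable_fredTerm hσ τ))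
    (Metric.mem_ball_self one_pos)
  -- The term of index 0 is the constant 1, so only the shifted series is differentiated; its
  -- derivatives are bounded uniformly on the unit ball around τ.
  have hfun : fredSum σ = fun s => 1 + ∑' n, fredTerm σ s (n + 1) := by
    funext s
    rw [fredSum, (summable_fredTerm hσ s).tsum_eq_zero_add, fredTerm_zero]
  have hin := (innerSL ℝ (airyL2 σ τ)).map_tsum (summable_fredL2 hσ τ)
  simp only [innerSL_apply_apply] at hin
  refine ((key.const_add 1).congr_deriv ?_).congr_of_eventuallyEq
    (Eventually.of_forall fun s => congrFun hfun s)
  rw [tsum_neg, ← hin, tsum_fredL2 hσ, real_inner_smul_right, waveQ]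
  ring


/-! ### Positivity of the Fredholm determinant -/

/-- The dominating function `√(σ(v) K(v - τ, v - τ))`. -/
def diagWeight (σ : ℝ → ℝ) (τ v : ℝ) : ℝ := √(σ v) * √(airyKernel (v - τ) (v - τ))

/-- Unlike the bound by `weight`, this one shrinks with τ: its squared L² norm is the trace of the
operator. Only determinants are estimated with it, so the vector is taken to be 0. -/
lemma isDominated_diagWeight {σ : ℝ → ℝ} (hσ : IsSymbol σ) (τ : ℝ) :
    IsDominated (kerFun σ τ) (fun _ => 0) (diagWeight σ τ) := by
  obtain ⟨B, hB, h⟩ := exists_vec_bounds hσ |τ|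
  have hm : Measurable (diagWeight σ τ) := hσ.measurable.sqrt.mul (continuous_airyKernel.comp
    (by fun_prop : Continuous fun v : ℝ => (v - τ, v - τ))).sqrt.measurable
  have h0 : ∀ v, 0 ≤ diagWeight σ τ v := fun v => by unfold diagWeight; positivity
  refine ⟨kerFun_comm σ τ, measurable_kerFun hσ τ, measurable_const, fun v w => ?_,
    fun v => by simpa using h0 v, ?_⟩
  · rw [kerFun, abs_mul, abs_mul, abs_of_nonneg (Real.sqrt_nonneg _),
      abs_of_nonneg (Real.sqrt_nonneg _)]
    calc _ ≤ √(σ v) * (√(airyKernel (v - τ) (v - τ)) * √(airyKernel (w - τ) (w - τ))) * √(σ w) := by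
          gcongr; exact abs_airyKernel_le _ _
      _ = _ := by rw [diagWeight, diagWeight]; ring
  · refine MemLp.of_le_mul (c := B) hσ.memLp_weight hm.aestronglyMeasurable
      (Eventually.of_forall fun v => ?_)
    rw [Real.norm_of_nonneg (h0 v), Real.norm_of_nonneg (weight_nonneg σ v)]
    exact (h τ le_rfl v).2.2.2

lemma diagWeight_sq {σ : ℝ → ℝ} (hσ : IsSymbol σ) (τ v : ℝ) :
    diagWeight σ τ v ^ 2 = σ v * airyKernel (v - τ) (v - τ) := by
  rw [diagWeight, mul_pow, Real.sq_sqrt (hσ.nonneg v), Real.sq_sqrt (airyKernel_self_nonneg _)]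

lemma monotone_airyKernel_shift (v : ℝ) : Monotone fun τ => airyKernel (v - τ) (v - τ) :=
  monotone_of_hasDerivAt_nonneg (fun τ => hasDerivAt_airyKernel_shift v v τ)
    fun _ => mul_self_nonneg _

lemma tendsto_airyKernel_self_atTop : Tendsto (fun u => airyKernel u u) atTop (𝓝 0) := by
  obtain ⟨C, hC, h⟩ := exists_airy_le_envelope
  have h1 : Tendsto (fun u : ℝ => C * (2 * Real.exp (-(1 / 2) * u))) atTop (𝓝 0) := by
    have h2 : Tendsto (fun u : ℝ => -(1 / 2) * u) atTop atBot :=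
      tendsto_id.const_mul_atTop_of_neg (by norm_num)
    simpa using ((Real.tendsto_exp_atBot.comp h2).const_mul 2).const_mul C
  refine squeeze_zero' (Eventually.of_forall airyKernel_self_nonneg) ?_ h1
  filter_upwards [eventually_ge_atTop 0] with u hu
  refine (h u).1.trans ?_
  gcongr
  rw [envelope, abs_of_nonneg hu, max_eq_left hu]
  have h2 : √(1 + u) ≤ 2 * Real.exp (1 / 2 * u) := by
    rw [Real.sqrt_le_left (by positivity)]
    nlinarith [Real.add_one_le_exp (1 / 2 * u), sq_nonneg u]
  calc _ ≤ 2 * Real.exp (1 / 2 * u) * Real.exp (-u) := by gcongr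
    _ = _ := by rw [mul_assoc, ← Real.exp_add]; ring_nf

/-- K(v - τ, v - τ) increases with τ, so the case τ = 0 dominates, and the kernel decays at +∞. -/
lemma tendsto_integral_diagWeight {σ : ℝ → ℝ} (hσ : IsSymbol σ) :
    Tendsto (fun τ => ∫ v, diagWeight σ τ v ^ 2) atBot (𝓝 0) := by
  have h0 : (0 : ℝ) = ∫ _ : ℝ, (0 : ℝ) := by simp
  rw [h0]
  refine tendsto_integral_filter_of_dominated_convergence (fun v => diagWeight σ 0 v ^ 2)
    (Eventually.of_forall fun τ => (isDominated_diagWeight hσ τ).memLp.aestronglyMeasurable.pow 2)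
    ?_ (isDominated_diagWeight hσ 0).integrable_sq (Eventually.of_forall fun v => ?_)
  · filter_upwards [eventually_le_atBot 0] with τ hτ
    refine Eventually.of_forall fun v => ?_
    rw [Real.norm_of_nonneg (sq_nonneg _), diagWeight_sq hσ, diagWeight_sq hσ]
    exact mul_le_mul_of_nonneg_left (monotone_airyKernel_shift v hτ) (hσ.nonneg v)
  · simp only [diagWeight_sq hσ]
    have h1 : Tendsto (fun τ : ℝ => v - τ) atBot atTop :=
      tendsto_atTop_add_const_left _ v tendsto_neg_atBot_atTop
    simpa using (tendsto_airyKernel_self_atTop.comp h1).const_mul (σ v)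

/-- When the trace N is small, all terms after the first sum to at most N S < 1, with S the Hadamard
series at 1. -/
lemma exists_fredSum_pos {σ : ℝ → ℝ} (hσ : IsSymbol σ) : ∃ τ, 0 < fredSum σ τ := by
  set S := ∑' n : ℕ, √(((n + 1 : ℕ) : ℝ) ^ (n + 1)) * (1 : ℝ) ^ n / n.factorial with hS
  have hsum := summable_hadamard 1 zero_le_one
  have hS0 : 0 ≤ S := tsum_nonneg fun n => by positivity
  obtain ⟨τ, hτ⟩ := ((tendsto_integral_diagWeight hσ).eventually_lt_const
    (show (0 : ℝ) < 1 / (S + 1) by positivity)).exists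
  refine ⟨τ, ?_⟩
  have H := isDominated_diagWeight hσ τ
  set N := ∫ v, diagWeight σ τ v ^ 2 with hN
  have hN0 : 0 ≤ N := integral_nonneg fun v => sq_nonneg _
  have hNS : N * (S + 1) < 1 := (lt_div_iff₀ (by positivity)).1 hτ
  have hN1 : N ≤ 1 := by nlinarith
  have hb : ∀ n : ℕ, ‖fredTerm σ τ (n + 1)‖ ≤
      N * (√(((n + 1 : ℕ) : ℝ) ^ (n + 1)) * (1 : ℝ) ^ n / n.factorial) := fun n => by
    refine (abs_fredTerm_le H (n + 1)).trans ?_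
    have h1 : N ^ (n + 1) ≤ N * 1 := by
      rw [pow_succ']; exact mul_le_mul_of_nonneg_left (pow_le_one₀ hN0 hN1) hN0
    have h2 : (n.factorial : ℝ) ≤ (n + 1).factorial := by
      exact_mod_cast Nat.factorial_le (Nat.le_succ n)
    calc _ ≤ √(((n + 1 : ℕ) : ℝ) ^ (n + 1)) * (N * 1) / n.factorial :=
          div_le_div₀ (by positivity) (mul_le_mul_of_nonneg_left h1 (by positivity))
            (by positivity) h2
      _ = _ := by rw [one_pow]; ring
  have h3 := tsum_of_norm_bounded (hsum.mul_left N).hasSum hb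
  rw [tsum_mul_left, ← hS, Real.norm_eq_abs] at h3
  rw [fredSum, (summable_fredTerm hσ τ).tsum_eq_zero_add, fredTerm_zero]
  have := (abs_le.1 h3).1
  linarith

lemma continuous_waveQ {σ : ℝ → ℝ} (hσ : IsSymbol σ) : Continuous (waveQ σ) :=
  continuous_iff_continuousAt.2 fun τ => (hasDerivAt_waveQ hσ τ).continuousAt

/-- The determinant solves the linear equation D' = -qD, so D exp(∫ q) is constant and D has the
sign it has at one point. -/
lemma fredSum_pos {σ : ℝ → ℝ} (hσ : IsSymbol σ) (τ : ℝ) : 0 < fredSum σ τ := by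
  have hq := continuous_waveQ hσ
  set P : ℝ → ℝ := fun τ => fredSum σ τ * Real.exp (∫ s in (0 : ℝ)..τ, waveQ σ s) with hP
  have hd : ∀ τ, HasDerivAt P 0 τ := fun τ => by
    have h1 := (intervalIntegral.integral_hasDerivAt_right (hq.intervalIntegrable 0 τ)
      (hq.stronglyMeasurableAtFilter _ _) hq.continuousAt).exp
    refine ((hasDerivAt_fredSum hσ τ).fun_mul h1).congr_deriv ?_
    ring
  have hconst : ∀ a b, P a = P b := is_const_of_deriv_eq_zero
    (fun τ => (hd τ).differentiableAt) fun τ => (hd τ).deriv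
  obtain ⟨τ₀, h0⟩ := exists_fredSum_pos hσ
  have h1 : 0 < P τ := by
    rw [hconst τ τ₀]; exact mul_pos h0 (Real.exp_pos _)
  exact pos_of_mul_pos_left h1 (Real.exp_pos _).le

/-- The first derivative of the logarithm of the Fredholm determinant. -/
lemma hasDerivAt_log_fredSum {σ : ℝ → ℝ} (hσ : IsSymbol σ) (τ : ℝ) :
    HasDerivAt (fun τ => Real.log (fredSum σ τ)) (-waveQ σ τ) τ := by
  have h := fredSum_pos hσ τ
  refine ((hasDerivAt_fredSum hσ τ).log h.ne').congr_deriv ?_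
  field_simp


/-! ### Rescaling of the symbol -/

/-- The symbol in the variable `v = t^{2/3} r`. -/
def scaled (σ : ℝ → ℝ) (t v : ℝ) : ℝ := σ (t ^ (-(2 / 3) : ℝ) * v)

/-- The identity t^(-2/3) t^(-1/3) = 1/t makes x a pure translation of u: the symbol depends on x
only through u + τ. -/
lemma symbol_eq_scaled (σ : ℝ → ℝ) (x : ℝ) {t : ℝ} (ht : 0 < t) (u : ℝ) :
    symbol σ x t u = scaled σ t (u + t ^ (-(1 / 3) : ℝ) * x) := by
  have h : t ^ (-(2 / 3) : ℝ) * t ^ (-(1 / 3) : ℝ) = t⁻¹ := by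
    rw [← Real.rpow_add ht, ← Real.rpow_neg_one]; norm_num
  rw [symbol, scaled]
  congr 1
  rw [mul_add, ← mul_assoc, h]; ring

/-- Pointwise (1 + |r|) σ ≤ (r² σ)² + 4/(1 + r²): for |r| ≥ 1 this is the inequality between means
for |r|³σ and 2, for |r| ≤ 1 the second term is enough. -/
lemma Assumptions.integrableOn {σ : ℝ → ℝ} (hσ : Assumptions σ) :
    IntegrableOn (fun r => (1 + |r|) * σ r) (Set.Iic 0) := by
  rw [integrableOn_Iic_iff_integrableOn_Iio]
  have h1 : IntegrableOn (fun r => (r ^ 2 * σ r) ^ 2) (Set.Iio 0) := hσ.decay.integrable_sq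
  have h2 : IntegrableOn (fun r : ℝ => 4 * (1 + r ^ 2)⁻¹) (Set.Iio 0) :=
    (integrable_inv_one_add_sq.const_mul 4).integrableOn
  refine (h1.add h2).mono' (((by fun_prop : Continuous fun r : ℝ => 1 + |r|).measurable).mul
    hσ.mono.measurable).aestronglyMeasurable (Eventually.of_forall fun r => ?_)
  obtain ⟨h0, h1⟩ := hσ.mem_Icc r
  rw [Real.norm_of_nonneg (by positivity)]
  simp only [Pi.add_apply]
  have hp : 0 < 1 + r ^ 2 := by positivity
  rw [← div_eq_mul_inv, ← sub_nonneg]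
  have hq : (r ^ 2 * σ r) ^ 2 + 4 / (1 + r ^ 2) - (1 + |r|) * σ r =
      ((r ^ 2 * σ r) ^ 2 * (1 + r ^ 2) + 4 - (1 + |r|) * σ r * (1 + r ^ 2)) / (1 + r ^ 2) := by
    field_simp
  rw [hq]
  refine div_nonneg ?_ hp.le
  rw [← sq_abs r]
  set a := |r|
  have ha : 0 ≤ a := abs_nonneg r
  rcases le_total a 1 with h | h
  · have k1 : (1 + a) * σ r ≤ 2 := by nlinarith
    have k2 : 1 + a ^ 2 ≤ 2 := by nlinarith
    have k3 : (1 + a) * σ r * (1 + a ^ 2) ≤ 2 * 2 :=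
      mul_le_mul k1 k2 (by positivity) (by norm_num)
    nlinarith [mul_nonneg (sq_nonneg (a ^ 2 * σ r)) (by positivity : 0 ≤ 1 + a ^ 2)]
  · have k1 : (1 + a) * σ r * (1 + a ^ 2) ≤ 4 * (a ^ 3 * σ r) := by
      have : (1 + a) * (1 + a ^ 2) ≤ (2 * a) * (2 * a ^ 2) :=
        mul_le_mul (by linarith) (by nlinarith) (by positivity) (by positivity)
      nlinarith
    have k2 : (a ^ 3 * σ r) ^ 2 ≤ (a ^ 2 * σ r) ^ 2 * (1 + a ^ 2) := by
      nlinarith [sq_nonneg (a ^ 2 * σ r)]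
    nlinarith [sq_nonneg (a ^ 3 * σ r - 2)]

lemma Assumptions.isSymbol {σ : ℝ → ℝ} (hσ : Assumptions σ) {t : ℝ} (ht : 0 < t) :
    IsSymbol (scaled σ t) := by
  have hc : 0 < t ^ (-(2 / 3) : ℝ) := Real.rpow_pos_of_pos ht _
  set c := t ^ (-(2 / 3) : ℝ) with hcdef
  have hmono : Monotone (scaled σ t) := fun v w h => hσ.mono (by gcongr)
  refine ⟨fun v => hσ.mem_Icc _, hmono, ?_⟩
  have h1 : Integrable ((Set.Iic 0).indicator fun r => (1 + |r|) * σ r) :=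
    hσ.integrableOn.integrable_indicator measurableSet_Iic
  have h2 := h1.comp_mul_left' hc.ne'
  have h3 : (fun v => (Set.Iic 0).indicator (fun r => (1 + |r|) * σ r) (c * v)) =
      (Set.Iic 0).indicator fun v => (1 + |c * v|) * σ (c * v) := by
    funext v
    have hiff : c * v ≤ 0 ↔ v ≤ 0 := by simpa using mul_le_mul_iff_right₀ hc (b := v) (c := 0)
    simp only [Set.indicator, Set.mem_Iic, hiff]
  rw [h3, integrable_indicator_iff measurableSet_Iic] at h2
  refine (h2.const_mul (1 + c⁻¹)).mono' (((by fun_prop : Continuous fun r : ℝ => 1 + |r|).measurable).mul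
    hmono.measurable).aestronglyMeasurable (Eventually.of_forall fun v => ?_)
  have h0 := (hσ.mem_Icc (c * v)).1
  rw [scaled, ← hcdef, Real.norm_of_nonneg (mul_nonneg (by positivity) h0), ← mul_assoc]
  refine mul_le_mul_of_nonneg_right ?_ h0
  rw [abs_mul, abs_of_pos hc]
  have : c⁻¹ * (c * |v|) = |v| := by field_simp
  nlinarith [abs_nonneg v, inv_pos.2 hc, mul_nonneg hc.le (abs_nonneg v)]

/-- The Stieltjes measure of the rescaled symbol is a push-forward of that of the symbol. -/
lemma Assumptions.map_stieltjes {σ : ℝ → ℝ} (hσ : Assumptions σ) {t : ℝ} (ht : 0 < t) :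
    dMeasure hσ = (hσ.isSymbol ht).mono.stieltjesFunction.measure.map
      (fun v => t ^ (-(2 / 3) : ℝ) * v) := by
  have hc : 0 < t ^ (-(2 / 3) : ℝ) := Real.rpow_pos_of_pos ht _
  have hmono := (hσ.isSymbol ht).mono
  have hlim : ∀ a, hmono.stieltjesFunction (a / t ^ (-(2 / 3) : ℝ)) = hσ.mono.stieltjesFunction a := by
    intro a
    set c := t ^ (-(2 / 3) : ℝ) with hcdef
    have h1 := hσ.mono.tendsto_rightLim a
    -- Scaling by c > 0 preserves right neighbourhoods, so the right limits of σ and of its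
    -- rescaling correspond.
    have h2 : Tendsto (fun v => c * v) (𝓝[>] (a / c)) (𝓝[>] a) := by
      refine tendsto_nhdsWithin_iff.2 ⟨?_, ?_⟩
      · have : Tendsto (fun v => c * v) (𝓝 (a / c)) (𝓝 (c * (a / c))) :=
          (continuous_const_mul c).tendsto _
        rw [mul_div_cancel₀ _ hc.ne'] at this
        exact this.mono_left nhdsWithin_le_nhds
      · filter_upwards [self_mem_nhdsWithin] with v hv
        have hv : a / c < v := hv
        rw [div_lt_iff₀ hc, mul_comm] at hv
        exact hv
    exact _root_.rightLim_eq_of_tendsto (h1.comp h2)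
  have hmeas : Measurable fun v : ℝ => t ^ (-(2 / 3) : ℝ) * v := measurable_const_mul _
  rw [dMeasure]
  refine Measure.ext_of_Ioc _ _ fun a b _ => ?_
  rw [Measure.map_apply hmeas measurableSet_Ioc, Set.preimage_const_mul_Ioc₀ _ _ hc,
    StieltjesFunction.measure_Ioc, StieltjesFunction.measure_Ioc, hlim, hlim]

/-! ### The Fredholm determinant of the statement -/

/-- Factors σ(u i) on the rows and factors √σ on both rows and columns have the same effect on a
determinant, which justifies the symmetric kernel. -/
lemma fredholmIntegrand_eq {σ : ℝ → ℝ} (hσ : Assumptions σ) (x : ℝ) {t : ℝ} (ht : 0 < t) (n : ℕ)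
    (u : Fin n → ℝ) : fredholmIntegrand σ x t n u =
      (gram (kerFun (scaled σ t) (t ^ (-(1 / 3) : ℝ) * x))
        (u + fun _ => t ^ (-(1 / 3) : ℝ) * x)).det := by
  set τ := t ^ (-(1 / 3) : ℝ) * x with hτ
  have h1 : fredholmIntegrand σ x t n u = (∏ i, scaled σ t (u i + τ)) *
      (Matrix.of fun i j : Fin n => airyKernel (u i) (u j)).det := by
    rw [fredholmIntegrand, ← Matrix.det_mul_column]
    simp only [symbol_eq_scaled σ x ht, Matrix.of_apply, hτ]
  have h2 : gram (kerFun (scaled σ t) τ) (u + fun _ => τ) = Matrix.of fun i j =>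
      √(scaled σ t (u i + τ)) * (Matrix.of fun i j => √(scaled σ t (u j + τ)) *
        (Matrix.of fun i j : Fin n => airyKernel (u i) (u j)) i j) i j := by
    ext i j
    simp only [gram, kerFun, Matrix.of_apply, Pi.add_apply, add_sub_cancel_right]
    ring
  rw [h1, h2, Matrix.det_mul_column, Matrix.det_mul_row, ← mul_assoc, ← Finset.prod_mul_distrib]
  simp only [Real.mul_self_sqrt ((hσ.isSymbol ht).nonneg _)]

lemma integrable_fredholmIntegrand {σ : ℝ → ℝ} (hσ : Assumptions σ) (x : ℝ) {t : ℝ} (ht : 0 < t)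
    (n : ℕ) : Integrable (fredholmIntegrand σ x t n) := by
  have h := (isDominated_diagWeight (hσ.isSymbol ht) (t ^ (-(1 / 3) : ℝ) * x)).integrable_det_gram n
  exact (h.comp_add_right fun _ => t ^ (-(1 / 3) : ℝ) * x).congr
    (Eventually.of_forall fun u => (fredholmIntegrand_eq hσ x ht n u).symm)

lemma fredholmTerm_eq {σ : ℝ → ℝ} (hσ : Assumptions σ) (x : ℝ) {t : ℝ} (ht : 0 < t) :
    fredholmTerm σ x t = fredTerm (scaled σ t) (t ^ (-(1 / 3) : ℝ) * x) := by
  funext n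
  rw [fredholmTerm, fredTerm, fredDet]
  simp only [fredholmIntegrand_eq hσ x ht]
  rw [integral_add_right_eq_self
    (fun u : Fin n → ℝ => (gram (kerFun (scaled σ t) (t ^ (-(1 / 3) : ℝ) * x)) u).det)]

lemma Q_eq {σ : ℝ → ℝ} (hσ : Assumptions σ) (x : ℝ) {t : ℝ} (ht : 0 < t) :
    Q σ x t = fredSum (scaled σ t) (t ^ (-(1 / 3) : ℝ) * x) := by
  rw [Q, fredSum, fredholmTerm_eq hσ x ht]


/-! ### The resolvent equation for complex functions -/

lemma integrable_kerFun_apply_mul {σ : ℝ → ℝ} (hσ : IsSymbol σ) (τ v : ℝ) {G : ℝ → ℂ}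
    (hG : MemLp G 2 volume) : Integrable fun w => (kerFun σ τ v w : ℂ) * G w := by
  obtain ⟨b, hb⟩ := exists_isDominated hσ |τ|
  have H := hb τ le_rfl
  have hm : Measurable fun w => kerFun σ τ v w := H.measurable_kernel.comp measurable_prodMk_left
  have hk : MemLp (fun w => (kerFun σ τ v w : ℂ)) 2 volume := by
    refine MemLp.of_le_mul (c := b v) H.memLp
      (Complex.measurable_ofReal.comp hm).aestronglyMeasurable (Eventually.of_forall fun w => ?_)
    rw [Complex.norm_real, Real.norm_of_nonneg (H.nonneg w)]
    exact H.abs_kernel_le v w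
  exact hk.integrable_mul hG

lemma eq_zero_of_sub_integral_eq_zero {σ : ℝ → ℝ} (hσ : IsSymbol σ) (τ : ℝ) {h : ℝ → ℝ}
    (hh : MemLp h 2 volume) (heq : ∀ᵐ v, h v - ∫ w, kerFun σ τ v w * h w = 0) :
    h =ᵐ[volume] 0 := by
  have h1 : toL2 h - airyOp σ τ (toL2 h) = 0 := by
    rw [sub_eq_zero]
    refine Lp.ext ?_
    filter_upwards [heq, coeFn_toL2 hh, coeFn_airyOp hσ τ (toL2 h)] with v h1 h2 h3
    rw [h2, h3, opFun_eq_integral hσ, sub_eq_zero.1 h1]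
    refine integral_congr_ae ?_
    filter_upwards [coeFn_toL2 hh] with w hw
    rw [hw]
  have h2 : toL2 h = 0 := by
    rw [← airyRes_eq_of_sub hσ τ h1, map_zero]
  have h3 := coeFn_toL2 hh
  rw [h2] at h3
  exact h3.symm.trans (Lp.coeFn_zero _ _ _)

/-- The kernel is real, so real and imaginary parts solve the equation separately. -/
lemma eq_zero_of_sub_integral_eq_zero_complex {σ : ℝ → ℝ} (hσ : IsSymbol σ) (τ : ℝ) {G : ℝ → ℂ}
    (hG : MemLp G 2 volume) (heq : ∀ᵐ v, G v - ∫ w, (kerFun σ τ v w : ℂ) * G w = 0) :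
    G =ᵐ[volume] 0 := by
  have hre := eq_zero_of_sub_integral_eq_zero hσ τ hG.re (by
    filter_upwards [heq] with v hv
    have h1 := congrArg Complex.re hv
    have h2 := integral_re (integrable_kerFun_apply_mul hσ τ v hG)
    simp only [RCLike.re_eq_complex_re, Complex.re_ofReal_mul] at h2 ⊢
    rw [Complex.sub_re, ← h2] at h1
    exact h1)
  have him := eq_zero_of_sub_integral_eq_zero hσ τ hG.im (by
    filter_upwards [heq] with v hv
    have h1 := congrArg Complex.im hv
    have h2 := integral_im (integrable_kerFun_apply_mul hσ τ v hG)
    simp only [RCLike.im_eq_complex_im, Complex.im_ofReal_mul] at h2 ⊢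
    rw [Complex.sub_im, ← h2] at h1
    exact h1)
  filter_upwards [hre, him] with v h1 h2
  exact Complex.ext h1 h2

lemma kernel_eq_kerFun (σ : ℝ → ℝ) (x : ℝ) {t : ℝ} (ht : 0 < t) (u v : ℝ) :
    kernel σ x t u v = kerFun (scaled σ t) (t ^ (-(1 / 3) : ℝ) * x)
      (u + t ^ (-(1 / 3) : ℝ) * x) (v + t ^ (-(1 / 3) : ℝ) * x) := by
  rw [kernel, kerFun, symbol_eq_scaled σ x ht, symbol_eq_scaled σ x ht, add_sub_cancel_right,
    add_sub_cancel_right]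

lemma memLp_comp_add {E : Type*} [NormedAddCommGroup E] {F : ℝ → E} (hF : MemLp F 2 volume)
    (τ : ℝ) : MemLp (fun u => F (u + τ)) 2 volume :=
  hF.comp_measurePreserving (measurePreserving_add_right volume τ)

/-- The resolvent equation in the shifted variable. -/
lemma solvesResolvent_iff {σ : ℝ → ℝ} (x : ℝ) {t : ℝ} (ht : 0 < t) (f F : ℝ → ℂ) :
    SolvesResolvent σ x t f (fun u => F (u + t ^ (-(1 / 3) : ℝ) * x)) ↔
      MemLp F 2 volume ∧ ∀ᵐ v, F v - ∫ w, (kerFun (scaled σ t) (t ^ (-(1 / 3) : ℝ) * x) v w : ℂ) * F w =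
        f (v - t ^ (-(1 / 3) : ℝ) * x) := by
  set τ := t ^ (-(1 / 3) : ℝ) * x with hτ
  rw [SolvesResolvent]
  refine and_congr ⟨fun h => ?_, fun h => memLp_comp_add h τ⟩ ?_
  · simpa using memLp_comp_add h (-τ)
  · have hint : ∀ u, ∫ v, (kernel σ x t u v : ℂ) * F (v + τ) =
        ∫ w, (kerFun (scaled σ t) τ (u + τ) w : ℂ) * F w := fun u => by
      simp only [kernel_eq_kerFun σ x ht]
      exact integral_add_right_eq_self
        (fun w => (kerFun (scaled σ t) τ (u + τ) w : ℂ) * F w) τ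
    simp only [hint]
    constructor <;> intro h
    · have := (quasiMeasurePreserving_add_right volume (-τ)).ae h
      simpa [sub_eq_add_neg] using this
    · have := (quasiMeasurePreserving_add_right volume τ).ae h
      simpa using this

lemma SolvesResolvent.ae_eq {σ : ℝ → ℝ} (hσ : Assumptions σ) {x t : ℝ} (ht : 0 < t) {f F G : ℝ → ℂ}
    (hF : SolvesResolvent σ x t f F) (hG : SolvesResolvent σ x t f G) : G =ᵐ[volume] F := by
  set τ := t ^ (-(1 / 3) : ℝ) * x with hτ
  have hF' : SolvesResolvent σ x t f fun u => (fun v => F (v - τ)) (u + τ) := by simpa using hF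
  have hG' : SolvesResolvent σ x t f fun u => (fun v => G (v - τ)) (u + τ) := by simpa using hG
  obtain ⟨mF, eF⟩ := (solvesResolvent_iff x ht f fun v => F (v - τ)).1 hF'
  obtain ⟨mG, eG⟩ := (solvesResolvent_iff x ht f fun v => G (v - τ)).1 hG'
  have hs := hσ.isSymbol ht
  have h0 := eq_zero_of_sub_integral_eq_zero_complex hs τ (mG.sub mF) (by
    filter_upwards [eF, eG] with v h1 h2
    have i1 := integrable_kerFun_apply_mul hs τ v mF
    have i2 := integrable_kerFun_apply_mul hs τ v mG
    simp only [Pi.sub_apply, mul_sub]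
    rw [integral_sub i2 i1]
    linear_combination h2 - h1)
  have := (quasiMeasurePreserving_add_right volume τ).ae h0
  filter_upwards [this] with u hu
  simpa [sub_eq_zero] using hu

/-- A solution of the resolvent equation for a multiple of a real vector. -/
lemma solvesResolvent_airyRes {σ : ℝ → ℝ} (hσ : Assumptions σ) (x : ℝ) {t : ℝ} (ht : 0 < t) (c : ℂ)
    {f : ℝ → ℝ} (hf : MemLp f 2 volume) :
    SolvesResolvent σ x t (fun u => c * f (u + t ^ (-(1 / 3) : ℝ) * x))
      fun u => c * (airyRes (scaled σ t) (t ^ (-(1 / 3) : ℝ) * x) (toL2 f)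
        (u + t ^ (-(1 / 3) : ℝ) * x) : ℂ) := by
  set τ := t ^ (-(1 / 3) : ℝ) * x with hτ
  have hs := hσ.isSymbol ht
  set r := airyRes (scaled σ t) τ (toL2 f) with hr
  refine (solvesResolvent_iff x ht _ (fun v => c * (r v : ℂ))).2
    ⟨((Lp.memLp r).ofReal).const_mul c, ?_⟩
  filter_upwards [coeFn_airyRes hs τ hf] with v hv
  have h1 : ∫ w, (kerFun (scaled σ t) τ v w : ℂ) * (c * (r w : ℂ)) = c * (opFun (scaled σ t) τ r v : ℂ) := by
    rw [opFun_eq_integral hs, ← integral_complex_ofReal, ← integral_const_mul]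
    congr 1; funext w; push_cast; ring
  rw [← hr] at hv
  rw [h1, hv]
  simp only [sub_add_cancel, hτ]
  push_cast; ring

lemma fVec_eq (σ : ℝ → ℝ) (x : ℝ) {t : ℝ} (ht : 0 < t) :
    fVec σ x t 0 = (fun u => -Complex.I * (airyVec' (scaled σ t) (t ^ (-(1 / 3) : ℝ) * x)
      (u + t ^ (-(1 / 3) : ℝ) * x) : ℂ)) ∧
    fVec σ x t 1 = fun u => (1 : ℂ) * (airyVec (scaled σ t) (t ^ (-(1 / 3) : ℝ) * x)
      (u + t ^ (-(1 / 3) : ℝ) * x) : ℂ) := by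
  constructor <;> funext u <;>
    simp only [fVec, symbol_eq_scaled σ x ht, airyVec, airyVec', add_sub_cancel_right] <;>
    simp
  ring

lemma exists_solvesResolvent {σ : ℝ → ℝ} (hσ : Assumptions σ) (x : ℝ) {t : ℝ} (ht : 0 < t)
    (i : Fin 2) : ∃ F, SolvesResolvent σ x t (fVec σ x t i) F := by
  have hs := hσ.isSymbol ht
  fin_cases i
  · exact ⟨_, (fVec_eq σ x ht).1 ▸
      solvesResolvent_airyRes hσ x ht (-Complex.I) (memLp_airyVec' hs _)⟩
  · exact ⟨_, (fVec_eq σ x ht).2 ▸ solvesResolvent_airyRes hσ x ht 1 (memLp_airyVec hs _)⟩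

/-- Uniqueness identifies the chosen solution up to null sets, which is enough inside the integrals
of Y. Only this component is needed, since Ψ₂₁ involves only the second row of Y. -/
lemma FVec_one_eq {σ : ℝ → ℝ} (hσ : Assumptions σ) (x : ℝ) {t : ℝ} (ht : 0 < t) :
    FVec σ x t 1 =ᵐ[volume] fun u => (waveL2 (scaled σ t) (t ^ (-(1 / 3) : ℝ) * x)
      (u + t ^ (-(1 / 3) : ℝ) * x) : ℂ) := by
  have h1 : SolvesResolvent σ x t (fVec σ x t 1) (FVec σ x t 1) :=
    Classical.epsilon_spec (exists_solvesResolvent hσ x ht 1)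
  have h2 := solvesResolvent_airyRes hσ x ht 1 (memLp_airyVec (hσ.isSymbol ht)
    (t ^ (-(1 / 3) : ℝ) * x))
  rw [← (fVec_eq σ x ht).2] at h2
  simp only [one_mul] at h2
  exact SolvesResolvent.ae_eq hσ ht h2 h1

/-! ### The wave function off the real axis -/

/-- The analytic continuation of the wave function, in the variable `ζ = z - τ`. -/
def waveC (σ : ℝ → ℝ) (τ : ℝ) (ζ : ℂ) : ℂ :=
  airyC ζ + ∫ v, (waveL2 σ τ v : ℂ) * (√(σ v) : ℂ) * airyKernelC ζ (v - τ)

lemma waveC_ofReal {σ : ℝ → ℝ} (hσ : IsSymbol σ) (τ z : ℝ) :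
    waveC σ τ ((z - τ : ℝ) : ℂ) = wave σ z τ := by
  rw [waveC, wave, kernelL2, inner_toL2 (memLp_kernelVec hσ τ z), ← ofReal_airy, Complex.ofReal_add,
    ← integral_complex_ofReal]
  congr 2; funext v
  rw [← ofReal_airyKernel, kernelVec]
  push_cast; ring

lemma exists_norm_airyC_add_le (ζ₀ : ℂ) :
    ∃ M, 0 < M ∧ ∀ ζ ∈ Metric.ball ζ₀ 1, ∀ y : ℝ, ‖airyC (ζ + y)‖ ≤ M * Real.exp (-y) := by
  obtain ⟨C, hC, h⟩ := exists_norm_airyC_le (|ζ₀.im| + 1)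
  refine ⟨C * Real.exp (1 - ζ₀.re), by positivity, fun ζ hζ y => ?_⟩
  have hd : ‖ζ - ζ₀‖ < 1 := by rwa [Metric.mem_ball, dist_eq_norm] at hζ
  have him : |ζ.im| ≤ |ζ₀.im| + 1 := by
    have h1 := (Complex.abs_im_le_norm (ζ - ζ₀)).trans hd.le
    rw [Complex.sub_im] at h1
    have h2 := abs_add_le (ζ.im - ζ₀.im) ζ₀.im
    rw [sub_add_cancel] at h2; linarith
  have hre : -ζ.re ≤ 1 - ζ₀.re := by
    have h1 := (Complex.abs_re_le_norm (ζ - ζ₀)).trans hd.le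
    rw [Complex.sub_re] at h1
    linarith [(abs_le.1 h1).1]
  refine (h (ζ + y) (by simpa using him)).1.trans ?_
  rw [mul_assoc, ← Real.exp_add]
  gcongr
  simp only [Complex.add_re, Complex.ofReal_re]; linarith

/-- For p = e^(-y) and q = |Ai(v + y)| use pq ≤ l p² + l⁻¹ q² with l = √(envelope v). The integral
of q² over y > 0 is K(v, v) ≤ D l², so both terms are of order l. -/
lemma exists_norm_airyKernelC_le (ζ₀ : ℂ) :
    ∃ C, 0 < C ∧ ∀ ζ ∈ Metric.ball ζ₀ 1, ∀ v : ℝ, ‖airyKernelC ζ v‖ ≤ C * √(envelope v) := by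
  obtain ⟨M, hM0, h⟩ := exists_norm_airyC_add_le ζ₀
  obtain ⟨D, hD, h'⟩ := exists_airy_le_envelope
  refine ⟨M * (1 + D), by positivity, fun ζ hζ v => ?_⟩
  set l := √(envelope v) with hl
  have hl0 : 0 < l := Real.sqrt_pos.2 (envelope_pos v)
  have hll : l * l = envelope v := Real.mul_self_sqrt (envelope_pos v).le
  have hint : IntegrableOn (fun y : ℝ => M * (l * Real.exp (-2 * y) +
      l⁻¹ * (airy (v + y) * airy (v + y)))) (Set.Ioi 0) :=
    (((exp_neg_integrableOn_Ioi 0 two_pos).const_mul l).add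
      ((integrableOn_airy_mul v v).const_mul l⁻¹)).const_mul M
  rw [airyKernelC]
  refine (norm_integral_le_of_norm_le hint ?_).trans ?_
  · rw [ae_restrict_iff' measurableSet_Ioi]
    refine Eventually.of_forall fun y hy => ?_
    have h1 := h ζ hζ y
    have h2 : ‖airyC (v + y)‖ = |airy (v + y)| := by
      rw [← Complex.ofReal_add, ← ofReal_airy, Complex.norm_real, Real.norm_eq_abs]
    rw [norm_mul, h2]
    have h3 : Real.exp (-y) * |airy (v + y)| ≤ l * Real.exp (-2 * y) +
        l⁻¹ * (airy (v + y) * airy (v + y)) := by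
      rw [← abs_mul_abs_self (airy (v + y)), show -2 * y = -y + -y by ring, Real.exp_add]
      set p := Real.exp (-y)
      set q := |airy (v + y)|
      have hp : 0 < p := Real.exp_pos _
      have hq : 0 ≤ q := abs_nonneg _
      have h4 : l * (p * p) + l⁻¹ * (q * q) - p * q = l⁻¹ * ((l * p) ^ 2 + q ^ 2 - (l * p) * q) := by
        field_simp
      have h5 : 0 ≤ l⁻¹ * ((l * p) ^ 2 + q ^ 2 - (l * p) * q) :=
        mul_nonneg (by positivity) (by nlinarith [sq_nonneg (l * p - q), mul_nonneg (mul_nonneg hl0.le hp.le) hq])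
      linarith
    calc _ ≤ M * Real.exp (-y) * |airy (v + y)| := by gcongr
      _ = M * (Real.exp (-y) * |airy (v + y)|) := by ring
      _ ≤ _ := by gcongr
  · rw [integral_const_mul, integral_add ((exp_neg_integrableOn_Ioi 0 two_pos).const_mul l)
      ((integrableOn_airy_mul v v).const_mul l⁻¹), integral_const_mul, integral_const_mul,
      ← airyKernel_eq_integral, integral_exp_mul_Ioi (by norm_num : (-2 : ℝ) < 0)]
    have h1 : l⁻¹ * airyKernel v v ≤ D * l := by
      rw [inv_mul_le_iff₀ hl0]
      calc _ ≤ D * envelope v := (h' v).1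
        _ = _ := by rw [← hll]; ring
    have h2 : l * (-Real.exp (-2 * 0) / -2) ≤ l := by norm_num; linarith
    calc _ ≤ M * (l + D * l) := by gcongr
      _ = _ := by ring

lemma continuous_airyKernelC (v : ℝ) : Continuous fun ζ => airyKernelC ζ v := by
  refine continuous_iff_continuousAt.2 fun ζ₀ => ?_
  obtain ⟨M, hM, h⟩ := exists_norm_airyC_add_le ζ₀
  obtain ⟨M', hM', h'⟩ := exists_norm_airyC_add_le v
  have hca := continuous_airyC
  refine continuousAt_of_dominated (bound := fun y : ℝ => M * M' * Real.exp (-2 * y)) ?_ ?_ ?_ ?_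
  · exact Eventually.of_forall fun ζ =>
      (by fun_prop : Continuous fun y : ℝ => airyC (ζ + y) * airyC (v + y)).aestronglyMeasurable
  · filter_upwards [Metric.ball_mem_nhds ζ₀ one_pos] with ζ hζ
    refine Eventually.of_forall fun y => ?_
    rw [norm_mul]
    calc _ ≤ (M * Real.exp (-y)) * (M' * Real.exp (-y)) :=
          mul_le_mul (h ζ hζ y) (h' v (Metric.mem_ball_self one_pos) y) (norm_nonneg _)
            (by positivity)
      _ = _ := by rw [show -2 * y = -y + -y by ring, Real.exp_add]; ring
  · exact (exp_neg_integrableOn_Ioi 0 two_pos).const_mul _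
  · exact Eventually.of_forall fun y =>
      (by fun_prop : Continuous fun ζ : ℂ => airyC (ζ + y) * airyC (v + y)).continuousAt

lemma aestronglyMeasurable_airyKernelC (ζ : ℂ) (τ : ℝ) :
    AEStronglyMeasurable (fun v : ℝ => airyKernelC ζ (v - τ)) volume := by
  have hca := continuous_airyC
  have hc : Continuous fun p : ℝ × ℝ => airyC (ζ + p.2) * airyC (((p.1 - τ : ℝ) : ℂ) + p.2) := by
    fun_prop
  exact (hc.stronglyMeasurable.integral_prod_right'
    (ν := volume.restrict (Set.Ioi 0))).aestronglyMeasurable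

/-- Continuity on all of ℂ, across the real axis, is what makes the boundary values from both sides
exist and agree. -/
lemma continuous_waveC {σ : ℝ → ℝ} (hσ : IsSymbol σ) (τ : ℝ) : Continuous (waveC σ τ) := by
  refine continuous_airyC.add (continuous_iff_continuousAt.2 fun ζ₀ => ?_)
  obtain ⟨C, hC, h⟩ := exists_norm_airyKernelC_le ζ₀
  set E := √((1 + |τ|) * Real.exp |τ|) with hE
  have hsh : ∀ v, √(envelope (v - τ)) ≤ E * √(envelope v) := fun v => by
    rw [hE, ← Real.sqrt_mul (by positivity)]
    exact Real.sqrt_le_sqrt (envelope_shift le_rfl v)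
  have hm : AEStronglyMeasurable (fun v => (waveL2 σ τ v : ℂ) * (√(σ v) : ℂ)) volume :=
    (Complex.continuous_ofReal.comp_aestronglyMeasurable
      (Lp.memLp (waveL2 σ τ)).aestronglyMeasurable).mul
      (Complex.measurable_ofReal.comp hσ.measurable.sqrt).aestronglyMeasurable
  have hi : Integrable fun v => (C * E) * (‖waveL2 σ τ v‖ * weight σ v) :=
    ((Lp.memLp (waveL2 σ τ)).norm.integrable_mul hσ.memLp_weight).const_mul _
  refine continuousAt_of_dominated (Eventually.of_forall fun ζ =>
    hm.mul (aestronglyMeasurable_airyKernelC ζ τ)) ?_ hi (Eventually.of_forall fun v => ?_)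
  · filter_upwards [Metric.ball_mem_nhds ζ₀ one_pos] with ζ hζ
    refine Eventually.of_forall fun v => ?_
    rw [norm_mul, norm_mul, Complex.norm_real, Complex.norm_real,
      Real.norm_of_nonneg (Real.sqrt_nonneg _), weight_eq hσ]
    calc _ ≤ ‖waveL2 σ τ v‖ * √(σ v) * (C * (E * √(envelope v))) := by
          gcongr
          have := h ζ hζ (v - τ)
          exact this.trans (by gcongr; exact hsh v)
      _ = _ := by ring
  · have h1 := continuous_airyKernelC (v - τ)
    exact (continuous_const.mul h1).continuousAt


/-! ### Identification of `phiC` and `phi` with the wave function. -/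

lemma hVec_eq (σ : ℝ → ℝ) (x : ℝ) {t : ℝ} (ht : 0 < t) (u : ℝ) :
    hVec σ x t 0 u = -Complex.I * (airyVec (scaled σ t) (t ^ (-(1 / 3) : ℝ) * x)
      (u + t ^ (-(1 / 3) : ℝ) * x) : ℂ) ∧
    hVec σ x t 1 u = (airyVec' (scaled σ t) (t ^ (-(1 / 3) : ℝ) * x)
      (u + t ^ (-(1 / 3) : ℝ) * x) : ℂ) := by
  constructor <;>
    simp only [hVec, symbol_eq_scaled σ x ht, airyVec, airyVec', add_sub_cancel_right] <;>
    simp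
  ring

lemma integrable_mul_div_sub {F G : ℝ → ℂ} (hF : MemLp F 2 volume) (hG : MemLp G 2 volume) {ζ : ℂ}
    (hζ : ζ.im ≠ 0) : Integrable fun ξ : ℝ => F ξ * G ξ / ((ξ : ℂ) - ζ) := by
  have hne : ∀ ξ : ℝ, (ξ : ℂ) - ζ ≠ 0 := fun ξ h => hζ (by simpa using congrArg Complex.im h)
  have hc : Continuous fun ξ : ℝ => ((ξ : ℂ) - ζ)⁻¹ :=
    (Complex.continuous_ofReal.sub continuous_const).inv₀ hne
  have h := (hF.integrable_mul hG).bdd_mul (c := |ζ.im|⁻¹) hc.aestronglyMeasurable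
    (Eventually.of_forall fun ξ => by
      rw [norm_inv]
      refine inv_anti₀ (abs_pos.2 hζ) ?_
      simpa using Complex.abs_im_le_norm ((ξ : ℂ) - ζ))
  refine h.congr (Eventually.of_forall fun ξ => ?_)
  simp only [Pi.mul_apply]
  rw [div_eq_mul_inv, mul_comm]

/-- Off the real axis the function `phiC` is the continuation of the wave function. -/
lemma phiC_eq {σ : ℝ → ℝ} (hσ : Assumptions σ) (x : ℝ) {t : ℝ} (ht : 0 < t) {w : ℂ}
    (hw : w.im ≠ 0) : phiC σ w x t = ((t ^ (1 / 6 : ℝ) : ℝ) : ℂ) *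
      waveC (scaled σ t) (t ^ (-(1 / 3) : ℝ) * x) (zeta x t w) := by
  have hs := hσ.isSymbol ht
  set τ := t ^ (-(1 / 3) : ℝ) * x with hτ
  set ζ := zeta x t w with hζdef
  have hζ : ζ.im ≠ 0 := by
    have h1 : ζ.im = t ^ (2 / 3 : ℝ) * w.im := by simp [hζdef, zeta]
    rw [h1]
    exact mul_ne_zero (Real.rpow_pos_of_pos ht _).ne' hw
  have hne : ∀ ξ : ℝ, (ξ : ℂ) - ζ ≠ 0 := fun ξ h => hζ (by simpa using congrArg Complex.im h)
  set G : ℝ → ℂ := fun u => (waveL2 (scaled σ t) τ (u + τ) : ℂ) with hG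
  have mG : MemLp G 2 volume :=
    memLp_comp_add (F := fun v => (waveL2 (scaled σ t) τ v : ℂ)) (Lp.memLp _).ofReal τ
  have m0 : MemLp (hVec σ x t 0) 2 volume := by
    have := (memLp_comp_add (memLp_airyVec hs τ).ofReal τ).const_mul (-Complex.I)
    exact this.ae_eq (Eventually.of_forall fun u => ((hVec_eq σ x ht u).1).symm)
  have m1 : MemLp (hVec σ x t 1) 2 volume := by
    have := memLp_comp_add (F := fun v => (airyVec' (scaled σ t) τ v : ℂ)) (memLp_airyVec' hs τ).ofReal τ
    exact this.ae_eq (Eventually.of_forall fun u => ((hVec_eq σ x ht u).2).symm)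
  have i0 := integrable_mul_div_sub mG m0 hζ
  have i1 := integrable_mul_div_sub mG m1 hζ
  have hY : ∀ j, ∫ ξ : ℝ, FVec σ x t 1 ξ * hVec σ x t j ξ / ((ξ : ℂ) - ζ) =
      ∫ ξ : ℝ, G ξ * hVec σ x t j ξ / ((ξ : ℂ) - ζ) := fun j => by
    refine integral_congr_ae ?_
    filter_upwards [FVec_one_eq hσ x ht] with ξ hξ
    rw [hξ]
  set A₀ := ∫ ξ : ℝ, G ξ * hVec σ x t 0 ξ / ((ξ : ℂ) - ζ) with hA₀
  set A₁ := ∫ ξ : ℝ, G ξ * hVec σ x t 1 ξ / ((ξ : ℂ) - ζ) with hA₁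
  have hwave : waveC (scaled σ t) τ ζ = airyC ζ + (Complex.I * airyC' ζ * A₀ - airyC ζ * A₁) := by
    rw [waveC, hA₀, hA₁, ← integral_const_mul, ← integral_const_mul,
      ← integral_sub (i0.const_mul _) (i1.const_mul _),
      ← integral_add_right_eq_self _ τ]
    congr 2; funext ξ
    -- The Cauchy kernel 1/(ξ - ζ) disappears: the two entries combine into the Wronskian of Ai at ζ
    -- and ξ, divisible by ζ - ξ. The same happens in both half planes, as the first column of
    -- `PhiAi` is the same there.
    have hW := wronskian_eq_integral ζ ξ
    rw [← airyKernelC] at hW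
    rw [(hVec_eq σ x ht ξ).1, (hVec_eq σ x ht ξ).2, add_sub_cancel_right, ← hτ, airyVec, airyVec',
      add_sub_cancel_right]
    push_cast
    rw [ofReal_airy, ofReal_airy']
    have h0 := hne ξ
    field_simp
    linear_combination (G ξ * (√(scaled σ t (ξ + τ)) : ℂ)) * hW +
      (G ξ * (√(scaled σ t (ξ + τ)) : ℂ) * airyC' ζ * airyC ξ) * Complex.I_sq
  have hΦ0 : PhiAi ζ 0 0 = -(√(2 * Real.pi) : ℂ) * airyC' ζ := by
    unfold PhiAi; split_ifs <;> simp
  have hΦ1 : PhiAi ζ 1 0 = -(√(2 * Real.pi) : ℂ) * (Complex.I * airyC ζ) := by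
    unfold PhiAi; split_ifs <;> simp
  have hY0 : Y σ x t ζ 1 0 = -A₀ := by simp [Y, hY, A₀]
  have hY1 : Y σ x t ζ 1 1 = 1 - A₁ := by simp [Y, hY, A₁]
  have hPsi : Psi σ x t w 1 0 = ((t ^ (1 / 6 : ℝ) : ℝ) : ℂ) *
      (Y σ x t ζ 1 0 * PhiAi ζ 0 0 + Y σ x t ζ 1 1 * PhiAi ζ 1 0) := by
    rw [Psi, ← hζdef]
    simp only [Matrix.mul_apply, Fin.sum_univ_two]
    simp
    ring
  have hpi : (√(2 * Real.pi) : ℂ) ≠ 0 := by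
    exact_mod_cast (Real.sqrt_pos.2 (by positivity)).ne'
  rw [phiC, hPsi, hΦ0, hΦ1, hY0, hY1, hwave]
  field_simp
  linear_combination (-((t ^ (1 / 6 : ℝ) : ℝ) : ℂ) * airyC ζ * (1 - A₁)) * Complex.I_sq

lemma zeta_ofReal (x t : ℝ) (z : ℝ) :
    zeta x t z = ((t ^ (2 / 3 : ℝ) * z - t ^ (-(1 / 3) : ℝ) * x : ℝ) : ℂ) := by
  simp [zeta]

lemma continuous_zeta (x t : ℝ) : Continuous (zeta x t) := by unfold zeta; fun_prop

/-- The boundary values of `phiC` on the real axis. -/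
lemma tendsto_phiC {σ : ℝ → ℝ} (hσ : Assumptions σ) (x z : ℝ) {t : ℝ} (ht : 0 < t) :
    Tendsto (fun w : ℂ => phiC σ w x t) (𝓝[{w : ℂ | w.im ≠ 0}] (z : ℂ))
      (𝓝 ((t ^ (1 / 6 : ℝ) * wave (scaled σ t) (t ^ (2 / 3 : ℝ) * z) (t ^ (-(1 / 3) : ℝ) * x) : ℝ) : ℂ)) := by
  have hs := hσ.isSymbol ht
  have hc : Continuous fun w => ((t ^ (1 / 6 : ℝ) : ℝ) : ℂ) *
      waveC (scaled σ t) (t ^ (-(1 / 3) : ℝ) * x) (zeta x t w) :=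
    continuous_const.mul ((continuous_waveC hs _).comp (continuous_zeta x t))
  have h1 := hc.tendsto (z : ℂ)
  rw [zeta_ofReal, waveC_ofReal hs, ← Complex.ofReal_mul] at h1
  refine (h1.mono_left nhdsWithin_le_nhds).congr' ?_
  filter_upwards [self_mem_nhdsWithin] with w hw
  exact (phiC_eq hσ x ht hw).symm

/-- Without this, the limit in the definition of `phi` would not be determined. -/
lemma neBot_nhdsWithin_im_ne_zero (z : ℂ) : (𝓝[{w : ℂ | w.im ≠ 0}] z).NeBot := by
  refine mem_closure_iff_nhdsWithin_neBot.1 ?_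
  exact (dense_compl_singleton (0 : ℝ)).preimage Complex.isOpenMap_im z

lemma phi_eq {σ : ℝ → ℝ} (hσ : Assumptions σ) (x z : ℝ) {t : ℝ} (ht : 0 < t) :
    phi σ z x t = t ^ (1 / 6 : ℝ) *
      wave (scaled σ t) (t ^ (2 / 3 : ℝ) * z) (t ^ (-(1 / 3) : ℝ) * x) := by
  have := neBot_nhdsWithin_im_ne_zero (z : ℂ)
  rw [phi, (tendsto_phiC hσ x z ht).limUnder_eq, Complex.ofReal_re]

lemma rpow_two_thirds_mul {t : ℝ} (ht : 0 < t) (v : ℝ) :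
    t ^ (2 / 3 : ℝ) * (t ^ (-(2 / 3) : ℝ) * v) = v := by
  rw [← mul_assoc, ← Real.rpow_add ht]; norm_num

lemma sq_rpow_sixth {t : ℝ} (ht : 0 < t) : (t ^ (1 / 6 : ℝ)) ^ 2 = t ^ (1 / 3 : ℝ) := by
  rw [← Real.rpow_natCast, ← Real.rpow_mul ht.le]; norm_num

/-- The substitution r = t^(-2/3) v carries the Stieltjes measure of the rescaled symbol to dσ, and
the squared prefactor t^(1/6) becomes t^(1/3). -/
lemma integrable_phi_sq {σ : ℝ → ℝ} (hσ : Assumptions σ) (x : ℝ) {t : ℝ} (ht : 0 < t) :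
    Integrable (fun r => phi σ r x t ^ 2) (dMeasure hσ) ∧
    ∫ r, phi σ r x t ^ 2 ∂(dMeasure hσ) = t ^ (1 / 3 : ℝ) *
      (waveQ (scaled σ t) (t ^ (-(1 / 3) : ℝ) * x) ^ 2 -
        2 * waveP (scaled σ t) (t ^ (-(1 / 3) : ℝ) * x)) := by
  have hs := hσ.isSymbol ht
  have hemb : MeasurableEmbedding fun v : ℝ => t ^ (-(2 / 3) : ℝ) * v :=
    measurableEmbedding_mulLeft₀ (Real.rpow_pos_of_pos ht _).ne'
  have hval : ∀ v, phi σ (t ^ (-(2 / 3) : ℝ) * v) x t ^ 2 =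
      t ^ (1 / 3 : ℝ) * wave (scaled σ t) v (t ^ (-(1 / 3) : ℝ) * x) ^ 2 := fun v => by
    rw [phi_eq hσ x _ ht, rpow_two_thirds_mul ht, mul_pow, sq_rpow_sixth ht]
  rw [hσ.map_stieltjes ht, hemb.integrable_map_iff, hemb.integral_map]
  simp only [Function.comp_def, hval]
  exact ⟨(integrable_wave_sq hs _).const_mul _, by
    rw [integral_const_mul, waveQ_sq_sub_eq_integral hs]⟩

end AiryKdV

end

/-! ### The theorem, by the chain rule in x. -/

theorem corollary1p3 (σ : ℝ → ℝ) (hσ : AiryKdV.Assumptions σ) (t : ℝ) (ht : 0 < t) :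
    -- the objects are well defined: the Fredholm determinant, ...
    (∀ x : ℝ, (∀ k : ℕ, Integrable (AiryKdV.fredholmIntegrand σ x t k)) ∧
      Summable (AiryKdV.fredholmTerm σ x t) ∧ 0 < AiryKdV.Q σ x t) ∧
    -- ... the vector `(1 - K)⁻¹ f`, ...
    (∀ (x : ℝ) (i : Fin 2), ∃ F : ℝ → ℂ,
      AiryKdV.SolvesResolvent σ x t (AiryKdV.fVec σ x t i) F ∧
      ∀ G : ℝ → ℂ, AiryKdV.SolvesResolvent σ x t (AiryKdV.fVec σ x t i) G → G =ᵐ[volume] F) ∧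
    -- ... the boundary values that define `φ_σ` on the real line, and the integral `∫ φ_σ² dσ`
    (∀ x z : ℝ, Tendsto (fun w : ℂ => AiryKdV.phiC σ w x t) (𝓝[{w : ℂ | w.im ≠ 0}] (z : ℂ))
      (𝓝 ((AiryKdV.phi σ z x t : ℝ) : ℂ))) ∧
    (∀ x : ℝ, Integrable (fun r : ℝ => AiryKdV.phi σ r x t ^ 2) (AiryKdV.dMeasure hσ)) ∧
    -- the formula for `∂ₓ² log Q_σ`
    Differentiable ℝ (fun x : ℝ => Real.log (AiryKdV.Q σ x t)) ∧
    (∀ x : ℝ, HasDerivAt (deriv fun x' : ℝ => Real.log (AiryKdV.Q σ x' t))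
      (-(1 / t) * ∫ r, AiryKdV.phi σ r x t ^ 2 ∂(AiryKdV.dMeasure hσ)) x) ∧
    -- the integro-differential Painlevé II equation
    (∀ z : ℝ, Differentiable ℝ (fun x : ℝ => AiryKdV.phi σ z x t) ∧
      ∀ x : ℝ, HasDerivAt (deriv fun x' : ℝ => AiryKdV.phi σ z x' t)
        ((z - x / t + 2 / t * ∫ r, AiryKdV.phi σ r x t ^ 2 ∂(AiryKdV.dMeasure hσ))
          * AiryKdV.phi σ z x t) x) := by
  have hs := hσ.isSymbol ht
  set b := t ^ (-(1 / 3) : ℝ) with hb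
  have hbx : ∀ x, HasDerivAt (fun x : ℝ => b * x) b x := fun x => by
    simpa using (hasDerivAt_id x).const_mul b
  -- Two x-derivatives bring the factor b². The next three identities convert b² times t^(2/3) z - b
  -- x + 2q' into z - x/t + (2/t) ∫ φ² dσ, where ∫ φ² dσ = t^(1/3) q'.
  have hbb : b ^ 2 * b = t⁻¹ := by
    rw [← pow_succ, ← Real.rpow_natCast, hb, ← Real.rpow_mul ht.le, ← Real.rpow_neg_one]; norm_num
  have hba : b ^ 2 * t ^ (2 / 3 : ℝ) = 1 := by
    rw [← Real.rpow_natCast, hb, ← Real.rpow_mul ht.le, ← Real.rpow_add ht]; norm_num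
  have hbt : b ^ 2 = t⁻¹ * t ^ (1 / 3 : ℝ) := by
    rw [← Real.rpow_natCast, hb, ← Real.rpow_mul ht.le, ← Real.rpow_neg_one, ← Real.rpow_add ht]
    norm_num
  have hlog : ∀ x, HasDerivAt (fun x => Real.log (AiryKdV.Q σ x t))
      (-AiryKdV.waveQ (AiryKdV.scaled σ t) (b * x) * b) x := fun x => by
    simp only [AiryKdV.Q_eq hσ _ ht]
    exact (AiryKdV.hasDerivAt_log_fredSum hs (b * x)).comp x (hbx x)
  have hphi : ∀ z x, HasDerivAt (fun x => AiryKdV.phi σ z x t)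
      (t ^ (1 / 6 : ℝ) * ((AiryKdV.waveQ (AiryKdV.scaled σ t) (b * x) *
        AiryKdV.wave (AiryKdV.scaled σ t) (t ^ (2 / 3 : ℝ) * z) (b * x) -
        AiryKdV.coWave (AiryKdV.scaled σ t) (t ^ (2 / 3 : ℝ) * z) (b * x)) * b)) x := fun z x => by
    simp only [AiryKdV.phi_eq hσ _ z ht]
    exact ((AiryKdV.hasDerivAt_wave hs (t ^ (2 / 3 : ℝ) * z) (b * x)).comp x (hbx x)).const_mul _
  refine ⟨fun x => ⟨AiryKdV.integrable_fredholmIntegrand hσ x ht, ?_, ?_⟩, fun x i => ?_,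
    fun x z => ?_, fun x => (AiryKdV.integrable_phi_sq hσ x ht).1,
    fun x => (hlog x).differentiableAt, fun x => ?_, fun z =>
    ⟨fun x => (hphi z x).differentiableAt, fun x => ?_⟩⟩
  · rw [AiryKdV.fredholmTerm_eq hσ x ht]
    exact AiryKdV.summable_fredTerm hs _
  · rw [AiryKdV.Q_eq hσ x ht]
    exact AiryKdV.fredSum_pos hs _
  · obtain ⟨F, hF⟩ := AiryKdV.exists_solvesResolvent hσ x ht i
    exact ⟨F, hF, fun G hG => AiryKdV.SolvesResolvent.ae_eq hσ ht hF hG⟩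
  · rw [AiryKdV.phi_eq hσ x z ht]
    exact AiryKdV.tendsto_phiC hσ x z ht
  · rw [funext fun x => (hlog x).deriv, (AiryKdV.integrable_phi_sq hσ x ht).2]
    refine ((((AiryKdV.hasDerivAt_waveQ hs (b * x)).comp x (hbx x)).fun_neg).mul_const b).congr_deriv ?_
    rw [one_div]
    linear_combination (-(AiryKdV.waveQ (AiryKdV.scaled σ t) (b * x) ^ 2 -
      2 * AiryKdV.waveP (AiryKdV.scaled σ t) (b * x))) * hbt
  · rw [funext fun x => (hphi z x).deriv, (AiryKdV.integrable_phi_sq hσ x ht).2,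
      AiryKdV.phi_eq hσ x z ht]
    refine ((((AiryKdV.hasDerivAt_deriv_wave hs (t ^ (2 / 3 : ℝ) * z) (b * x)).comp x
      (hbx x)).mul_const b).const_mul (t ^ (1 / 6 : ℝ))).congr_deriv ?_
    rw [div_eq_mul_inv x t, div_eq_mul_inv 2 t]
    set W := AiryKdV.wave (AiryKdV.scaled σ t) (t ^ (2 / 3 : ℝ) * z) (b * x)
    set V := AiryKdV.waveQ (AiryKdV.scaled σ t) (b * x) ^ 2 -
      2 * AiryKdV.waveP (AiryKdV.scaled σ t) (b * x)
    linear_combination (t ^ (1 / 6 : ℝ) * W) * (z * hba - x * hbb + 2 * V * hbt)
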